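/- Let $\Bbbk$ be a field, $G$ an abelian group (written additively) and $\chi:G\times G\to\Bbbk^*$ an alternating bicharacter, i.e. $\chi$ is multiplicative in each variable and $\chi(\sigma,\sigma)=1$. Let $Q$ be a $\chi$-color commutative $G$-graded $\Bbbk$-algebra ($xy=\chi(x,y)yx$ for homogeneous $x,y$). A color DG $Q$-algebra $A$ is a DG $Q$-algebra (differential $\partial$ of degree $-1$) with a $G$-grading that is preserved by $\partial$ and extends the grading of $Q$, such that $xy=(-1)^{|x||y|}\chi(x,y)yx$ for homogeneous $x,y$, and $x^2=0$ for homogeneous $x$ of odd homological degree. Left color DG modules over $A^{\mathrm e}=A\otimes_QA$ are the color DG $A$-bimodules on which $Q$ acts symmetrically ($qm=\chi(q,m)mq$), with $(a\otimes b)m=(-1)^{|b||m|}\chi(b,m)\,amb$. $\operatorname{Hom}_{A^{\mathrm e}}(M,N)$ is bigraded by homological degree and color, its elements being sums of homogeneous maps $f$ with $f(xm)=(-1)^{|f||x|}\chi(f,x)\,x f(m)$, and has differential $f\mapsto\partial f-(-1)^{|f|}f\partial$; tensor products of maps are $(f\otimes g)(m\otimes n)=(-1)^{|g||m|}\chi(g,m)\,f(m)\otimes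 g(n)$. A color DG $A^{\mathrm e}$-module $P$ is semiprojective if $\operatorname{Hom}_{A^{\mathrm e}}(P,-)$ preserves surjections and quasi-isomorphisms. For a morphism $\varepsilon:P\to A$ of color DG $A^{\mathrm e}$-modules, a co-unital diagonal approximation for $\varepsilon$ is a morphism of color DG $A^{\mathrm e}$-modules $\Phi:P\to P\otimes_AP$ with $(\varepsilon\otimes1)\Phi=\mathrm{id}_P=(1\otimes\varepsilon)\Phi$, where $A\otimes_AP=P=P\otimes_AA$ through multiplication. (1) Let $A$ be a color DG $Q$-algebra, $\varepsilon:P\to A$ a semiprojective resolution of $A$ over $A^{\mathrm e}$ (a quasi-isomorphism with $P$ semiprojective), $\Phi$ a co-unital diagonal approximation for $\varepsilon$, and $X$ a color DG $A^{\mathrm e}$-module. Put $\operatorname{Ext}_{A^{\mathrm e}}(A,X)=H(\operatorname{Hom}_{A^{\mathrm e}}(P,X))$, and identify $\operatorname{Ext}_{A^{\mathrm e}}(A,A)=H(\operatorname{Hom}_{A^{\mathrm e}}(P,A))$ with $H(\operatorname{Hom}_{A^{\mathrm e}}(P,P))$ by means of $\varepsilon$. Then the cup action of $\operatorname{Ext}_{A^{\mathrm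 e}}(A,A)$ on $\operatorname{Ext}_{A^{\mathrm e}}(A,X)$, induced by $$\sigma\cup\tau=\mu\,(\sigma\otimes(\varepsilon\tau))\,\Phi,\qquad \sigma\in\operatorname{Hom}_{A^{\mathrm e}}(P,X),\ \tau\in\operatorname{Hom}_{A^{\mathrm e}}(P,P),\ \mu(x\otimes a)=xa,$$ coincides with the composition action, induced by $(\sigma,\tau)\mapsto\sigma\tau$. (2) Let $f_1,\dots,f_c\in Q$ be $G$-homogeneous of colors $\delta_1,\dots,\delta_c$, let $E=Q\langle e_1,\dots,e_c\mid\partial e_i=f_i\rangle$ be the (skew) Koszul complex, with $e_i$ of homological degree $1$ and color $\delta_i$, and let $E^{\mathrm e}\langle Y\rangle=E^{\mathrm e}\langle y_1,\dots,y_c\mid\partial y_i=e_i\otimes1-1\otimes e_i\rangle$ be obtained from $E^{\mathrm e}$ by adjoining (skew) divided power variables $y_i$ of homological degree $2$ and color $\delta_i$; it is free over $E^{\mathrm e}$, disregarding differentials, on the $y^{(H)}=y_1^{(h_1)}\cdots y_c^{(h_c)}$, $H\in\mathbb N^c$. Let $\epsilon:E^{\mathrm e}\langle Y\rangle\to E$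 be the augmentation $(a\otimes b)y^{(H)}\mapsto ab$ if $H=0$ and $\mapsto0$ if $H\ne0$. Then $\epsilon$ admits a co-unital diagonal approximation $\Phi:E^{\mathrm e}\langle Y\rangle\to E^{\mathrm e}\langle Y\rangle\otimes_EE^{\mathrm e}\langle Y\rangle$ with $\Phi(y_i)=y_i\otimes1+1\otimes y_i$ for all $i$, namely the unique one that is given by the resulting divided power formula $$\Phi(y^{(H)})=\sum_{H'+H''=H}\Bigl(\prod_{i<j}\chi(y_i,y_j)^{h'_jh''_i}\Bigr)\,y^{(H')}\otimes y^{(H'')}\qquad\text{for all }H\in\mathbb N^c.$$ -/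

import Mathlib

universe u v w uv uw uk uG

noncomputable section

namespace ColorDG

/-! ### Gradings -/

section Grading

variable {ι : Type*} {k : Type*} [Field k] {M : Type*} [AddCommGroup M] [Module k M]
  {N : Type*} [AddCommGroup N] [Module k N]

/-- `M` is the internal direct sum of the subspaces `gr i`. -/
def IsGrading (gr : ι → Submodule k M) : Prop := iSupIndep gr ∧ ⨆ i, gr i = ⊤

theorem isGrading_of_dec {gr : ι → Submodule k M} (dec : M →ₗ[k] (ι →₀ M))
    (h : ∀ i, ∀ m ∈ gr i, dec m = Finsupp.single i m) (top : ⨆ i, gr i = ⊤) :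
    IsGrading gr := by
  refine ⟨?_, top⟩
  rw [iSupIndep_def]
  intro i
  rw [Submodule.disjoint_def]
  intro x hx hx'
  have h1 : (⨆ (j) (_ : j ≠ i), gr j) ≤ LinearMap.ker ((Finsupp.lapply i).comp dec) := by
    refine iSup_le fun j => iSup_le fun hj => ?_
    intro y hy
    simp [h j y hy, hj]
  have h2 := h1 hx'
  simpa [h i x hx] using h2

theorem IsGrading.exists_dec {gr : ι → Submodule k M} (hg : IsGrading gr) :
    ∃ dec : M →ₗ[k] (ι →₀ M), ∀ i, ∀ m ∈ gr i, dec m = Finsupp.single i m := by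
  classical
  have hi := (DirectSum.isInternal_submodule_iff_iSupIndep_and_iSup_eq_top gr).2 hg
  let e := LinearEquiv.ofBijective (DirectSum.coeLinearMap gr) hi
  refine ⟨(DirectSum.toModule k ι (ι →₀ M)
    (fun i => (Finsupp.lsingle i).comp (gr i).subtype)).comp e.symm.toLinearMap, ?_⟩
  intro i m hm
  have : e.symm m = DirectSum.lof k ι (fun i => gr i) i ⟨m, hm⟩ := by
    rw [LinearEquiv.symm_apply_eq]
    change m = DirectSum.coeLinearMap gr _
    simp
  simp [this]

/-- The decomposition of an element into its homogeneous components. -/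
def IsGrading.dec {gr : ι → Submodule k M} (hg : IsGrading gr) : M →ₗ[k] (ι →₀ M) :=
  hg.exists_dec.choose

theorem IsGrading.dec_of_mem {gr : ι → Submodule k M} (hg : IsGrading gr) {i : ι} {m : M}
    (hm : m ∈ gr i) : hg.dec m = Finsupp.single i m :=
  hg.exists_dec.choose_spec i m hm

/-- The linear map that multiplies a homogeneous element of degree `i` by the scalar `c i`. -/
def IsGrading.scale {gr : ι → Submodule k M} (hg : IsGrading gr) (c : ι → k) : M →ₗ[k] M :=
  (Finsupp.lsum k fun i => c i • (LinearMap.id : M →ₗ[k] M)).comp hg.dec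

theorem IsGrading.scale_of_mem {gr : ι → Submodule k M} (hg : IsGrading gr) (c : ι → k)
    {i : ι} {m : M} (hm : m ∈ gr i) : hg.scale c m = c i • m := by
  simp [IsGrading.scale, hg.dec_of_mem hm]

theorem IsGrading.scale_mem {gr : ι → Submodule k M} (hg : IsGrading gr) (c : ι → k)
    {i : ι} {m : M} (hm : m ∈ gr i) : hg.scale c m ∈ gr i := by
  rw [hg.scale_of_mem c hm]
  exact Submodule.smul_mem _ _ hm

theorem IsGrading.induction {gr : ι → Submodule k M} (hg : IsGrading gr) {p : M → Prop}
    (mem : ∀ i, ∀ m ∈ gr i, p m) (add : ∀ x y, p x → p y → p (x + y)) (zero : p 0) (m : M) :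
    p m :=
  Submodule.iSup_induction gr (motive := p) (hg.2 ▸ Submodule.mem_top : m ∈ ⨆ i, gr i)
    mem zero add

theorem IsGrading.linext {gr : ι → Submodule k M} (hg : IsGrading gr) {f g : M →ₗ[k] N}
    (h : ∀ i, ∀ m ∈ gr i, f m = g m) : f = g := by
  ext m
  refine hg.induction (p := fun m => f m = g m) h ?_ (by simp) m
  intro x y hx hy
  simp [hx, hy]

theorem IsGrading.linext₂ {κ : Type*} {gr : ι → Submodule k M} (hg : IsGrading gr)
    {gr' : κ → Submodule k N} (hg' : IsGrading gr') {V : Type*} [AddCommGroup V] [Module k V]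
    {f g : M →ₗ[k] N →ₗ[k] V}
    (h : ∀ i, ∀ m ∈ gr i, ∀ j, ∀ n ∈ gr' j, f m n = g m n) : f = g :=
  hg.linext fun i m hm => hg'.linext fun j n hn => h i m hm j n hn

end Grading

/-! ### Bicharacters -/

/-- An alternating bicharacter on the (additively written) abelian group `G` of colors. -/
structure AltBichar (G : Type uG) [AddCommGroup G] (k : Type uk) [Field k] where
  toFun : G → G → kˣ
  add_left : ∀ a b c, toFun (a + b) c = toFun a c * toFun b c
  add_right : ∀ a b c, toFun a (b + c) = toFun a b * toFun a c
  alt : ∀ a, toFun a a = 1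

/-- The sign `(-1)^i` in the field `k`. -/
def sg (k : Type uk) [Field k] (i : ℤ) : k := (-1) ^ i

section Signs

variable {k : Type uk} [Field k]

@[simp] theorem sg_zero : sg k 0 = 1 := by simp [sg]
@[simp] theorem sg_one : sg k 1 = -1 := by simp [sg]

theorem sg_add (i j : ℤ) : sg k (i + j) = sg k i * sg k j := by
  simp [sg, zpow_add₀]

theorem sg_sub (i j : ℤ) : sg k (i - j) = sg k i * sg k j := by
  rw [sg, zpow_sub₀ (by simp), div_eq_mul_inv, ← inv_zpow]; simp [sg, inv_neg]

theorem sg_even {i : ℤ} (h : Even i) : sg k i = 1 := h.neg_one_zpow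
theorem sg_odd {i : ℤ} (h : Odd i) : sg k i = -1 := h.neg_one_zpow

@[simp] theorem sg_mul_self (i : ℤ) : sg k i * sg k i = 1 := by
  rcases Int.even_or_odd i with h | h <;> simp [sg_even, sg_odd, h]

end Signs

/-- The group of bidegrees: homological degree and color. -/
abbrev Deg (G : Type uG) := ℤ × G

/-- The bidegree `(1, 0)`. -/
abbrev one₁ (G : Type uG) [AddCommGroup G] : Deg G := (1, 0)

section Bichar

variable {G : Type uG} [AddCommGroup G] {k : Type uk} [Field k] (χ : AltBichar G k)

/-- The values of the bicharacter as scalars. -/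
def AltBichar.c (a b : G) : k := (χ.toFun a b : k)

/-- The commutation factor `(-1)^{|x||y|} χ(x, y)` of bidegrees. -/
def AltBichar.β (s t : Deg G) : k := sg k (s.1 * t.1) * χ.c s.2 t.2

theorem AltBichar.c_add_left (a b c : G) : χ.c (a + b) c = χ.c a c * χ.c b c := by
  simp [AltBichar.c, χ.add_left]

theorem AltBichar.c_add_right (a b c : G) : χ.c a (b + c) = χ.c a b * χ.c a c := by
  simp [AltBichar.c, χ.add_right]

@[simp] theorem AltBichar.c_self (a : G) : χ.c a a = 1 := by simp [AltBichar.c, χ.alt]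

theorem AltBichar.c_swap (a b : G) : χ.c a b * χ.c b a = 1 := by
  have := χ.c_self (a + b)
  rw [χ.c_add_left, χ.c_add_right, χ.c_add_right] at this
  simpa using this

theorem AltBichar.c_ne_zero (a b : G) : χ.c a b ≠ 0 := by simp [AltBichar.c]

@[simp] theorem AltBichar.c_zero_left (b : G) : χ.c 0 b = 1 := by
  have h := χ.c_add_left 0 0 b
  have h0 := χ.c_ne_zero 0 b
  rw [add_zero] at h
  exact (mul_eq_left₀ h0).1 h.symm

@[simp] theorem AltBichar.c_zero_right (b : G) : χ.c b 0 = 1 := by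
  have h := χ.c_swap b 0
  simpa using h

theorem AltBichar.c_neg_left (a b : G) : χ.c (-a) b = χ.c b a := by
  have h1 : χ.c (-a) b * χ.c a b = 1 := by rw [← χ.c_add_left]; simp
  have h2 := χ.c_swap b a
  exact mul_right_cancel₀ (χ.c_ne_zero a b) (h1.trans h2.symm)

theorem AltBichar.c_neg_right (a b : G) : χ.c a (-b) = χ.c b a := by
  have h1 : χ.c a (-b) * χ.c a b = 1 := by rw [← χ.c_add_right]; simp
  have h2 := χ.c_swap b a
  exact mul_right_cancel₀ (χ.c_ne_zero a b) (h1.trans h2.symm)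

theorem AltBichar.β_add_left (a b c : Deg G) : χ.β (a + b) c = χ.β a c * χ.β b c := by
  simp only [AltBichar.β, Prod.fst_add, Prod.snd_add, add_mul, sg_add, χ.c_add_left]; ring

theorem AltBichar.β_add_right (a b c : Deg G) : χ.β a (b + c) = χ.β a b * χ.β a c := by
  simp only [AltBichar.β, Prod.fst_add, Prod.snd_add, mul_add, sg_add, χ.c_add_right]; ring

theorem AltBichar.β_swap (a b : Deg G) : χ.β a b * χ.β b a = 1 := by
  simp only [AltBichar.β]
  rw [mul_mul_mul_comm, χ.c_swap, mul_comm b.1, sg_mul_self, one_mul]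

theorem AltBichar.β_self (a : Deg G) : χ.β a a = sg k a.1 := by
  have : sg k (a.1 * a.1) = sg k a.1 := by
    rcases Int.even_or_odd a.1 with h | h
    · rw [sg_even h, sg_even (h.mul_left _)]
    · rw [sg_odd h, sg_odd (h.mul h)]
  simp [AltBichar.β, this]

@[simp] theorem AltBichar.β_zero_left (b : Deg G) : χ.β 0 b = 1 := by simp [AltBichar.β]
@[simp] theorem AltBichar.β_zero_right (b : Deg G) : χ.β b 0 = 1 := by simp [AltBichar.β]

theorem AltBichar.β_sub_one_left (a b : Deg G) :
    χ.β (a - one₁ G) b = sg k b.1 * χ.β a b := by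
  simp only [AltBichar.β, Prod.fst_sub, Prod.snd_sub, sub_mul, sg_sub, sub_zero, one_mul]; ring

theorem AltBichar.β_sub_one_right (a b : Deg G) :
    χ.β a (b - one₁ G) = sg k a.1 * χ.β a b := by
  simp only [AltBichar.β, Prod.fst_sub, Prod.snd_sub, mul_sub, sg_sub, sub_zero, mul_one]; ring

theorem AltBichar.β_deg_zero_left (a : G) (b : Deg G) : χ.β (0, a) b = χ.c a b.2 := by
  simp [AltBichar.β]

end Bichar

/-! ### Color commutative rings, color DG algebras, color DG bimodules -/

/-- A `χ`-color commutative `G`-graded `k`-algebra. -/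
structure ColorRing {G : Type uG} [AddCommGroup G] {k : Type uk} [Field k]
    (χ : AltBichar G k) where
  carrier : Type u
  [ring : Ring carrier]
  [algebra : Algebra k carrier]
  gr : G → Submodule k carrier
  isGrading : IsGrading gr
  one_mem : (1 : carrier) ∈ gr 0
  mul_mem : ∀ {a b : G} {x y : carrier}, x ∈ gr a → y ∈ gr b → x * y ∈ gr (a + b)
  color_comm : ∀ {a b : G} {x y : carrier}, x ∈ gr a → y ∈ gr b →
    x * y = χ.c a b • (y * x)

attribute [instance] ColorRing.ring ColorRing.algebra

variable {G : Type uG} [AddCommGroup G] {k : Type uk} [Field k] {χ : AltBichar G k}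

/-- A (graded color commutative) color DG `Q`-algebra. The differential lowers the homological
degree by one and preserves colors; `unit` is the structure map. -/
structure ColorDGAlg (Q : ColorRing.{u} χ) where
  carrier : Type u
  [ring : Ring carrier]
  [algebra : Algebra k carrier]
  gr : Deg G → Submodule k carrier
  isGrading : IsGrading gr
  one_mem : (1 : carrier) ∈ gr 0
  mul_mem : ∀ {s t : Deg G} {x y : carrier}, x ∈ gr s → y ∈ gr t → x * y ∈ gr (s + t)
  d : carrier →ₗ[k] carrier
  d_mem : ∀ {s : Deg G} {x : carrier}, x ∈ gr s → d x ∈ gr (s - one₁ G)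
  d_d : ∀ x, d (d x) = 0
  leibniz : ∀ {s : Deg G} {x : carrier}, x ∈ gr s → ∀ y,
    d (x * y) = d x * y + sg k s.1 • (x * d y)
  unit : Q.carrier →ₐ[k] carrier
  unit_mem : ∀ {a : G} {q : Q.carrier}, q ∈ Q.gr a → unit q ∈ gr (0, a)
  d_unit : ∀ q, d (unit q) = 0
  color_comm : ∀ {s t : Deg G} {x y : carrier}, x ∈ gr s → y ∈ gr t →
    x * y = χ.β s t • (y * x)
  odd_sq : ∀ {s : Deg G} {x : carrier}, Odd s.1 → x ∈ gr s → x * x = 0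

attribute [instance] ColorDGAlg.ring ColorDGAlg.algebra

/-- A color DG `A`-`B`-bimodule over `Q`: commuting left and right actions, compatible with the
gradings and the differential, on which `Q` acts symmetrically, `q m = χ(q, m) m q`.
For `A = B` this is the same thing as a left color DG module over the enveloping algebra
`Aᵉ = A ⊗_Q A`, with `(a ⊗ b) m = (-1)^{|b||m|} χ(b, m) a m b`.
Here `lact a m` is `a m` and `ract b m` is `m b`. -/
structure ColorDGBimod {Q : ColorRing.{u} χ} (A B : ColorDGAlg Q) where
  carrier : Type v
  [group : AddCommGroup carrier]
  [module : Module k carrier]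
  gr : Deg G → Submodule k carrier
  isGrading : IsGrading gr
  lact : A.carrier →ₗ[k] carrier →ₗ[k] carrier
  ract : B.carrier →ₗ[k] carrier →ₗ[k] carrier
  one_lact : ∀ m, lact 1 m = m
  mul_lact : ∀ a a' m, lact (a * a') m = lact a (lact a' m)
  one_ract : ∀ m, ract 1 m = m
  mul_ract : ∀ b b' m, ract (b * b') m = ract b' (ract b m)
  lact_ract : ∀ a b m, lact a (ract b m) = ract b (lact a m)
  lact_mem : ∀ {s t : Deg G} {a m}, a ∈ A.gr s → m ∈ gr t → lact a m ∈ gr (s + t)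
  ract_mem : ∀ {s t : Deg G} {b m}, m ∈ gr s → b ∈ B.gr t → ract b m ∈ gr (s + t)
  d : carrier →ₗ[k] carrier
  d_mem : ∀ {s : Deg G} {m}, m ∈ gr s → d m ∈ gr (s - one₁ G)
  d_d : ∀ m, d (d m) = 0
  d_lact : ∀ {s : Deg G} {a}, a ∈ A.gr s → ∀ m,
    d (lact a m) = lact (A.d a) m + sg k s.1 • lact a (d m)
  d_ract : ∀ {s : Deg G} {m}, m ∈ gr s → ∀ b,
    d (ract b m) = ract b (d m) + sg k s.1 • ract (B.d b) m
  symm : ∀ {a : G} {q} {s : Deg G} {m}, q ∈ Q.gr a → m ∈ gr s →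
    lact (A.unit q) m = χ.c a s.2 • ract (B.unit q) m

attribute [instance] ColorDGBimod.group ColorDGBimod.module

variable {Q : ColorRing.{u} χ}

/-! ### Regular bimodules and restriction of scalars -/

/-- `Q` as a color DG `Q`-algebra concentrated in homological degree zero. -/
def ColorRing.toDGAlg (Q : ColorRing.{u} χ) : ColorDGAlg Q where
  carrier := Q.carrier
  gr s := if s.1 = 0 then Q.gr s.2 else ⊥
  isGrading := by
    refine isGrading_of_dec ((Finsupp.lmapDomain Q.carrier k fun a : G => ((0 : ℤ), a)).comp
      Q.isGrading.dec) ?_ ?_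
    · rintro ⟨i, a⟩ m hm
      by_cases hi : i = 0
      · subst hi
        simp only [if_true] at hm
        simp [Q.isGrading.dec_of_mem hm]
      · simp only [hi, if_false, Submodule.mem_bot] at hm
        simp [hm]
    · rw [eq_top_iff, ← Q.isGrading.2]
      refine iSup_le fun a => ?_
      refine le_trans ?_ (le_iSup _ ((0 : ℤ), a))
      simp
  one_mem := by simpa using Q.one_mem
  mul_mem := by
    rintro ⟨i, a⟩ ⟨j, b⟩ x y hx hy
    by_cases hi : i = 0
    · by_cases hj : j = 0
      · subst hi; subst hj
        simp only [if_true] at hx hy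
        simpa using Q.mul_mem hx hy
      · simp only [hj, if_false, Submodule.mem_bot] at hy
        simp [hy]
    · simp only [hi, if_false, Submodule.mem_bot] at hx
      simp [hx]
  d := 0
  d_mem := by intros; simp
  d_d := by intros; simp
  leibniz := by intros; simp
  unit := AlgHom.id k _
  unit_mem := by intro a q hq; simpa using hq
  d_unit := by intros; simp
  color_comm := by
    rintro ⟨i, a⟩ ⟨j, b⟩ x y hx hy
    by_cases hi : i = 0
    · by_cases hj : j = 0
      · subst hi; subst hj
        simp only [if_true] at hx hy
        simpa [AltBichar.β] using Q.color_comm hx hy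
      · simp only [hj, if_false, Submodule.mem_bot] at hy
        simp [hy]
    · simp only [hi, if_false, Submodule.mem_bot] at hx
      simp [hx]
  odd_sq := by
    rintro ⟨i, a⟩ x hi hx
    have : i ≠ 0 := by rintro rfl; simp at hi
    simp only [this, if_false, Submodule.mem_bot] at hx
    simp [hx]

theorem ColorRing.toDGAlg_cases {i : ℤ} {a : G} {q : Q.carrier}
    (h : (q : Q.toDGAlg.carrier) ∈ Q.toDGAlg.gr (i, a)) : (i = 0 ∧ q ∈ Q.gr a) ∨ q = 0 := by
  change q ∈ (if i = 0 then Q.gr a else ⊥) at h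
  by_cases hi : i = 0
  · left; exact ⟨hi, by simpa [hi] using h⟩
  · right; simpa [hi] using h

/-- The structure map `Q → A`, seen as a map of color DG algebras. -/
def ColorDGAlg.unitHom (A : ColorDGAlg Q) : Q.toDGAlg.carrier →ₐ[k] A.carrier := A.unit

theorem ColorDGAlg.unitHom_mem (A : ColorDGAlg Q) {s : Deg G} {q : Q.toDGAlg.carrier}
    (h : q ∈ Q.toDGAlg.gr s) : A.unitHom q ∈ A.gr s := by
  obtain ⟨i, a⟩ := s
  rcases ColorRing.toDGAlg_cases h with ⟨rfl, hb⟩ | hb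
  · exact A.unit_mem hb
  · rw [show q = 0 from hb, map_zero]; exact Submodule.zero_mem _

theorem ColorDGAlg.d_unitHom (A : ColorDGAlg Q) (q : Q.toDGAlg.carrier) :
    A.d (A.unitHom q) = 0 := A.d_unit q

theorem ColorRing.toDGAlg_d (q : Q.toDGAlg.carrier) : Q.toDGAlg.d q = 0 := rfl

/-- `A` as an `A`-bimodule, i.e. as a module over `Aᵉ` through the multiplication map. -/
def ColorDGAlg.reg (A : ColorDGAlg Q) : ColorDGBimod.{u, u} A A where
  carrier := A.carrier
  gr := A.gr
  isGrading := A.isGrading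
  lact := LinearMap.mul k A.carrier
  ract := (LinearMap.mul k A.carrier).flip
  one_lact := by simp
  mul_lact := by simp [mul_assoc]
  one_ract := by simp
  mul_ract := by simp [mul_assoc]
  lact_ract := by simp [mul_assoc]
  lact_mem := A.mul_mem
  ract_mem := A.mul_mem
  d := A.d
  d_mem := A.d_mem
  d_d := A.d_d
  d_lact := fun hx y => A.leibniz hx y
  d_ract := fun hx y => A.leibniz hx y
  symm := by
    intro a q s m hq hm
    have := A.color_comm (A.unit_mem hq) hm
    simpa [AltBichar.β_deg_zero_left] using this

namespace ColorDGBimod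

variable {A B C : ColorDGAlg Q}

/-- Restriction of the right action along `Q → B`. -/
def restrictRight (M : ColorDGBimod.{u, v} A B) : ColorDGBimod.{u, v} A Q.toDGAlg where
  carrier := M.carrier
  gr := M.gr
  isGrading := M.isGrading
  lact := M.lact
  ract := M.ract.comp B.unitHom.toLinearMap
  one_lact := M.one_lact
  mul_lact := M.mul_lact
  one_ract := fun m => by simp [M.one_ract]
  mul_ract := fun b b' m => by simp [M.mul_ract]
  lact_ract := fun a b m => M.lact_ract a (B.unitHom b) m
  lact_mem := M.lact_mem
  ract_mem := fun hm hb => M.ract_mem hm (B.unitHom_mem hb)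
  d := M.d
  d_mem := M.d_mem
  d_d := M.d_d
  d_lact := M.d_lact
  d_ract := fun {s m} hm b => by
    simp [M.d_ract hm, B.d_unitHom, ColorRing.toDGAlg_d]
  symm := fun hq hm => M.symm hq hm

/-- Restriction of the left action along `Q → A`. -/
def restrictLeft (M : ColorDGBimod.{u, v} A B) : ColorDGBimod.{u, v} Q.toDGAlg B where
  carrier := M.carrier
  gr := M.gr
  isGrading := M.isGrading
  lact := M.lact.comp A.unitHom.toLinearMap
  ract := M.ract
  one_lact := fun m => by simp [M.one_lact]
  mul_lact := fun b b' m => by simp [M.mul_lact]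
  one_ract := M.one_ract
  mul_ract := M.mul_ract
  lact_ract := fun a b m => M.lact_ract (A.unitHom a) b m
  lact_mem := fun ha hm => M.lact_mem (A.unitHom_mem ha) hm
  ract_mem := M.ract_mem
  d := M.d
  d_mem := M.d_mem
  d_d := M.d_d
  d_lact := fun {s a} ha m => by
    simp [M.d_lact (A.unitHom_mem ha), A.d_unitHom, ColorRing.toDGAlg_d]
  d_ract := M.d_ract
  symm := fun hq hm => M.symm hq hm

/-! ### Tensor products -/

section Tensor

open TensorProduct

variable (M : ColorDGBimod.{u, v} A B) (N : ColorDGBimod.{u, w} B C)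

/-- The relations `m b ⊗ n = m ⊗ b n`. -/
def tensRel : Submodule k (M.carrier ⊗[k] N.carrier) :=
  Submodule.span k {z | ∃ m b n, z = M.ract b m ⊗ₜ[k] n - m ⊗ₜ[k] N.lact b n}

/-- The underlying vector space of `M ⊗_B N`. -/
def TensCarrier : Type (max v w) := (M.carrier ⊗[k] N.carrier) ⧸ tensRel M N

instance : AddCommGroup (TensCarrier M N) :=
  inferInstanceAs (AddCommGroup ((M.carrier ⊗[k] N.carrier) ⧸ tensRel M N))

instance : Module k (TensCarrier M N) :=
  inferInstanceAs (Module k ((M.carrier ⊗[k] N.carrier) ⧸ tensRel M N))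

/-- The projection `M ⊗_k N → M ⊗_B N`. -/
def tproj : (M.carrier ⊗[k] N.carrier) →ₗ[k] TensCarrier M N := (tensRel M N).mkQ

/-- The elementary tensor `m ⊗ n` in `M ⊗_B N`. -/
def tmk : M.carrier →ₗ[k] N.carrier →ₗ[k] TensCarrier M N :=
  (TensorProduct.mk k M.carrier N.carrier).compr₂ (tproj M N)

variable {M N}

theorem tmk_ract (b : B.carrier) (m : M.carrier) (n : N.carrier) :
    tmk M N (M.ract b m) n = tmk M N m (N.lact b n) := by
  rw [← sub_eq_zero]
  have : tproj M N (M.ract b m ⊗ₜ[k] n - m ⊗ₜ[k] N.lact b n) = 0 :=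
    (Submodule.Quotient.mk_eq_zero _).2 (Submodule.subset_span ⟨m, b, n, rfl⟩)
  rw [map_sub] at this
  exact this

section Lift

variable {V : Type*} [AddCommGroup V] [Module k V]

theorem balanced_of_homogeneous (F : M.carrier →ₗ[k] N.carrier →ₗ[k] V)
    (hF : ∀ s, ∀ m ∈ M.gr s, ∀ t, ∀ b ∈ B.gr t, ∀ r, ∀ n ∈ N.gr r,
      F (M.ract b m) n = F m (N.lact b n)) (m b n) : F (M.ract b m) n = F m (N.lact b n) := by
  have h : ∀ b t, b ∈ B.gr t → F.comp (M.ract b) = (F.compl₂ (N.lact b)) := by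
    intro b t hb
    refine M.isGrading.linext₂ N.isGrading ?_
    intro s m hm r n hn
    exact hF s m hm t b hb r n hn
  refine B.isGrading.induction (p := fun b => F (M.ract b m) n = F m (N.lact b n)) ?_ ?_ ?_ b
  · intro t b hb
    exact congrArg (fun L => L m n) (h b t hb)
  · intro x y hx hy
    simp only [map_add, LinearMap.add_apply, hx, hy]
  · simp

/-- Linear maps out of `M ⊗_B N` from balanced bilinear maps (balancedness need only be checked
on homogeneous elements). -/
def tlift (F : M.carrier →ₗ[k] N.carrier →ₗ[k] V)
    (hF : ∀ s, ∀ m ∈ M.gr s, ∀ t, ∀ b ∈ B.gr t, ∀ r, ∀ n ∈ N.gr r,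
      F (M.ract b m) n = F m (N.lact b n)) : TensCarrier M N →ₗ[k] V :=
  (tensRel M N).liftQ (TensorProduct.lift F) (by
    rw [tensRel, Submodule.span_le]
    rintro z ⟨m, b, n, rfl⟩
    simp [balanced_of_homogeneous F hF m b n])

@[simp] theorem tlift_tmk (F : M.carrier →ₗ[k] N.carrier →ₗ[k] V) (hF) (m n) :
    tlift F hF (tmk M N m n) = F m n := by
  change (tensRel M N).liftQ (TensorProduct.lift F) _ (Submodule.Quotient.mk (m ⊗ₜ n)) = _
  rw [Submodule.liftQ_apply, TensorProduct.lift.tmul]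

theorem tens_ext {f g : TensCarrier M N →ₗ[k] V}
    (h : ∀ s, ∀ m ∈ M.gr s, ∀ t, ∀ n ∈ N.gr t, f (tmk M N m n) = g (tmk M N m n)) : f = g := by
  have h1 : f.comp (tproj M N) = g.comp (tproj M N) := by
    apply TensorProduct.ext
    exact M.isGrading.linext₂ N.isGrading h
  ext z
  obtain ⟨z, rfl⟩ := Submodule.mkQ_surjective _ z
  exact LinearMap.congr_fun h1 z

end Lift

/-- The bidegree decomposition of `M ⊗_B N`. -/
def tensGr (M : ColorDGBimod.{u, v} A B) (N : ColorDGBimod.{u, w} B C) (s : Deg G) :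
    Submodule k (TensCarrier M N) :=
  Submodule.span k {z | ∃ a b, a + b = s ∧ ∃ m ∈ M.gr a, ∃ n ∈ N.gr b, z = tmk M N m n}

theorem tmk_mem {a b : Deg G} {m n} (hm : m ∈ M.gr a) (hn : n ∈ N.gr b) :
    tmk M N m n ∈ tensGr M N (a + b) :=
  Submodule.subset_span ⟨a, b, rfl, m, hm, n, hn, rfl⟩

theorem tmk_mem' {a b s : Deg G} (h : a + b = s) {m n} (hm : m ∈ M.gr a) (hn : n ∈ N.gr b) :
    tmk M N m n ∈ tensGr M N s := h ▸ tmk_mem hm hn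

theorem tensGr_le {s : Deg G} {V : Type*} [AddCommGroup V] [Module k V] {W : Submodule k V}
    {f : TensCarrier M N →ₗ[k] V}
    (h : ∀ a b, a + b = s → ∀ m ∈ M.gr a, ∀ n ∈ N.gr b, f (tmk M N m n) ∈ W) {z}
    (hz : z ∈ tensGr M N s) : f z ∈ W := by
  have : tensGr M N s ≤ W.comap f := by
    rw [tensGr, Submodule.span_le]
    rintro z ⟨a, b, hab, m, hm, n, hn, rfl⟩
    exact h a b hab m hm n hn
  exact this hz

theorem tens_eqOn {s : Deg G} {V : Type*} [AddCommGroup V] [Module k V]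
    {f g : TensCarrier M N →ₗ[k] V}
    (h : ∀ a b, a + b = s → ∀ m ∈ M.gr a, ∀ n ∈ N.gr b, f (tmk M N m n) = g (tmk M N m n)) {z}
    (hz : z ∈ tensGr M N s) : f z = g z := by
  have : (f - g) z ∈ (⊥ : Submodule k V) := tensGr_le (f := f - g) (fun a b hab m hm n hn => by
    simp [h a b hab m hm n hn]) hz
  simpa [sub_eq_zero] using this

theorem tensGr_isGrading : IsGrading (tensGr M N) := by
  let D : M.carrier →ₗ[k] N.carrier →ₗ[k] (Deg G →₀ TensCarrier M N) :=
    LinearMap.compl₁₂ (Finsupp.lsum k fun a => LinearMap.flip (Finsupp.lsum k fun b =>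
      LinearMap.flip ((tmk M N).compr₂ (Finsupp.lsingle (a + b)))))
      M.isGrading.dec N.isGrading.dec
  have hD : ∀ a, ∀ m ∈ M.gr a, ∀ b, ∀ n ∈ N.gr b, D m n = Finsupp.single (a + b) (tmk M N m n) := by
    intro a m hm b n hn
    simp [D, M.isGrading.dec_of_mem hm, N.isGrading.dec_of_mem hn]
  have hbal : ∀ s, ∀ m ∈ M.gr s, ∀ t, ∀ b ∈ B.gr t, ∀ r, ∀ n ∈ N.gr r,
      D (M.ract b m) n = D m (N.lact b n) := by
    intro s m hm t b hb r n hn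
    rw [hD _ _ (M.ract_mem hm hb) _ _ hn, hD _ _ hm _ _ (N.lact_mem hb hn), tmk_ract, add_assoc]
  refine isGrading_of_dec (tlift D hbal) ?_ ?_
  · intro s z hz
    refine tens_eqOn (g := Finsupp.lsingle s) ?_ hz
    rintro a b rfl m hm n hn
    simp [hD _ _ hm _ _ hn]
  · rw [eq_top_iff]
    rintro z -
    have : (⨆ s, tensGr M N s).mkQ = 0 := by
      refine tens_ext fun s m hm t n hn => ?_
      simp only [Submodule.mkQ_apply, LinearMap.zero_apply, Submodule.Quotient.mk_eq_zero]
      exact Submodule.mem_iSup_of_mem (s + t) (tmk_mem hm hn)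
    have h2 := LinearMap.congr_fun this z
    simpa using h2

/-- The differential `d (m ⊗ n) = d m ⊗ n + (-1)^{|m|} m ⊗ d n`. -/
def tensD (M : ColorDGBimod.{u, v} A B) (N : ColorDGBimod.{u, w} B C) :
    TensCarrier M N →ₗ[k] TensCarrier M N :=
  tlift ((tmk M N).comp M.d +
      ((tmk M N).comp (M.isGrading.scale fun s => sg k s.1)).compl₂ N.d) (by
    intro s m hm t b hb r n hn
    simp only [LinearMap.add_apply, LinearMap.comp_apply, LinearMap.compl₂_apply, M.d_ract hm,
      M.isGrading.scale_of_mem _ (M.ract_mem hm hb), M.isGrading.scale_of_mem _ hm, N.d_lact hb,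
      map_add, map_smul, LinearMap.smul_apply, tmk_ract, Prod.fst_add, sg_add, smul_smul, add_assoc]
    rw [mul_comm])

theorem tensD_tmk {s : Deg G} {m} (hm : m ∈ M.gr s) (n) :
    tensD M N (tmk M N m n) = tmk M N (M.d m) n + sg k s.1 • tmk M N m (N.d n) := by
  simp [tensD, M.isGrading.scale_of_mem _ hm]

theorem tensD_tmk_mem {a b s : Deg G} (h : a + b = s) {m n} (hm : m ∈ M.gr a) (hn : n ∈ N.gr b) :
    tensD M N (tmk M N m n) ∈ tensGr M N (s - one₁ G) := by
  subst h
  rw [tensD_tmk hm]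
  refine Submodule.add_mem _ (tmk_mem' ?_ (M.d_mem hm) hn)
    (Submodule.smul_mem _ _ (tmk_mem' ?_ hm (N.d_mem hn)))
  · abel
  · abel

/-- The left action on `M ⊗_B N`: `a (m ⊗ n) = a m ⊗ n`. -/
def tensLact (M : ColorDGBimod.{u, v} A B) (N : ColorDGBimod.{u, w} B C) :
    A.carrier →ₗ[k] TensCarrier M N →ₗ[k] TensCarrier M N where
  toFun a := tlift ((tmk M N).comp (M.lact a)) (by
    intro s m _ t b _ r n _
    simp only [LinearMap.comp_apply, M.lact_ract, tmk_ract])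
  map_add' a a' := tens_ext fun s m _ t n _ => by simp
  map_smul' c a := tens_ext fun s m _ t n _ => by simp

@[simp] theorem tensLact_tmk (a : A.carrier) (m : M.carrier) (n : N.carrier) :
    tensLact M N a (tmk M N m n) = tmk M N (M.lact a m) n := by
  simp [tensLact]

/-- The right action on `M ⊗_B N`: `(m ⊗ n) c = m ⊗ n c`. -/
def tensRact (M : ColorDGBimod.{u, v} A B) (N : ColorDGBimod.{u, w} B C) :
    C.carrier →ₗ[k] TensCarrier M N →ₗ[k] TensCarrier M N where
  toFun c := tlift ((tmk M N).compl₂ (N.ract c)) (by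
    intro s m _ t b _ r n _
    simp only [LinearMap.compl₂_apply, ← N.lact_ract, tmk_ract])
  map_add' a a' := tens_ext fun s m _ t n _ => by simp
  map_smul' c a := tens_ext fun s m _ t n _ => by simp

@[simp] theorem tensRact_tmk (c : C.carrier) (m : M.carrier) (n : N.carrier) :
    tensRact M N c (tmk M N m n) = tmk M N m (N.ract c n) := by
  simp [tensRact]

/-- The tensor product `M ⊗_B N` of an `A`-`B`-bimodule and a `B`-`C`-bimodule. -/
def tens (M : ColorDGBimod.{u, v} A B) (N : ColorDGBimod.{u, w} B C) :
    ColorDGBimod.{u, max v w} A C where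
  carrier := TensCarrier M N
  gr := tensGr M N
  isGrading := tensGr_isGrading
  lact := tensLact M N
  ract := tensRact M N
  one_lact := fun z => by
    have : tensLact M N 1 = LinearMap.id := tens_ext fun s m _ t n _ => by simp [M.one_lact]
    exact LinearMap.congr_fun this z
  mul_lact := fun a a' z => by
    have : tensLact M N (a * a') = (tensLact M N a).comp (tensLact M N a') :=
      tens_ext fun s m _ t n _ => by simp [M.mul_lact]
    exact LinearMap.congr_fun this z
  one_ract := fun z => by
    have : tensRact M N 1 = LinearMap.id := tens_ext fun s m _ t n _ => by simp [N.one_ract]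
    exact LinearMap.congr_fun this z
  mul_ract := fun a a' z => by
    have : tensRact M N (a * a') = (tensRact M N a').comp (tensRact M N a) :=
      tens_ext fun s m _ t n _ => by simp [N.mul_ract]
    exact LinearMap.congr_fun this z
  lact_ract := fun a c z => by
    have : (tensLact M N a).comp (tensRact M N c) = (tensRact M N c).comp (tensLact M N a) :=
      tens_ext fun s m _ t n _ => by simp
    exact LinearMap.congr_fun this z
  lact_mem := fun {s t a z} ha hz => by
    refine tensGr_le (f := tensLact M N a) ?_ hz
    rintro p q rfl m hm n hn
    rw [tensLact_tmk]
    exact tmk_mem' (by abel) (M.lact_mem ha hm) hn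
  ract_mem := fun {s t c z} hz hc => by
    refine tensGr_le (f := tensRact M N c) ?_ hz
    rintro p q rfl m hm n hn
    rw [tensRact_tmk]
    exact tmk_mem' (by abel) hm (N.ract_mem hn hc)
  d := tensD M N
  d_mem := fun {s z} hz => tensGr_le (f := tensD M N)
    (fun a b hab m hm n hn => tensD_tmk_mem hab hm hn) hz
  d_d := fun z => by
    have : (tensD M N).comp (tensD M N) = 0 := tens_ext fun s m hm t n hn => by
      simp only [LinearMap.comp_apply, tensD_tmk hm, map_add, map_smul, tensD_tmk (M.d_mem hm),
        M.d_d, N.d_d, map_zero, LinearMap.zero_apply, zero_add, smul_zero, add_zero]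
      rw [← add_smul]
      simp [sg_sub]
    exact LinearMap.congr_fun this z
  d_lact := fun {s a} ha z => by
    have : (tensD M N).comp (tensLact M N a) = tensLact M N (A.d a) +
        sg k s.1 • (tensLact M N a).comp (tensD M N) := tens_ext fun t m hm r n hn => by
      simp only [LinearMap.comp_apply, LinearMap.add_apply, LinearMap.smul_apply, tensLact_tmk,
        tensD_tmk hm, tensD_tmk (M.lact_mem ha hm), map_add, map_smul, M.d_lact ha,
        Prod.fst_add, sg_add, smul_add, smul_smul, add_assoc]
    exact LinearMap.congr_fun this z
  d_ract := fun {s z} hz c => by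
    have := tens_eqOn (s := s) (f := (tensD M N).comp (tensRact M N c))
      (g := (tensRact M N c).comp (tensD M N) + sg k s.1 • tensRact M N (C.d c)) ?_ hz
    · exact this
    · rintro p q rfl m hm n hn
      simp only [LinearMap.comp_apply, LinearMap.add_apply, LinearMap.smul_apply, tensRact_tmk,
        tensD_tmk hm, map_add, map_smul, N.d_ract hn, Prod.fst_add, sg_add, smul_add, smul_smul,
        add_assoc]
  symm := fun {a q s z} hq hz => by
    refine tens_eqOn (s := s) (f := tensLact M N (A.unit q))
      (g := χ.c a s.2 • tensRact M N (C.unit q)) ?_ hz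
    rintro p r rfl m hm n hn
    simp only [LinearMap.smul_apply, tensRact_tmk, tensLact_tmk, M.symm hq hm, map_smul, tmk_ract,
      N.symm hq hn, smul_smul, Prod.snd_add, χ.c_add_right]

end Tensor
end ColorDGBimod

/-! ### Morphisms, Hom complexes and homology -/

section Hom

variable {A B : ColorDGAlg Q}

/-- A morphism of color DG bimodules: it preserves bidegrees, is linear and commutes with the
differentials. -/
@[ext] structure DGMor (M : ColorDGBimod.{u, v} A B) (N : ColorDGBimod.{u, w} A B) where
  toLin : M.carrier →ₗ[k] N.carrier
  map_gr : ∀ {s : Deg G} {m}, m ∈ M.gr s → toLin m ∈ N.gr s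
  map_lact : ∀ a m, toLin (M.lact a m) = N.lact a (toLin m)
  map_ract : ∀ b m, toLin (M.ract b m) = N.ract b (toLin m)
  map_d : ∀ m, toLin (M.d m) = N.d (toLin m)

/-- The identity morphism. -/
def DGMor.id (M : ColorDGBimod.{u, v} A B) : DGMor M M where
  toLin := LinearMap.id
  map_gr := fun h => h
  map_lact := fun _ _ => rfl
  map_ract := fun _ _ => rfl
  map_d := fun _ => rfl

/-- Homology `ker d / im d`. -/
def Homology (M : ColorDGBimod.{u, v} A B) : Type v :=
  LinearMap.ker M.d ⧸ (LinearMap.range M.d).submoduleOf (LinearMap.ker M.d)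

instance (M : ColorDGBimod.{u, v} A B) : AddCommGroup (Homology M) :=
  inferInstanceAs (AddCommGroup (_ ⧸ (LinearMap.range M.d).submoduleOf (LinearMap.ker M.d)))

instance (M : ColorDGBimod.{u, v} A B) : Module k (Homology M) :=
  inferInstanceAs (Module k (_ ⧸ (LinearMap.range M.d).submoduleOf (LinearMap.ker M.d)))

/-- The map induced in homology. -/
def DGMor.homologyMap {M : ColorDGBimod.{u, v} A B} {N : ColorDGBimod.{u, w} A B} (φ : DGMor M N) :
    Homology M →ₗ[k] Homology N :=
  Submodule.mapQ _ _ (φ.toLin.restrict (p := LinearMap.ker M.d) (q := LinearMap.ker N.d)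
    (fun m hm => by rw [LinearMap.mem_ker] at hm ⊢; rw [← φ.map_d, hm, map_zero])) (by
      rintro ⟨m, hm⟩ ⟨m', hm'⟩
      exact ⟨φ.toLin m', by rw [← φ.map_d, hm']; rfl⟩)

/-- A quasi-isomorphism: a morphism that is bijective in homology. -/
def DGMor.IsQuasiIso {M : ColorDGBimod.{u, v} A B} {N : ColorDGBimod.{u, w} A B} (φ : DGMor M N) :
    Prop := Function.Bijective φ.homologyMap

/-- `Hom(M, N)` in bidegree `s`: the maps of bidegree `s` with
`f (a m) = (-1)^{|f||a|} χ(f, a) a f(m)` and `f (m b) = f(m) b`. For `A = B` these are the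
`Aᵉ`-linear maps, `f (x m) = (-1)^{|f||x|} χ(f, x) x f(m)` for `x` in `Aᵉ`. -/
def HomDeg (s : Deg G) (M : ColorDGBimod.{u, v} A B) (N : ColorDGBimod.{u, w} A B) :
    Submodule k (M.carrier →ₗ[k] N.carrier) where
  carrier := {f | (∀ t, ∀ m ∈ M.gr t, f m ∈ N.gr (s + t)) ∧
    (∀ t, ∀ a ∈ A.gr t, ∀ m, f (M.lact a m) = χ.β s t • N.lact a (f m)) ∧
    (∀ b m, f (M.ract b m) = N.ract b (f m))}
  add_mem' := by
    rintro f g ⟨hf1, hf2, hf3⟩ ⟨hg1, hg2, hg3⟩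
    refine ⟨fun t m hm => Submodule.add_mem _ (hf1 t m hm) (hg1 t m hm), fun t a ha m => ?_,
      fun b m => ?_⟩
    · simp [hf2 t a ha m, hg2 t a ha m]
    · simp [hf3 b m, hg3 b m]
  zero_mem' := by refine ⟨?_, ?_, ?_⟩ <;> intros <;> simp
  smul_mem' := by
    rintro c f ⟨hf1, hf2, hf3⟩
    refine ⟨fun t m hm => Submodule.smul_mem _ _ (hf1 t m hm), fun t a ha m => ?_,
      fun b m => ?_⟩
    · simp [hf2 t a ha m, smul_smul, mul_comm]
    · simp [hf3 b m]

/-- The component of bidegree `s` of the Hom complex, as a type. -/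
def ColorHom (s : Deg G) (M : ColorDGBimod.{u, v} A B) (N : ColorDGBimod.{u, w} A B) :
    Type (max v w) := HomDeg s M N

instance (s : Deg G) (M : ColorDGBimod.{u, v} A B) (N : ColorDGBimod.{u, w} A B) :
    AddCommGroup (ColorHom s M N) := inferInstanceAs (AddCommGroup (HomDeg s M N))

instance (s : Deg G) (M : ColorDGBimod.{u, v} A B) (N : ColorDGBimod.{u, w} A B) :
    Module k (ColorHom s M N) := inferInstanceAs (Module k (HomDeg s M N))

namespace ColorHom

section

variable {s t : Deg G} {M : ColorDGBimod.{u, v} A B} {N : ColorDGBimod.{u, w} A B}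

/-- The underlying linear map. -/
def toLin : ColorHom s M N →ₗ[k] (M.carrier →ₗ[k] N.carrier) := (HomDeg s M N).subtype

theorem toLin_injective : Function.Injective (toLin : ColorHom s M N → _) :=
  Subtype.val_injective

/-- Bundling. -/
def mk (f : M.carrier →ₗ[k] N.carrier) (hf : f ∈ HomDeg s M N) : ColorHom s M N := ⟨f, hf⟩

@[simp] theorem toLin_mk (f : M.carrier →ₗ[k] N.carrier) (hf : f ∈ HomDeg s M N) :
    toLin (mk f hf) = f := rfl

theorem map_gr (f : ColorHom s M N) {m} (hm : m ∈ M.gr t) : toLin f m ∈ N.gr (s + t) :=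
  f.2.1 t m hm

theorem map_lact (f : ColorHom s M N) {a} (ha : a ∈ A.gr t) (m) :
    toLin f (M.lact a m) = χ.β s t • N.lact a (toLin f m) := f.2.2.1 t a ha m

theorem map_ract (f : ColorHom s M N) (b m) :
    toLin f (M.ract b m) = N.ract b (toLin f m) := f.2.2.2 b m

end

end ColorHom

/-- The differential `f ↦ d f - (-1)^i f d` of the Hom complex, on maps of homological
degree `i`. -/
def homDelta (M : ColorDGBimod.{u, v} A B) (N : ColorDGBimod.{u, w} A B) (i : ℤ) :
    (M.carrier →ₗ[k] N.carrier) →ₗ[k] (M.carrier →ₗ[k] N.carrier) where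
  toFun f := N.d.comp f - sg k i • f.comp M.d
  map_add' f g := by ext m; simp; abel
  map_smul' c f := by ext m; simp [smul_sub, smul_smul, mul_comm]

@[simp] theorem homDelta_apply (M : ColorDGBimod.{u, v} A B) (N : ColorDGBimod.{u, w} A B) (i : ℤ)
    (f : M.carrier →ₗ[k] N.carrier) (m) : homDelta M N i f m = N.d (f m) - sg k i • f (M.d m) := rfl

/-- The cycles of bidegree `s` of the Hom complex. -/
def HomZ (s : Deg G) (M : ColorDGBimod.{u, v} A B) (N : ColorDGBimod.{u, w} A B) :
    Submodule k (ColorHom s M N) :=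
  LinearMap.ker ((homDelta M N s.1).comp ColorHom.toLin)

/-- The boundaries of bidegree `s` of the Hom complex: the images of the maps of bidegree
`s + (1, 0)`. -/
def HomB (s : Deg G) (M : ColorDGBimod.{u, v} A B) (N : ColorDGBimod.{u, w} A B) :
    Submodule k (ColorHom s M N) :=
  (LinearMap.range ((homDelta M N (s.1 + 1)).comp
    (ColorHom.toLin (s := s + one₁ G) (M := M) (N := N)))).comap ColorHom.toLin

/-- The homology of the Hom complex `Hom(M, N)` in bidegree `s`. -/
abbrev HomH (s : Deg G) (M : ColorDGBimod.{u, v} A B) (N : ColorDGBimod.{u, w} A B) :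
    Type (max v w) :=
  HomZ s M N ⧸ (HomB s M N).submoduleOf (HomZ s M N)

theorem mem_HomZ {s : Deg G} {M : ColorDGBimod.{u, v} A B} {N : ColorDGBimod.{u, w} A B}
    {f : ColorHom s M N} : f ∈ HomZ s M N ↔ ∀ m, N.d (f.toLin m) = sg k s.1 • f.toLin (M.d m) := by
  rw [HomZ, LinearMap.mem_ker, LinearMap.ext_iff]
  simp only [LinearMap.comp_apply, homDelta_apply, LinearMap.zero_apply, sub_eq_zero]

theorem mem_HomB {s : Deg G} {M : ColorDGBimod.{u, v} A B} {N : ColorDGBimod.{u, w} A B}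
    {f : ColorHom s M N} : f ∈ HomB s M N ↔ ∃ g : ColorHom (s + one₁ G) M N,
      ∀ m, f.toLin m = N.d (g.toLin m) + sg k s.1 • g.toLin (M.d m) := by
  constructor
  · rintro ⟨g, hgf⟩
    refine ⟨g, fun m => ?_⟩
    have := LinearMap.congr_fun hgf m
    simpa [sg_add] using this.symm
  · rintro ⟨g, hg⟩
    refine ⟨g, ?_⟩
    ext m
    simp [hg m, sg_add]

theorem HomB_le_HomZ (s : Deg G) (M : ColorDGBimod.{u, v} A B) (N : ColorDGBimod.{u, w} A B) :
    HomB s M N ≤ HomZ s M N := by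
  intro f hf
  obtain ⟨g, hg⟩ := mem_HomB.1 hf
  rw [mem_HomZ]
  intro m
  simp [hg, N.d_d, M.d_d]

/-- A morphism as an element of bidegree `0` of the Hom complex. -/
def DGMor.toHom {M : ColorDGBimod.{u, v} A B} {N : ColorDGBimod.{u, w} A B} (φ : DGMor M N) :
    ColorHom 0 M N :=
  ColorHom.mk φ.toLin ⟨fun t m hm => by rw [zero_add]; exact φ.map_gr hm,
    fun t a _ m => by rw [χ.β_zero_left, one_smul, φ.map_lact], φ.map_ract⟩

@[simp] theorem DGMor.toLin_toHom {M : ColorDGBimod.{u, v} A B} {N : ColorDGBimod.{u, w} A B}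
    (φ : DGMor M N) : φ.toHom.toLin = φ.toLin := rfl

/-- Composition with a morphism on the left, `Hom(M, φ)`. -/
def DGMor.postcomp {M : ColorDGBimod.{u, v} A B} {N : ColorDGBimod.{u, w} A B}
    {N' : ColorDGBimod.{u, uw} A B} (φ : DGMor N N') (s : Deg G) : ColorHom s M N →ₗ[k] ColorHom s M N' where
  toFun f := ColorHom.mk (φ.toLin.comp f.toLin) ⟨fun t m hm => φ.map_gr (f.map_gr hm),
    fun t a ha m => by simp [f.map_lact ha, φ.map_lact], fun b m => by
      simp [f.map_ract, φ.map_ract]⟩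
  map_add' f g := ColorHom.toLin_injective (by ext m; simp; rfl)
  map_smul' c f := ColorHom.toLin_injective (by ext m; simp; rfl)

@[simp] theorem DGMor.toLin_postcomp {M : ColorDGBimod.{u, v} A B} {N : ColorDGBimod.{u, w} A B}
    {N' : ColorDGBimod.{u, uw} A B} (φ : DGMor N N') (s : Deg G) (f : ColorHom s M N) :
    (φ.postcomp s f).toLin = φ.toLin.comp f.toLin := rfl

theorem DGMor.postcomp_mem_HomZ {M : ColorDGBimod.{u, v} A B} {N : ColorDGBimod.{u, w} A B}
    {N' : ColorDGBimod.{u, uw} A B} (φ : DGMor N N') {s : Deg G} {f : ColorHom s M N} (hf : f ∈ HomZ s M N) :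
    φ.postcomp s f ∈ HomZ s M N' := by
  rw [mem_HomZ] at hf ⊢
  intro m
  simp [← φ.map_d, hf]

theorem DGMor.postcomp_mem_HomB {M : ColorDGBimod.{u, v} A B} {N : ColorDGBimod.{u, w} A B}
    {N' : ColorDGBimod.{u, uw} A B} (φ : DGMor N N') {s : Deg G} {f : ColorHom s M N} (hf : f ∈ HomB s M N) :
    φ.postcomp s f ∈ HomB s M N' := by
  obtain ⟨g, hg⟩ := mem_HomB.1 hf
  refine mem_HomB.2 ⟨φ.postcomp _ g, fun m => ?_⟩
  simp [← φ.map_d, hg]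

/-- The map induced by a morphism `φ` on the homology of Hom complexes. -/
def DGMor.homHMap {N : ColorDGBimod.{u, w} A B} {N' : ColorDGBimod.{u, uw} A B} (φ : DGMor N N')
    (M : ColorDGBimod.{u, v} A B) (s : Deg G) : HomH s M N →ₗ[k] HomH s M N' :=
  Submodule.mapQ _ _ ((φ.postcomp s).restrict (p := HomZ s M N) (q := HomZ s M N')
    fun _ hf => φ.postcomp_mem_HomZ hf) fun _ hf => φ.postcomp_mem_HomB hf

/-- `P` is semiprojective: `Hom(P, -)` preserves surjections and quasi-isomorphisms. -/
def IsSemiprojective (P : ColorDGBimod.{u, v} A B) : Prop :=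
  (∀ (N N' : ColorDGBimod.{u, v} A B) (φ : DGMor N N'), Function.Surjective φ.toLin →
    ∀ s, Function.Surjective (φ.postcomp (M := P) s)) ∧
  (∀ (N N' : ColorDGBimod.{u, v} A B) (φ : DGMor N N'), φ.IsQuasiIso →
    ∀ s, Function.Bijective (φ.homHMap P s))

/-- Composition of homogeneous maps. -/
def ColorHom.comp {M : ColorDGBimod.{u, v} A B} {N : ColorDGBimod.{u, uv} A B}
    {L : ColorDGBimod.{u, w} A B} (s t : Deg G) :
    ColorHom s N L →ₗ[k] ColorHom t M N →ₗ[k] ColorHom (s + t) M L :=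
  LinearMap.mk₂ k (fun f g => ColorHom.mk (f.toLin.comp g.toLin)
    ⟨fun r m hm => by rw [add_assoc]; exact f.map_gr (g.map_gr hm),
      fun r a ha m => by
        simp [g.map_lact ha, f.map_lact ha, smul_smul, χ.β_add_left, mul_comm],
      fun b m => by simp [g.map_ract, f.map_ract]⟩)
    (fun f f' g => ColorHom.toLin_injective (by ext m; simp; rfl))
    (fun c f g => ColorHom.toLin_injective (by ext m; simp; rfl))
    (fun f g g' => ColorHom.toLin_injective (by ext m; simp; rfl))
    (fun c f g => ColorHom.toLin_injective (by ext m; simp; rfl))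

theorem ColorHom.toLin_comp {M : ColorDGBimod.{u, v} A B} {N : ColorDGBimod.{u, uv} A B}
    {L : ColorDGBimod.{u, w} A B} {s t : Deg G} (f : ColorHom s N L) (g : ColorHom t M N) :
    (ColorHom.comp s t f g).toLin = f.toLin.comp g.toLin := rfl

end Hom

/-! ### Tensor products of maps, diagonal approximations, cup and composition actions -/

section Cup

open ColorDGBimod

variable {A B C : ColorDGAlg Q}

section TensMap

variable {M : ColorDGBimod.{u, v} A B} {M' : ColorDGBimod.{u, uv} A B}
  {N : ColorDGBimod.{u, w} B C} {N' : ColorDGBimod.{u, uw} B C} {s t : Deg G}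

theorem tmk_mem_tens {M : ColorDGBimod.{u, v} A B} {N : ColorDGBimod.{u, w} B C} {a b r : Deg G}
    (h : a + b = r) {m n} (hm : m ∈ M.gr a) (hn : n ∈ N.gr b) :
    tmk M N m n ∈ (tens M N).gr r := tmk_mem' h hm hn

/-- `f ⊗ g : m ⊗ n ↦ (-1)^{|g||m|} χ(g, m) f(m) ⊗ g(n)`, as a linear map. -/
def tensMapLin (f : ColorHom s M M') (g : ColorHom t N N') :
    TensCarrier M N →ₗ[k] TensCarrier M' N' :=
  tlift (LinearMap.compl₁₂ (tmk M' N') (f.toLin.comp (M.isGrading.scale (χ.β t))) g.toLin) (by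
    intro p m hm r b hb q n hn
    simp only [LinearMap.compl₁₂_apply, LinearMap.comp_apply, M.isGrading.scale_of_mem _ hm,
      M.isGrading.scale_of_mem _ (M.ract_mem hm hb), map_smul, LinearMap.smul_apply,
      f.map_ract, g.map_lact hb, tmk_ract, χ.β_add_right, smul_smul]
    rw [mul_comm])

theorem tensMapLin_tmk (f : ColorHom s M M') (g : ColorHom t N N') {p : Deg G} {m}
    (hm : m ∈ M.gr p) (n) :
    tensMapLin f g (tmk M N m n) = χ.β t p • tmk M' N' (f.toLin m) (g.toLin n) := by
  simp [tensMapLin, M.isGrading.scale_of_mem _ hm]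

/-- The tensor product of homogeneous maps,
`(f ⊗ g)(m ⊗ n) = (-1)^{|g||m|} χ(g, m) f(m) ⊗ g(n)`. -/
def tensMap (f : ColorHom s M M') (g : ColorHom t N N') :
    ColorHom (s + t) (tens M N) (tens M' N') :=
  ColorHom.mk (tensMapLin f g) (by
    refine ⟨fun r z hz => ?_, fun r a ha z => ?_, fun c z => ?_⟩
    · refine tensGr_le (f := tensMapLin f g) ?_ hz
      rintro p q rfl m hm n hn
      rw [tensMapLin_tmk f g hm]
      exact Submodule.smul_mem _ _ (tmk_mem_tens (by abel) (f.map_gr hm) (g.map_gr hn))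
    · have : (tensMapLin f g).comp (tensLact M N a) =
          χ.β (s + t) r • (tensLact M' N' a).comp (tensMapLin f g) :=
        tens_ext fun p m hm q n hn => by
          simp only [LinearMap.comp_apply, LinearMap.smul_apply, tensLact_tmk,
            tensMapLin_tmk f g hm, tensMapLin_tmk f g (M.lact_mem ha hm), f.map_lact ha, map_smul,
            smul_smul, χ.β_add_left, χ.β_add_right]
          congr 1
          ring
      exact LinearMap.congr_fun this z
    · have : (tensMapLin f g).comp (tensRact M N c) =
          (tensRact M' N' c).comp (tensMapLin f g) :=
        tens_ext fun p m hm q n hn => by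
          simp only [LinearMap.comp_apply, tensRact_tmk,
            tensMapLin_tmk f g hm, g.map_ract, map_smul]
      exact LinearMap.congr_fun this z)

@[simp] theorem toLin_tensMap (f : ColorHom s M M') (g : ColorHom t N N') :
    (tensMap f g).toLin = tensMapLin f g := rfl

theorem tensMapLin_d {f : ColorHom s M M'} {g : ColorHom t N N'} {p : Deg G} {m}
    (hm : m ∈ M.gr p) (n) :
    tensD M' N' (tensMapLin f g (tmk M N m n)) = χ.β t p • (tmk M' N' (M'.d (f.toLin m)) (g.toLin n)
      + (sg k s.1 * sg k p.1) • tmk M' N' (f.toLin m) (N'.d (g.toLin n))) := by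
  rw [tensMapLin_tmk f g hm, map_smul, tensD_tmk (f.map_gr hm), Prod.fst_add, sg_add]

theorem tensMapLin_d' {f : ColorHom s M M'} {g : ColorHom t N N'} {p : Deg G} {m}
    (hm : m ∈ M.gr p) (n) :
    tensMapLin f g (tensD M N (tmk M N m n)) = χ.β t p •
      (sg k t.1 • tmk M' N' (f.toLin (M.d m)) (g.toLin n)
      + sg k p.1 • tmk M' N' (f.toLin m) (g.toLin (N.d n))) := by
  rw [tensD_tmk hm, map_add, map_smul, tensMapLin_tmk f g hm, tensMapLin_tmk f g (M.d_mem hm),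
    χ.β_sub_one_right, smul_add, smul_smul, smul_smul, smul_smul, mul_comm (sg k t.1),
    mul_comm (sg k p.1)]

theorem tensMap_mem_HomZ {f : ColorHom s M M'} {g : ColorHom t N N'} (hf : f ∈ HomZ s M M')
    (hg : g ∈ HomZ t N N') : tensMap f g ∈ HomZ (s + t) (tens M N) (tens M' N') := by
  rw [mem_HomZ] at hf hg ⊢
  have : (tensD M' N').comp (tensMapLin f g) =
      sg k (s + t).1 • (tensMapLin f g).comp (tensD M N) := tens_ext fun p m hm q n hn => by
    simp only [LinearMap.comp_apply, LinearMap.smul_apply, tensMapLin_d hm, tensMapLin_d' hm,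
      hf, hg, map_smul, LinearMap.smul_apply, smul_add, smul_smul, Prod.fst_add, sg_add]
    congr 2
    · linear_combination (-χ.β t p * sg k s.1) * sg_mul_self (k := k) t.1
    · ring
  exact LinearMap.congr_fun this

theorem tensMap_mem_HomB_left {f : ColorHom s M M'} {g : ColorHom t N N'} (hf : f ∈ HomB s M M')
    (hg : g ∈ HomZ t N N') : tensMap f g ∈ HomB (s + t) (tens M N) (tens M' N') := by
  rw [mem_HomZ] at hg
  obtain ⟨f', hf'⟩ := mem_HomB.1 hf
  have e : s + one₁ G + t = s + t + one₁ G := by abel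
  refine mem_HomB.2 ⟨ColorHom.mk (tensMapLin f' g) (e ▸ (tensMap f' g).2), ?_⟩
  have : tensMapLin f g = (tensD M' N').comp (tensMapLin f' g) +
      sg k (s + t).1 • (tensMapLin f' g).comp (tensD M N) := tens_ext fun p m hm q n hn => by
    simp only [LinearMap.comp_apply, LinearMap.smul_apply, LinearMap.add_apply, tensMapLin_d hm,
      tensMapLin_d' hm, tensMapLin_tmk f g hm,
      hf', hg, map_smul, map_add, LinearMap.smul_apply, LinearMap.add_apply, smul_add, smul_smul,
      Prod.fst_add, sg_add, sg_one]
    have h1 : χ.β t p * sg k s.1 = sg k s.1 * sg k t.1 * (χ.β t p * sg k t.1) := by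
      linear_combination (-χ.β t p * sg k s.1) * sg_mul_self (k := k) t.1
    have h2 : χ.β t p * (sg k s.1 * -1 * sg k p.1 * sg k t.1) =
        -(sg k s.1 * sg k t.1 * (χ.β t p * sg k p.1)) := by ring
    rw [h1, h2]
    module
  exact LinearMap.congr_fun this

theorem tensMap_mem_HomB_right {f : ColorHom s M M'} {g : ColorHom t N N'} (hf : f ∈ HomZ s M M')
    (hg : g ∈ HomB t N N') : tensMap f g ∈ HomB (s + t) (tens M N) (tens M' N') := by
  rw [mem_HomZ] at hf
  obtain ⟨g', hg'⟩ := mem_HomB.1 hg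
  have e : s + (t + one₁ G) = s + t + one₁ G := by abel
  refine mem_HomB.2 ⟨sg k s.1 • ColorHom.mk (tensMapLin f g') (e ▸ (tensMap f g').2), ?_⟩
  have : tensMapLin f g = (tensD M' N').comp (sg k s.1 • tensMapLin f g') +
      sg k (s + t).1 • (sg k s.1 • tensMapLin f g').comp (tensD M N) :=
    tens_ext fun p m hm q n hn => by
      have hb : χ.β (t + one₁ G) p = χ.β t p * sg k p.1 := by
        rw [χ.β_add_left]
        simp [AltBichar.β]
      simp only [LinearMap.comp_apply, LinearMap.smul_apply, LinearMap.add_apply, tensMapLin_d hm,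
        tensMapLin_d' hm, tensMapLin_tmk f g hm,
        hf, hg', map_smul, map_add, LinearMap.smul_apply, LinearMap.add_apply, smul_add, smul_smul,
        Prod.fst_add, sg_add, sg_one, hb]
      have hs := sg_mul_self (k := k) s.1
      have hp := sg_mul_self (k := k) p.1
      have ht := sg_mul_self (k := k) t.1
      have h1 : sg k s.1 * (χ.β t p * sg k p.1 * sg k s.1) = χ.β t p * sg k p.1 := by
        linear_combination (χ.β t p * sg k p.1) * hs
      have h2 : sg k s.1 * (χ.β t p * sg k p.1 * (sg k s.1 * sg k p.1)) = χ.β t p := by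
        linear_combination (χ.β t p * sg k p.1 * sg k p.1) * hs + χ.β t p * hp
      have h3 : sg k s.1 * sg k t.1 * (sg k s.1 * (χ.β t p * sg k p.1 * (sg k t.1 * -1))) =
          - (χ.β t p * sg k p.1) := by
        linear_combination (-χ.β t p * sg k p.1 * sg k t.1 * sg k t.1) * hs
          - χ.β t p * sg k p.1 * ht
      have h4 : sg k s.1 * sg k t.1 * (sg k s.1 * (χ.β t p * sg k p.1 * sg k p.1)) =
          χ.β t p * sg k t.1 := by
        linear_combination (χ.β t p * sg k p.1 * sg k p.1 * sg k t.1) * hs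
          + χ.β t p * sg k t.1 * hp
      simp only [h1, h2, h3, h4]
      module
  exact LinearMap.congr_fun this

end TensMap

/-- The left action, as a bilinear map on the regular bimodule. -/
def regLact (M : ColorDGBimod.{u, v} A B) : A.reg.carrier →ₗ[k] M.carrier →ₗ[k] M.carrier := M.lact

/-- The right action, as a bilinear map on the regular bimodule. -/
def regRact (M : ColorDGBimod.{u, v} B A) : M.carrier →ₗ[k] A.reg.carrier →ₗ[k] M.carrier :=
  M.ract.flip

/-- The multiplication map `a ⊗ m ↦ a m`, as a linear map. -/
def leftMulLin (M : ColorDGBimod.{u, v} A B) : TensCarrier A.reg M →ₗ[k] M.carrier :=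
  tlift (regLact M) fun _ _ _ _ _ _ _ _ _ => M.mul_lact _ _ _

theorem leftMulLin_tmk (M : ColorDGBimod.{u, v} A B) (a : A.carrier) (m : M.carrier) :
    leftMulLin M (tmk A.reg M a m) = M.lact a m := tlift_tmk _ _ _ _

/-- The multiplication map `m ⊗ a ↦ m a`, as a linear map. -/
def rightMulLin (M : ColorDGBimod.{u, v} B A) : TensCarrier M A.reg →ₗ[k] M.carrier :=
  tlift (regRact M) fun _ _ _ _ _ _ _ _ _ => (M.mul_ract _ _ _).symm

theorem rightMulLin_tmk (M : ColorDGBimod.{u, v} B A) (m : M.carrier) (a : A.carrier) :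
    rightMulLin M (tmk M A.reg m a) = M.ract a m := tlift_tmk _ _ _ _

/-- The multiplication map `A ⊗_A M → M`. -/
def leftMul (M : ColorDGBimod.{u, v} A B) : DGMor (tens A.reg M) M where
  toLin := leftMulLin M
  map_gr := fun {s z} hz => by
    refine tensGr_le (f := leftMulLin M) ?_ hz
    rintro p q rfl m hm n hn
    exact leftMulLin_tmk M m n ▸ M.lact_mem hm hn
  map_lact := fun a z => by
    have : (leftMulLin M).comp (tensLact A.reg M a) = (M.lact a).comp (leftMulLin M) :=
      tens_ext fun s m _ t n _ => by
        rw [LinearMap.comp_apply, tensLact_tmk]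
        exact ((leftMulLin_tmk M (A.ring.mul a m) n).trans (M.mul_lact _ _ _)).trans
          (congrArg (M.lact a) (leftMulLin_tmk M m n).symm)
    exact LinearMap.congr_fun this z
  map_ract := fun b z => by
    have : (leftMulLin M).comp (tensRact A.reg M b) = (M.ract b).comp (leftMulLin M) :=
      tens_ext fun s m _ t n _ => by
        rw [LinearMap.comp_apply, tensRact_tmk]
        exact ((leftMulLin_tmk M m (M.ract b n)).trans (M.lact_ract _ _ _)).trans
          (congrArg (M.ract b) (leftMulLin_tmk M m n).symm)
    exact LinearMap.congr_fun this z
  map_d := fun z => by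
    have : (leftMulLin M).comp (tensD A.reg M) = M.d.comp (leftMulLin M) :=
      tens_ext fun s m hm t n _ => by
        rw [LinearMap.comp_apply, tensD_tmk hm, map_add, map_smul, LinearMap.comp_apply]
        refine Eq.trans ?_ (congrArg M.d (leftMulLin_tmk M m n).symm)
        refine Eq.trans ?_ (M.d_lact hm n).symm
        exact congrArg₂ (fun x y => x + sg k s.1 • y) (leftMulLin_tmk M (A.d m) n)
          (leftMulLin_tmk M m (M.d n))
    exact LinearMap.congr_fun this z

/-- The multiplication map `M ⊗_A A → M`. -/
def rightMul (M : ColorDGBimod.{u, v} B A) : DGMor (tens M A.reg) M where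
  toLin := rightMulLin M
  map_gr := fun {s z} hz => by
    refine tensGr_le (f := rightMulLin M) ?_ hz
    rintro p q rfl m hm n hn
    exact rightMulLin_tmk M m n ▸ M.ract_mem hm hn
  map_lact := fun a z => by
    have : (rightMulLin M).comp (tensLact M A.reg a) = (M.lact a).comp (rightMulLin M) :=
      tens_ext fun s m _ t n _ => by
        rw [LinearMap.comp_apply, tensLact_tmk]
        exact ((rightMulLin_tmk M (M.lact a m) n).trans (M.lact_ract _ _ _).symm).trans
          (congrArg (M.lact a) (rightMulLin_tmk M m n).symm)
    exact LinearMap.congr_fun this z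
  map_ract := fun b z => by
    have : (rightMulLin M).comp (tensRact M A.reg b) = (M.ract b).comp (rightMulLin M) :=
      tens_ext fun s m _ t n _ => by
        rw [LinearMap.comp_apply, tensRact_tmk]
        exact ((rightMulLin_tmk M m (A.ring.mul n b)).trans
          (M.mul_ract _ _ _)).trans (congrArg (M.ract b) (rightMulLin_tmk M m n).symm)
    exact LinearMap.congr_fun this z
  map_d := fun z => by
    have : (rightMulLin M).comp (tensD M A.reg) = M.d.comp (rightMulLin M) :=
      tens_ext fun s m hm t n _ => by
        rw [LinearMap.comp_apply, tensD_tmk hm, map_add, map_smul, LinearMap.comp_apply]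
        refine Eq.trans ?_ (congrArg M.d (rightMulLin_tmk M m n).symm)
        refine Eq.trans ?_ (M.d_ract hm n).symm
        exact congrArg₂ (fun x y => x + sg k s.1 • y) (rightMulLin_tmk M (M.d m) n)
          (rightMulLin_tmk M m (A.d n))
    exact LinearMap.congr_fun this z

/-- `Φ : P → P ⊗_A P` is a co-unital diagonal approximation for `ε : P → A`: both
`(ε ⊗ 1) Φ` and `(1 ⊗ ε) Φ` are the identity, where `A ⊗_A P = P = P ⊗_A A` through
multiplication. -/
def IsCounitalDiagApprox {P : ColorDGBimod.{u, v} A A} (ε : DGMor P A.reg)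
    (Φ : DGMor P (tens P P)) : Prop :=
  (∀ p, (leftMul P).toLin ((tensMap ε.toHom (DGMor.id P).toHom).toLin (Φ.toLin p)) = p) ∧
  (∀ p, (rightMul P).toLin ((tensMap (DGMor.id P).toHom ε.toHom).toLin (Φ.toLin p)) = p)

/-- Composition with a morphism on the right. -/
def DGMor.precomp {M : ColorDGBimod.{u, v} A B} {M' : ColorDGBimod.{u, uv} A B} {N : ColorDGBimod.{u, w} A B}
    (φ : DGMor M M') {s : Deg G} (f : ColorHom s M' N) : ColorHom s M N :=
  ColorHom.mk (f.toLin.comp φ.toLin) ⟨fun t m hm => f.map_gr (φ.map_gr hm),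
    fun t a ha m => by simp [f.map_lact ha, φ.map_lact], fun b m => by
      simp [f.map_ract, φ.map_ract]⟩

@[simp] theorem DGMor.toLin_precomp {M : ColorDGBimod.{u, v} A B} {M' : ColorDGBimod.{u, uv} A B}
    {N : ColorDGBimod.{u, w} A B}
    (φ : DGMor M M') {s : Deg G} (f : ColorHom s M' N) :
    (φ.precomp f).toLin = f.toLin.comp φ.toLin := rfl

section Actions

variable {P : ColorDGBimod.{u, u} A A} (ε : DGMor P A.reg) (Φ : DGMor P (tens P P))
  (X : ColorDGBimod.{u, w} A A)

/-- The cup product `σ ∪ τ = μ (σ ⊗ (ε τ)) Φ` of `σ ∈ Hom(P, X)` and `τ ∈ Hom(P, P)`. -/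
def cupFun {s t : Deg G} (σ : ColorHom s P X) (τ : ColorHom t P P) : ColorHom (s + t) P X :=
  Φ.precomp ((rightMul X).postcomp (s + t) (tensMap σ (ε.postcomp t τ)))

variable {ε Φ X}

theorem toLin_cupFun {s t : Deg G} (σ : ColorHom s P X) (τ : ColorHom t P P) (p : P.carrier) :
    (cupFun ε Φ X σ τ).toLin p =
      rightMulLin X (tensMapLin σ (ε.postcomp t τ) (Φ.toLin p)) := rfl

theorem DGMor.precomp_mem_HomZ {M : ColorDGBimod.{u, v} A B} {M' : ColorDGBimod.{u, uv} A B}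
    {N : ColorDGBimod.{u, w} A B} (φ : DGMor M M') {s : Deg G} {f : ColorHom s M' N}
    (hf : f ∈ HomZ s M' N) : φ.precomp f ∈ HomZ s M N := by
  rw [mem_HomZ] at hf ⊢
  intro m
  simp [φ.map_d, hf]

theorem DGMor.precomp_mem_HomB {M : ColorDGBimod.{u, v} A B} {M' : ColorDGBimod.{u, uv} A B}
    {N : ColorDGBimod.{u, w} A B} (φ : DGMor M M') {s : Deg G} {f : ColorHom s M' N}
    (hf : f ∈ HomB s M' N) : φ.precomp f ∈ HomB s M N := by
  obtain ⟨g, hg⟩ := mem_HomB.1 hf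
  refine mem_HomB.2 ⟨φ.precomp g, fun m => ?_⟩
  simp [φ.map_d, hg]

variable (ε Φ X)

/-- The cup product as a bilinear map. -/
def cup (s t : Deg G) :
    ColorHom s P X →ₗ[k] ColorHom t P P →ₗ[k] ColorHom (s + t) P X :=
  LinearMap.mk₂ k (cupFun ε Φ X)
    (fun σ σ' τ => ColorHom.toLin_injective (by
      have : tensMapLin (σ + σ') (ε.postcomp t τ) =
          tensMapLin σ (ε.postcomp t τ) + tensMapLin σ' (ε.postcomp t τ) :=
        tens_ext fun p m hm q n hn => by
          simp only [tensMapLin_tmk _ _ hm, map_add, LinearMap.add_apply, smul_add]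
      ext p
      exact (congrArg (rightMulLin X) (LinearMap.congr_fun this (Φ.toLin p))).trans
        (map_add _ _ _)))
    (fun c σ τ => ColorHom.toLin_injective (by
      have : tensMapLin (c • σ) (ε.postcomp t τ) = c • tensMapLin σ (ε.postcomp t τ) :=
        tens_ext fun p m hm q n hn => by
          simp only [tensMapLin_tmk _ _ hm, map_smul, LinearMap.smul_apply, smul_smul, mul_comm]
      ext p
      exact (congrArg (rightMulLin X) (LinearMap.congr_fun this (Φ.toLin p))).trans
        ((rightMulLin X).map_smul c _)))
    (fun σ τ τ' => ColorHom.toLin_injective (by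
      have : tensMapLin σ (ε.postcomp t (τ + τ')) =
          tensMapLin σ (ε.postcomp t τ) + tensMapLin σ (ε.postcomp t τ') :=
        tens_ext fun p m hm q n hn => by
          simp only [tensMapLin_tmk _ _ hm, map_add, LinearMap.add_apply, smul_add]
      ext p
      exact (congrArg (rightMulLin X) (LinearMap.congr_fun this (Φ.toLin p))).trans
        (map_add _ _ _)))
    (fun c σ τ => ColorHom.toLin_injective (by
      have : tensMapLin σ (ε.postcomp t (c • τ)) = c • tensMapLin σ (ε.postcomp t τ) :=
        tens_ext fun p m hm q n hn => by
          simp only [tensMapLin_tmk _ _ hm, map_smul, LinearMap.smul_apply, smul_smul, mul_comm]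
      ext p
      exact (congrArg (rightMulLin X) (LinearMap.congr_fun this (Φ.toLin p))).trans
        ((rightMulLin X).map_smul c _)))

@[simp] theorem cup_apply {s t : Deg G} (σ : ColorHom s P X) (τ : ColorHom t P P) :
    cup ε Φ X s t σ τ =
      Φ.precomp ((rightMul X).postcomp (s + t) (tensMap σ (ε.postcomp t τ))) := rfl

/-- A bilinear map that is compatible with cycles and boundaries induces a bilinear map in
homology. -/
def subquotMap₂ {U V W : Type*} [AddCommGroup U] [Module k U] [AddCommGroup V] [Module k V]
    [AddCommGroup W] [Module k W] (F : U →ₗ[k] V →ₗ[k] W) (Z₁ B₁ : Submodule k U)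
    (Z₂ B₂ : Submodule k V) (Z₃ B₃ : Submodule k W)
    (hz : ∀ x ∈ Z₁, ∀ y ∈ Z₂, F x y ∈ Z₃) (hl : ∀ x ∈ B₁, ∀ y ∈ Z₂, F x y ∈ B₃)
    (hr : ∀ x ∈ Z₁, ∀ y ∈ B₂, F x y ∈ B₃) :
    (Z₁ ⧸ B₁.submoduleOf Z₁) →ₗ[k] (Z₂ ⧸ B₂.submoduleOf Z₂) →ₗ[k] (Z₃ ⧸ B₃.submoduleOf Z₃) :=
  Submodule.liftQ _
    { toFun := fun x => Submodule.mapQ _ _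
        ((F x.1).restrict (p := Z₂) (q := Z₃) (hz x.1 x.2)) fun y hy => hr x.1 x.2 y.1 hy
      map_add' := fun x x' => by
        apply Submodule.linearMap_qext
        ext y
        exact congrArg Submodule.Quotient.mk (Subtype.ext (by simp))
      map_smul' := fun c x => by
        apply Submodule.linearMap_qext
        ext y
        exact congrArg Submodule.Quotient.mk (Subtype.ext (by simp)) }
    (by
      intro x hx
      rw [LinearMap.mem_ker]
      apply Submodule.linearMap_qext
      ext y
      refine (Submodule.Quotient.mk_eq_zero _).2 ?_
      exact hl x.1 hx y.1 y.2)

/-- The cup action of `H(Hom(P, P))` on `H(Hom(P, X))`. -/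
def cupH (s t : Deg G) : HomH s P X →ₗ[k] HomH t P P →ₗ[k] HomH (s + t) P X :=
  subquotMap₂ (cup ε Φ X s t) _ _ _ _ _ _
    (fun _ hσ _ hτ => Φ.precomp_mem_HomZ ((rightMul X).postcomp_mem_HomZ
      (tensMap_mem_HomZ hσ (ε.postcomp_mem_HomZ hτ))))
    (fun _ hσ _ hτ => Φ.precomp_mem_HomB ((rightMul X).postcomp_mem_HomB
      (tensMap_mem_HomB_left hσ (ε.postcomp_mem_HomZ hτ))))
    (fun _ hσ _ hτ => Φ.precomp_mem_HomB ((rightMul X).postcomp_mem_HomB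
      (tensMap_mem_HomB_right hσ (ε.postcomp_mem_HomB hτ))))

variable (P)

/-- The composition action of `H(Hom(P, P))` on `H(Hom(P, X))`. -/
def compH (s t : Deg G) : HomH s P X →ₗ[k] HomH t P P →ₗ[k] HomH (s + t) P X :=
  subquotMap₂ (ColorHom.comp s t) _ _ _ _ _ _
    (fun σ hσ τ hτ => by
      rw [mem_HomZ] at hσ hτ ⊢
      intro m
      simp [ColorHom.toLin_comp, hσ, hτ, sg_add, smul_smul])
    (fun σ hσ τ hτ => by
      rw [mem_HomZ] at hτ
      obtain ⟨g, hg⟩ := mem_HomB.1 hσ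
      have e : s + one₁ G + t = s + t + one₁ G := by abel
      refine mem_HomB.2 ⟨ColorHom.mk (g.toLin.comp τ.toLin) (e ▸ (ColorHom.comp _ _ g τ).2),
        fun m => ?_⟩
      have : τ.toLin (P.d m) = sg k t.1 • P.d (τ.toLin m) := by
        rw [hτ, smul_smul, sg_mul_self, one_smul]
      simp [ColorHom.toLin_comp, hg, this, sg_add, smul_smul, mul_assoc])
    (fun σ hσ τ hτ => by
      rw [mem_HomZ] at hσ
      obtain ⟨g, hg⟩ := mem_HomB.1 hτ
      have e : s + (t + one₁ G) = s + t + one₁ G := by abel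
      refine mem_HomB.2 ⟨sg k s.1 • ColorHom.mk (σ.toLin.comp g.toLin)
        (e ▸ (ColorHom.comp _ _ σ g).2), fun m => ?_⟩
      have h := hσ (g.toLin m)
      have : sg k s.1 * sg k t.1 * sg k s.1 = sg k t.1 := by
        rw [mul_right_comm, sg_mul_self, one_mul]
      simp [ColorHom.toLin_comp, hg, h, sg_add, smul_smul, this])

variable {P}

/-- For a semiprojective resolution `ε : P → A` over `Aᵉ`, the isomorphism
`ε_* : H(Hom(P, P)) → H(Hom(P, A)) = Ext(A, A)` in bidegree `t`. -/
def extEquiv (hP : IsSemiprojective P) (hε : ε.IsQuasiIso) (t : Deg G) :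
    HomH t P P ≃ₗ[k] HomH t P A.reg :=
  LinearEquiv.ofBijective (ε.homHMap P t) (hP.2 _ _ ε hε t)

/-- The cup action `Ext(A, X) × Ext(A, A) → Ext(A, X)`, where Ext over `Aᵉ` is computed with the
semiprojective resolution `ε : P → A`. -/
def extCup (hP : IsSemiprojective P) (hε : ε.IsQuasiIso) (s t : Deg G) :
    HomH s P X →ₗ[k] HomH t P A.reg →ₗ[k] HomH (s + t) P X :=
  (cupH ε Φ X s t).compl₂ (extEquiv ε hP hε t).symm.toLinearMap

/-- The composition action `Ext(A, X) × Ext(A, A) → Ext(A, X)`. -/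
def extComp (hP : IsSemiprojective P) (hε : ε.IsQuasiIso) (s t : Deg G) :
    HomH s P X →ₗ[k] HomH t P A.reg →ₗ[k] HomH (s + t) P X :=
  (compH P X s t).compl₂ (extEquiv ε hP hε t).symm.toLinearMap

end Actions

end Cup

/-! ### Adjoining exterior variables; the Koszul complex -/

section Koszul

/-- The underlying vector space of `A⟨e⟩`: the pair `(a, b)` stands for `a + b e`. -/
def ExtCarrier (A : ColorDGAlg Q) (_δ : G) : Type u := A.carrier × A.carrier

namespace ExtCarrier

variable (A : ColorDGAlg Q) (δ : G)

instance : AddCommGroup (ExtCarrier A δ) := inferInstanceAs (AddCommGroup (A.carrier × A.carrier))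
instance : Module k (ExtCarrier A δ) := inferInstanceAs (Module k (A.carrier × A.carrier))

variable {A δ}

/-- The element `a + b e`. -/
def mk (a b : A.carrier) : ExtCarrier A δ := (a, b)

@[ext] theorem ext {x y : ExtCarrier A δ} (h1 : x.1 = y.1) (h2 : x.2 = y.2) : x = y :=
  Prod.ext h1 h2

@[simp] theorem mk_fst (a b : A.carrier) : (mk a b : ExtCarrier A δ).1 = a := rfl
@[simp] theorem mk_snd (a b : A.carrier) : (mk a b : ExtCarrier A δ).2 = b := rfl
@[simp] theorem add_fst (x y : ExtCarrier A δ) : (x + y).1 = x.1 + y.1 := rfl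
@[simp] theorem add_snd (x y : ExtCarrier A δ) : (x + y).2 = x.2 + y.2 := rfl
@[simp] theorem smul_fst (c : k) (x : ExtCarrier A δ) : (c • x).1 = c • x.1 := rfl
@[simp] theorem smul_snd (c : k) (x : ExtCarrier A δ) : (c • x).2 = c • x.2 := rfl
@[simp] theorem zero_fst : (0 : ExtCarrier A δ).1 = 0 := rfl
@[simp] theorem zero_snd : (0 : ExtCarrier A δ).2 = 0 := rfl

end ExtCarrier

namespace ColorDGAlg

variable (A : ColorDGAlg Q)

/-- The map `a ↦ β(s, |a|) a`; moving a variable of bidegree `s` past `a` produces this factor. -/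
def tw (s : Deg G) : A.carrier →ₗ[k] A.carrier := A.isGrading.scale (χ.β s)

/-- The map `a ↦ (-1)^{|a|} a`. -/
def sgn : A.carrier →ₗ[k] A.carrier := A.isGrading.scale fun t => sg k t.1

variable {A}

theorem tw_of_mem (s : Deg G) {t : Deg G} {a} (ha : a ∈ A.gr t) : A.tw s a = χ.β s t • a :=
  A.isGrading.scale_of_mem _ ha

theorem tw_mem (s : Deg G) {t : Deg G} {a} (ha : a ∈ A.gr t) : A.tw s a ∈ A.gr t :=
  A.isGrading.scale_mem _ ha

theorem sgn_of_mem {t : Deg G} {a} (ha : a ∈ A.gr t) : A.sgn a = sg k t.1 • a :=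
  A.isGrading.scale_of_mem _ ha

theorem sgn_mem {t : Deg G} {a} (ha : a ∈ A.gr t) : A.sgn a ∈ A.gr t :=
  A.isGrading.scale_mem _ ha

theorem tw_one (s : Deg G) : A.tw s 1 = 1 := by rw [tw_of_mem s A.one_mem]; simp

theorem tw_mul (s : Deg G) (a b : A.carrier) : A.tw s (a * b) = A.tw s a * A.tw s b := by
  have : (LinearMap.mul k A.carrier).compr₂ (A.tw s) =
      (LinearMap.mul k A.carrier).compl₁₂ (A.tw s) (A.tw s) :=
    A.isGrading.linext₂ A.isGrading fun i a ha j b hb => by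
      simp only [LinearMap.compr₂_apply, LinearMap.compl₁₂_apply, LinearMap.mul_apply',
        tw_of_mem s ha, tw_of_mem s hb, tw_of_mem s (A.mul_mem ha hb), χ.β_add_right,
        smul_mul_smul_comm]
  exact LinearMap.congr_fun₂ this a b

theorem sgn_mul (a b : A.carrier) : A.sgn (a * b) = A.sgn a * A.sgn b := by
  have : (LinearMap.mul k A.carrier).compr₂ A.sgn =
      (LinearMap.mul k A.carrier).compl₁₂ A.sgn A.sgn :=
    A.isGrading.linext₂ A.isGrading fun i a ha j b hb => by
      simp only [LinearMap.compr₂_apply, LinearMap.compl₁₂_apply, LinearMap.mul_apply',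
        sgn_of_mem ha, sgn_of_mem hb, sgn_of_mem (A.mul_mem ha hb), Prod.fst_add, sg_add,
        smul_mul_smul_comm]
  exact LinearMap.congr_fun₂ this a b

theorem d_sgn (a : A.carrier) : A.d (A.sgn a) = - A.sgn (A.d a) := by
  have : A.d.comp A.sgn = - A.sgn.comp A.d := A.isGrading.linext fun i a ha => by
    simp [sgn_of_mem ha, sgn_of_mem (A.d_mem ha), sg_sub]
  exact LinearMap.congr_fun this a

theorem d_tw (δ : G) (a : A.carrier) : A.d (A.tw (1, δ) a) = - A.tw (1, δ) (A.d a) := by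
  have : A.d.comp (A.tw (1, δ)) = - (A.tw (1, δ)).comp A.d := A.isGrading.linext fun i a ha => by
    simp [tw_of_mem _ ha, tw_of_mem _ (A.d_mem ha), χ.β_sub_one_right]
  exact LinearMap.congr_fun this a

theorem d_sgn_mul_unit (b : A.carrier) (q : Q.carrier) :
    A.d (A.sgn b * A.unit q) = - (A.sgn (A.d b) * A.unit q) := by
  have : A.d.comp ((LinearMap.mulRight k (A.unit q)).comp A.sgn) =
      - (LinearMap.mulRight k (A.unit q)).comp (A.sgn.comp A.d) :=
    A.isGrading.linext fun i a ha => by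
      simp only [LinearMap.comp_apply, LinearMap.mulRight_apply, LinearMap.neg_apply,
        A.leibniz (sgn_mem ha), A.d_unit, mul_zero, smul_zero, add_zero, d_sgn, neg_mul]
  exact LinearMap.congr_fun this b

theorem sgn_tw_mul_unit {δ : G} {q : Q.carrier} (hq : q ∈ Q.gr δ) (y : A.carrier) :
    A.sgn (A.tw (1, δ) y) * A.unit q = A.unit q * y := by
  have : (LinearMap.mulRight k (A.unit q)).comp (A.sgn.comp (A.tw (1, δ))) =
      LinearMap.mulLeft k (A.unit q) :=
    A.isGrading.linext fun i a ha => by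
      simp only [LinearMap.comp_apply, LinearMap.mulRight_apply, LinearMap.mulLeft_apply,
        tw_of_mem _ ha, map_smul, sgn_of_mem ha, A.color_comm (A.unit_mem hq) ha, smul_smul]
      congr 1
      simp only [AltBichar.β, one_mul, zero_mul, sg_zero]
      linear_combination (χ.c δ i.2) * sg_mul_self (k := k) i.1
  exact LinearMap.congr_fun this y

theorem tw_sgn_mul_unit {δ : G} {q : Q.carrier} (hq : q ∈ Q.gr δ) (y : A.carrier) :
    A.tw (1, δ) (A.sgn y * A.unit q) = A.unit q * y := by
  have h : A.tw (1, δ) (A.unit q) = A.unit q := by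
    rw [tw_of_mem _ (A.unit_mem hq)]; simp [AltBichar.β]
  have h2 : A.tw (1, δ) (A.sgn y) = A.sgn (A.tw (1, δ) y) := by
    have : (A.tw (1, δ)).comp A.sgn = A.sgn.comp (A.tw (1, δ)) :=
      A.isGrading.linext fun i a ha => by
        simp [tw_of_mem _ ha, sgn_of_mem ha, smul_smul, mul_comm]
    exact LinearMap.congr_fun this y
  rw [tw_mul, h, h2, sgn_tw_mul_unit hq]

end ColorDGAlg

namespace ExtCarrier

variable (A : ColorDGAlg Q) (δ : G)

/-- The product of `A⟨e⟩`: `(a + b e)(a' + b' e) = a a' + (a b' + (-1)^{|a'|} χ(e, a') b a') e`,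
since `e a' = (-1)^{|a'|} χ(e, a') a' e` and `e e = 0`. -/
instance : Ring (ExtCarrier A δ) :=
  { (inferInstance : AddCommGroup (ExtCarrier A δ)) with
    mul := fun x y => mk (x.1 * y.1) (x.1 * y.2 + x.2 * A.tw (1, δ) y.1)
    one := mk 1 0
    mul_assoc := fun x y z => by
      change mk ((x.1 * y.1) * z.1) ((x.1 * y.1) * z.2 +
          (x.1 * y.2 + x.2 * A.tw (1, δ) y.1) * A.tw (1, δ) z.1) =
        (mk (x.1 * (y.1 * z.1)) (x.1 * (y.1 * z.2 + y.2 * A.tw (1, δ) z.1) +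
          x.2 * A.tw (1, δ) (y.1 * z.1)) : ExtCarrier A δ)
      rw [ColorDGAlg.tw_mul]
      congr 1 <;> noncomm_ring
    one_mul := fun x => by
      change (mk (1 * x.1) (1 * x.2 + 0 * A.tw (1, δ) x.1) : ExtCarrier A δ) = x
      ext <;> simp
    mul_one := fun x => by
      change (mk (x.1 * 1) (x.1 * 0 + x.2 * A.tw (1, δ) 1) : ExtCarrier A δ) = x
      ext <;> simp [ColorDGAlg.tw_one]
    left_distrib := fun x y z => by
      change (mk (x.1 * (y.1 + z.1)) (x.1 * (y.2 + z.2) + x.2 * A.tw (1, δ) (y.1 + z.1)) :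
        ExtCarrier A δ) = mk (x.1 * y.1) (x.1 * y.2 + x.2 * A.tw (1, δ) y.1) +
          mk (x.1 * z.1) (x.1 * z.2 + x.2 * A.tw (1, δ) z.1)
      rw [map_add]
      ext <;> simp only [mk_fst, mk_snd, add_fst, add_snd, mul_add]; abel
    right_distrib := fun x y z => by
      change (mk ((x.1 + y.1) * z.1) ((x.1 + y.1) * z.2 + (x.2 + y.2) * A.tw (1, δ) z.1) :
        ExtCarrier A δ) = mk (x.1 * z.1) (x.1 * z.2 + x.2 * A.tw (1, δ) z.1) +
          mk (y.1 * z.1) (y.1 * z.2 + y.2 * A.tw (1, δ) z.1)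
      ext <;> simp only [mk_fst, mk_snd, add_fst, add_snd, add_mul]; abel
    zero_mul := fun x => by
      change (mk (0 * x.1) (0 * x.2 + 0 * A.tw (1, δ) x.1) : ExtCarrier A δ) = 0
      ext <;> simp
    mul_zero := fun x => by
      change (mk (x.1 * 0) (x.1 * 0 + x.2 * A.tw (1, δ) 0) : ExtCarrier A δ) = 0
      ext <;> simp }

variable {A δ}

@[simp] theorem mul_fst (x y : ExtCarrier A δ) : (x * y).1 = x.1 * y.1 := rfl
@[simp] theorem mul_snd (x y : ExtCarrier A δ) :
    (x * y).2 = x.1 * y.2 + x.2 * A.tw (1, δ) y.1 := rfl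
@[simp] theorem one_fst : (1 : ExtCarrier A δ).1 = 1 := rfl
@[simp] theorem one_snd : (1 : ExtCarrier A δ).2 = 0 := rfl
@[simp] theorem add_fst' (x y : ExtCarrier A δ) : (x + y).1 = x.1 + y.1 := rfl
@[simp] theorem add_snd' (x y : ExtCarrier A δ) : (x + y).2 = x.2 + y.2 := rfl

instance : Algebra k (ExtCarrier A δ) :=
  Algebra.ofModule (fun c x y => by ext <;> simp) (fun c x y => by ext <;> simp)

variable (A δ)

/-- The inclusion `A → A⟨e⟩`. -/
def incl : A.carrier →ₐ[k] ExtCarrier A δ :=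
  AlgHom.ofLinearMap
    { toFun := fun a => mk a 0
      map_add' := fun a b => by ext <;> simp
      map_smul' := fun c a => by ext <;> simp }
    rfl (fun a b => by ext <;> simp)

@[simp] theorem incl_fst (a : A.carrier) : (incl A δ a).1 = a := rfl
@[simp] theorem incl_snd (a : A.carrier) : (incl A δ a).2 = 0 := rfl

/-- The bidegree decomposition of `A⟨e⟩`, with `e` in bidegree `(1, δ)`. -/
def gr (s : Deg G) : Submodule k (ExtCarrier A δ) where
  carrier := {x | x.1 ∈ A.gr s ∧ x.2 ∈ A.gr (s - (1, δ))}
  add_mem' := fun h h' => ⟨Submodule.add_mem _ h.1 h'.1, Submodule.add_mem _ h.2 h'.2⟩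
  zero_mem' := ⟨Submodule.zero_mem _, Submodule.zero_mem _⟩
  smul_mem' := fun c _ h => ⟨Submodule.smul_mem _ c h.1, Submodule.smul_mem _ c h.2⟩

variable {A δ}

/-- The differential of `A⟨e⟩`: `d (a + b e) = d a + (d b) e + (-1)^{|b|} b f`. -/
def dif (f : Q.carrier) : ExtCarrier A δ →ₗ[k] ExtCarrier A δ where
  toFun x := mk (A.d x.1 + A.sgn x.2 * A.unit f) (A.d x.2)
  map_add' x y := by ext <;> simp [add_mul]; abel
  map_smul' c x := by ext <;> simp

@[simp] theorem dif_fst (f : Q.carrier) (x : ExtCarrier A δ) :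
    (dif f x).1 = A.d x.1 + A.sgn x.2 * A.unit f := rfl
@[simp] theorem dif_snd (f : Q.carrier) (x : ExtCarrier A δ) : (dif f x).2 = A.d x.2 := rfl

theorem gr_isGrading : IsGrading (gr A δ) := by
  let i₁ : A.carrier →ₗ[k] ExtCarrier A δ := LinearMap.inl k A.carrier A.carrier
  let i₂ : A.carrier →ₗ[k] ExtCarrier A δ := LinearMap.inr k A.carrier A.carrier
  let p₁ : ExtCarrier A δ →ₗ[k] A.carrier := LinearMap.fst k A.carrier A.carrier
  let p₂ : ExtCarrier A δ →ₗ[k] A.carrier := LinearMap.snd k A.carrier A.carrier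
  have hx : ∀ x : ExtCarrier A δ, x = i₁ x.1 + i₂ x.2 := fun x => by
    refine ext ?_ ?_
    · change x.1 = x.1 + 0; simp
    · change x.2 = 0 + x.2; simp
  refine isGrading_of_dec
    (((Finsupp.lsum k fun t => (Finsupp.lsingle t).comp i₁).comp A.isGrading.dec).comp p₁ +
    ((Finsupp.lsum k fun t => (Finsupp.lsingle (t + (1, δ))).comp i₂).comp
      A.isGrading.dec).comp p₂) ?_ ?_
  · rintro s x ⟨h1, h2⟩
    have e1 : A.isGrading.dec (p₁ x) = Finsupp.single s x.1 := A.isGrading.dec_of_mem h1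
    have e2 : A.isGrading.dec (p₂ x) = Finsupp.single (s - (1, δ)) x.2 :=
      A.isGrading.dec_of_mem h2
    simp only [LinearMap.add_apply, LinearMap.comp_apply, e1, e2, Finsupp.lsum_single,
      Finsupp.lsingle_apply, sub_add_cancel]
    rw [← Finsupp.single_add, ← hx]
  · rw [eq_top_iff]
    rintro x -
    rw [hx x]
    refine Submodule.add_mem _ ?_ ?_
    · refine A.isGrading.induction (p := fun a => i₁ a ∈ ⨆ s, gr A δ s) ?_ ?_ ?_ x.1
      · intro s a ha
        exact Submodule.mem_iSup_of_mem s ⟨ha, Submodule.zero_mem _⟩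
      · intro a b ha hb; rw [map_add]; exact Submodule.add_mem _ ha hb
      · rw [map_zero]; exact Submodule.zero_mem _
    · refine A.isGrading.induction (p := fun a => i₂ a ∈ ⨆ s, gr A δ s) ?_ ?_ ?_ x.2
      · intro s a ha
        refine Submodule.mem_iSup_of_mem (s + (1, δ)) ⟨Submodule.zero_mem _, ?_⟩
        change a ∈ A.gr (s + (1, δ) - (1, δ))
        rwa [add_sub_cancel_right]
      · intro a b ha hb; rw [map_add]; exact Submodule.add_mem _ ha hb
      · rw [map_zero]; exact Submodule.zero_mem _

end ExtCarrier

open ExtCarrier in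
/-- The extension `A⟨e | ∂e = f⟩` by a (skew) exterior variable `e` of bidegree `(1, δ)`, where
`f ∈ Q` is homogeneous of color `δ`. -/
def ColorDGAlg.adjoinExt (A : ColorDGAlg Q) {δ : G} {f : Q.carrier} (hf : f ∈ Q.gr δ) :
    ColorDGAlg Q where
  carrier := ExtCarrier A δ
  gr := ExtCarrier.gr A δ
  isGrading := gr_isGrading
  one_mem := ⟨A.one_mem, Submodule.zero_mem _⟩
  mul_mem := fun {s t x y} hx hy => by
    refine ⟨A.mul_mem hx.1 hy.1, Submodule.add_mem _ ?_ ?_⟩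
    · have := A.mul_mem hx.1 hy.2
      rwa [← add_sub_assoc] at this
    · have := A.mul_mem hx.2 (A.tw_mem (1, δ) hy.1)
      rwa [sub_add_eq_add_sub] at this
  d := dif f
  d_mem := fun {s x} hx => by
    refine ⟨Submodule.add_mem _ (A.d_mem hx.1) ?_, ?_⟩
    · have := A.mul_mem (A.sgn_mem hx.2) (A.unit_mem hf)
      convert this using 2
      ext <;> simp
    · have := A.d_mem hx.2
      rwa [sub_right_comm] at this
  d_d := fun x => by
    ext
    · simp [A.d_d, ColorDGAlg.d_sgn_mul_unit]
    · simp [A.d_d]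
  leibniz := fun {s x} hx y => by
    have e1 : A.sgn x.1 = sg k s.1 • x.1 := A.sgn_of_mem hx.1
    have e2 : A.sgn x.2 = - sg k s.1 • x.2 := by
      rw [A.sgn_of_mem hx.2]; simp [sg_sub]
    have e3 := A.leibniz hx.2 (A.tw (1, δ) y.1)
    have e4 := ColorDGAlg.sgn_tw_mul_unit hf y.1
    have e5 := ColorDGAlg.tw_sgn_mul_unit hf y.2
    refine ext ?_ ?_
    · simp only [dif_fst, mul_fst, mul_snd, add_fst', smul_fst, A.leibniz hx.1, map_add,
        ColorDGAlg.sgn_mul, add_mul, mul_assoc, e4, e1, mul_add, smul_add, smul_mul_assoc]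
      abel
    · simp only [dif_fst, dif_snd, mul_snd, add_snd', smul_snd, map_add, A.leibniz hx.1,
        e3, e2, e5, ColorDGAlg.d_tw, mul_add, add_mul, smul_add, smul_mul_assoc, mul_assoc,
        Prod.fst_sub, sg_sub, sg_one, mul_neg, smul_neg, neg_smul, mul_one, neg_neg, neg_mul]
      abel
  unit := (incl A δ).comp A.unit
  unit_mem := fun hq => ⟨A.unit_mem hq, Submodule.zero_mem _⟩
  d_unit := fun q => by
    ext <;> simp [A.d_unit]
  color_comm := fun {s t x y} hx hy => by
    refine ext ?_ ?_
    · exact A.color_comm hx.1 hy.1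
    · simp only [mul_snd, smul_snd, A.tw_of_mem (1, δ) hx.1, A.tw_of_mem (1, δ) hy.1,
        A.color_comm hx.1 hy.2, mul_smul_comm, smul_add, smul_smul, A.color_comm hx.2 hy.1]
      have h1 : χ.β s (t - (1, δ)) = χ.β s t * χ.β (1, δ) s := by
        have h := χ.β_add_right s (t - (1, δ)) (1, δ)
        rw [sub_add_cancel] at h
        rw [h, mul_assoc, χ.β_swap, mul_one]
      have h2 : χ.β (1, δ) t * χ.β (s - (1, δ)) t = χ.β s t := by
        have h := χ.β_add_left (s - (1, δ)) (1, δ) t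
        rw [sub_add_cancel] at h
        rw [h, mul_comm]
      rw [h1, h2, add_comm]
  odd_sq := fun {s x} hs hx => by
    refine ext (A.odd_sq hs hx.1) ?_
    have h1 : χ.β s (s - (1, δ)) = - χ.β (1, δ) s := by
      have h := χ.β_add_right s (s - (1, δ)) (1, δ)
      rw [sub_add_cancel, χ.β_self, sg_odd hs] at h
      have h' := χ.β_swap s (1, δ)
      linear_combination (-χ.β s (s - (1, δ))) * h' - χ.β (1, δ) s * h
    simp only [mul_snd, zero_snd, A.color_comm hx.1 hx.2, A.tw_of_mem (1, δ) hx.1, h1,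
      mul_smul_comm, neg_smul, neg_add_cancel]

/-- The (skew) Koszul complex `E = Q⟨e₁, …, e_c | ∂ eᵢ = fᵢ⟩` on color homogeneous elements
`fᵢ ∈ Q` of color `δᵢ`, obtained by adjoining one exterior variable after the other. -/
def koszul : {n : ℕ} → {f : Fin n → Q.carrier} → {δ : Fin n → G} → (∀ i, f i ∈ Q.gr (δ i)) →
    ColorDGAlg Q
  | 0, _, _, _ => Q.toDGAlg
  | n + 1, _, _, h => (koszul (n := n) fun i => h i.castSucc).adjoinExt (h (Fin.last n))

/-- The variables `e₁, …, e_c` of the Koszul complex. -/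
def koszulVar : {n : ℕ} → {f : Fin n → Q.carrier} → {δ : Fin n → G} →
    (h : ∀ i, f i ∈ Q.gr (δ i)) → Fin n → (koszul h).carrier
  | 0, _, _, _ => Fin.elim0
  | n + 1, _, δ, h => Fin.lastCases (motive := fun _ => (koszul h).carrier)
      (ExtCarrier.mk (A := koszul (n := n) fun i => h i.castSucc) (δ := δ (Fin.last n)) 0 1)
      (fun i => ExtCarrier.incl (koszul (n := n) fun i => h i.castSucc) (δ (Fin.last n))
        (koszulVar (n := n) (fun i => h i.castSucc) i))

theorem koszulVar_last {n : ℕ} {f : Fin (n + 1) → Q.carrier} {δ : Fin (n + 1) → G}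
    (h : ∀ i, f i ∈ Q.gr (δ i)) : koszulVar h (Fin.last n) =
      ExtCarrier.mk (A := koszul (n := n) fun i => h i.castSucc) (δ := δ (Fin.last n)) 0 1 :=
  Fin.lastCases_last (motive := fun _ => (koszul h).carrier) ..

theorem koszulVar_castSucc {n : ℕ} {f : Fin (n + 1) → Q.carrier} {δ : Fin (n + 1) → G}
    (h : ∀ i, f i ∈ Q.gr (δ i)) (i : Fin n) : koszulVar h i.castSucc =
      ExtCarrier.incl (koszul (n := n) fun i => h i.castSucc) (δ (Fin.last n))
        (koszulVar (n := n) (fun i => h i.castSucc) i) :=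
  Fin.lastCases_castSucc (motive := fun _ => (koszul h).carrier) ..

theorem koszulVar_mem {n : ℕ} {f : Fin n → Q.carrier} {δ : Fin n → G}
    (h : ∀ i, f i ∈ Q.gr (δ i)) (i : Fin n) : koszulVar h i ∈ (koszul h).gr (1, δ i) := by
  induction n with
  | zero => exact i.elim0
  | succ n ih =>
    let E := koszul (n := n) fun i => h i.castSucc
    induction i using Fin.lastCases with
    | last =>
      rw [koszulVar_last]
      have h1 : (1 : E.carrier) ∈ E.gr ((1, δ (Fin.last n)) - (1, δ (Fin.last n))) := by
        rw [sub_self]; exact E.one_mem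
      exact ⟨Submodule.zero_mem (E.gr _), h1⟩
    | cast i =>
      rw [koszulVar_castSucc]
      exact ⟨ih (fun i => h i.castSucc) i, Submodule.zero_mem (E.gr _)⟩

theorem d_koszulVar {n : ℕ} {f : Fin n → Q.carrier} {δ : Fin n → G}
    (h : ∀ i, f i ∈ Q.gr (δ i)) (i : Fin n) :
    (koszul h).d (koszulVar h i) = (koszul h).unit (f i) := by
  induction n with
  | zero => exact i.elim0
  | succ n ih =>
    let E := koszul (n := n) fun i => h i.castSucc
    induction i using Fin.lastCases with
    | last =>
      rw [koszulVar_last]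
      have h1 : E.d 1 = 0 := by simpa using E.d_unit 1
      have h2 : E.sgn 1 = 1 := by rw [E.sgn_of_mem E.one_mem]; simp
      refine ExtCarrier.ext (A := E) (δ := δ (Fin.last n)) ?_ h1
      change E.d 0 + E.sgn 1 * E.unit (f (Fin.last n)) = E.unit (f (Fin.last n))
      rw [map_zero, h2, zero_add, one_mul]
    | cast i =>
      rw [koszulVar_castSucc]
      have := ih (fun i => h i.castSucc) i
      refine ExtCarrier.ext (A := E) (δ := δ (Fin.last n)) ?_ (map_zero E.d)
      change E.d (koszulVar (n := n) (fun i => h i.castSucc) i) +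
        E.sgn 0 * E.unit (f (Fin.last n)) = E.unit (f i.castSucc)
      rw [map_zero, zero_mul, add_zero]
      exact this

end Koszul

/-! ### Adjoining divided power variables; the resolution `Eᵉ⟨Y⟩` -/

section DividedPowers

open ColorDGBimod

variable {A : ColorDGAlg Q} {n : ℕ}

/-- The bidegree of `y^(H) = y₁^(h₁) ⋯ y_n^(h_n)`, where `yᵢ` has bidegree `(2, δᵢ)`. -/
def hdeg (δ : Fin n → G) (H : Fin n → ℕ) : Deg G := (2 * ∑ i, (H i : ℤ), ∑ i, H i • δ i)

/-- The scalar `∏_{j < i} χ(δⱼ, δᵢ)^{hⱼ}`, produced by moving an element of color `δᵢ` to the left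
past `y₁^(h₁) ⋯ y_{i-1}^(h_{i-1})`. -/
def kap (χ : AltBichar G k) (δ : Fin n → G) (i : Fin n) (H : Fin n → ℕ) : k :=
  ∏ j ∈ Finset.Iio i, χ.c (δ j) (δ i) ^ H j

/-- For `e ∈ A` of bidegree `(1, δ)`, the map `m ↦ (-1)^{|m|} m z` with `z = e ⊗ 1 - 1 ⊗ e ∈ Aᵉ`,
that is `m ↦ χ(m, e) e m - (-1)^{|m|} m e`. -/
def zAct (M : ColorDGBimod.{u, v} A A) (e : A.carrier) (δ : G) : M.carrier →ₗ[k] M.carrier :=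
  (M.lact e).comp (M.isGrading.scale fun s => χ.c s.2 δ) -
    (M.ract e).comp (M.isGrading.scale fun s => sg k s.1)

theorem hdeg_add (δ : Fin n → G) (H K : Fin n → ℕ) : hdeg δ (H + K) = hdeg δ H + hdeg δ K := by
  simp [hdeg, Finset.sum_add_distrib, mul_add, add_smul]

theorem hdeg_single (δ : Fin n → G) (i : Fin n) : hdeg δ (Pi.single i 1) = (2, δ i) := by
  ext
  · simp [hdeg, Pi.single_apply]
  · simp [hdeg, Pi.single_apply]

@[simp] theorem hdeg_zero (δ : Fin n → G) : hdeg δ 0 = 0 := by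
  ext <;> simp [hdeg]

theorem sub_single_add {H : Fin n → ℕ} {i : Fin n} (h : H i ≠ 0) :
    H - Pi.single i 1 + Pi.single i 1 = H := by
  ext j
  by_cases hj : j = i
  · subst hj; simp; omega
  · simp [hj]

theorem hdeg_sub_single (δ : Fin n → G) {H : Fin n → ℕ} {i : Fin n} (h : H i ≠ 0) :
    hdeg δ (H - Pi.single i 1) + (2, δ i) = hdeg δ H := by
  conv_rhs => rw [← sub_single_add h, hdeg_add, hdeg_single]

theorem sg_hdeg (δ : Fin n → G) (H : Fin n → ℕ) : sg k (hdeg δ H).1 = 1 := sg_even (by simp [hdeg])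

section zAct

variable {M : ColorDGBimod.{u, v} A A} {e e' : A.carrier} {δ δ' : G}

theorem zAct_of_mem {s : Deg G} {m} (hm : m ∈ M.gr s) :
    zAct M e δ m = χ.c s.2 δ • M.lact e m - sg k s.1 • M.ract e m := by
  simp [zAct, M.isGrading.scale_of_mem _ hm]

theorem zAct_mem (he : e ∈ A.gr (1, δ)) {s : Deg G} {m} (hm : m ∈ M.gr s) :
    zAct M e δ m ∈ M.gr (s + (1, δ)) := by
  rw [zAct_of_mem hm]
  refine Submodule.sub_mem _ (Submodule.smul_mem _ _ ?_) (Submodule.smul_mem _ _ (M.ract_mem hm he))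
  rw [add_comm]
  exact M.lact_mem he hm

theorem zAct_d (he : e ∈ A.gr (1, δ)) {f : Q.carrier} (hf : f ∈ Q.gr δ) (hd : A.d e = A.unit f)
    {s : Deg G} {m} (hm : m ∈ M.gr s) : M.d (zAct M e δ m) = - zAct M e δ (M.d m) := by
  rw [zAct_of_mem hm, zAct_of_mem (M.d_mem hm), map_sub, map_smul, map_smul, M.d_lact he,
    M.d_ract hm, hd, M.symm hf hm, smul_add, smul_add]
  simp only [Prod.fst_sub, Prod.snd_sub, sub_zero, sg_sub, sg_one, smul_smul, χ.c_swap,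
    sg_mul_self]
  module

theorem zAct_lact (he : e ∈ A.gr (1, δ)) {t : Deg G} {a} (ha : a ∈ A.gr t) {s : Deg G} {m}
    (hm : m ∈ M.gr s) : zAct M e δ (M.lact a m) = sg k t.1 • M.lact a (zAct M e δ m) := by
  have h : M.lact e (M.lact a m) = (sg k t.1 * χ.c δ t.2) • M.lact a (M.lact e m) := by
    rw [← M.mul_lact, A.color_comm he ha, map_smul, LinearMap.smul_apply, M.mul_lact]
    simp [AltBichar.β]
  rw [zAct_of_mem hm, zAct_of_mem (M.lact_mem ha hm), h, map_sub, map_smul, map_smul,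
    ← M.lact_ract, smul_sub, smul_smul, smul_smul, smul_smul, Prod.fst_add, Prod.snd_add, sg_add,
    χ.c_add_left]
  congr 2
  linear_combination (χ.c s.2 δ * sg k t.1) * χ.c_swap t.2 δ

theorem zAct_ract (he : e ∈ A.gr (1, δ)) {t : Deg G} {b} (hb : b ∈ A.gr t) {s : Deg G} {m}
    (hm : m ∈ M.gr s) : zAct M e δ (M.ract b m) = χ.c t.2 δ • M.ract b (zAct M e δ m) := by
  have h : M.ract e (M.ract b m) = (sg k t.1 * χ.c t.2 δ) • M.ract b (M.ract e m) := by
    rw [← M.mul_ract, A.color_comm hb he, map_smul, LinearMap.smul_apply, M.mul_ract]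
    simp [AltBichar.β]
  rw [zAct_of_mem hm, zAct_of_mem (M.ract_mem hm hb), h, map_sub, map_smul, map_smul,
    M.lact_ract, smul_sub, smul_smul, smul_smul, smul_smul, Prod.fst_add, Prod.snd_add, sg_add,
    χ.c_add_left]
  congr 2
  · ring
  · linear_combination (sg k s.1 * χ.c t.2 δ) * sg_mul_self (k := k) t.1

theorem zAct_zAct (he : e ∈ A.gr (1, δ)) (he' : e' ∈ A.gr (1, δ')) {s : Deg G} {m}
    (hm : m ∈ M.gr s) :
    zAct M e' δ' (zAct M e δ m) = - χ.c δ δ' • zAct M e δ (zAct M e' δ' m) := by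
  have h1 : M.lact e' (M.lact e m) = - χ.c δ' δ • M.lact e (M.lact e' m) := by
    rw [← M.mul_lact, A.color_comm he' he, map_smul, LinearMap.smul_apply, M.mul_lact]
    simp [AltBichar.β]
  have h2 : M.ract e' (M.ract e m) = - χ.c δ δ' • M.ract e (M.ract e' m) := by
    rw [← M.mul_ract, A.color_comm he he', map_smul, LinearMap.smul_apply, M.mul_ract]
    simp [AltBichar.β]
  rw [zAct_of_mem (zAct_mem he hm), zAct_of_mem (zAct_mem he' hm), zAct_of_mem hm,
    zAct_of_mem hm]
  simp only [map_sub, map_smul, h1, h2, M.lact_ract, Prod.fst_add, Prod.snd_add, sg_add, sg_one,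
    χ.c_add_left, smul_sub, smul_smul]
  have h3 := χ.c_swap δ δ'
  have e1 : χ.c s.2 δ' * χ.c δ δ' * (χ.c s.2 δ * -χ.c δ' δ) =
      -χ.c s.2 δ' * χ.c s.2 δ := by linear_combination (-χ.c s.2 δ' * χ.c s.2 δ) * h3
  have e2 : -χ.c δ δ' * (χ.c s.2 δ * χ.c δ' δ * χ.c s.2 δ') =
      -χ.c s.2 δ' * χ.c s.2 δ := by linear_combination (-χ.c s.2 δ' * χ.c s.2 δ) * h3
  have e3 : -χ.c δ δ' * (χ.c s.2 δ * χ.c δ' δ * sg k s.1) =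
      -χ.c s.2 δ * sg k s.1 := by linear_combination (-χ.c s.2 δ * sg k s.1) * h3
  simp only [e1, e2, e3]
  module

theorem zAct_self (he : e ∈ A.gr (1, δ)) {s : Deg G} {m} (hm : m ∈ M.gr s) :
    zAct M e δ (zAct M e δ m) = 0 := by
  have h0 : e * e = 0 := A.odd_sq (s := (1, δ)) (by simp) he
  have h1 : M.lact e (M.lact e m) = 0 := by rw [← M.mul_lact, h0]; simp
  have h2 : M.ract e (M.ract e m) = 0 := by rw [← M.mul_ract, h0]; simp
  rw [zAct_of_mem (zAct_mem he hm), zAct_of_mem hm]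
  simp only [map_sub, map_smul, h1, h2, M.lact_ract, Prod.fst_add, Prod.snd_add, sg_add, sg_one,
    χ.c_add_left, χ.c_self, smul_sub, smul_smul]
  module

end zAct

/-- The underlying vector space of `M⟨Y⟩ = ⨁_H M y^(H)`. -/
def DPCarrier (M : ColorDGBimod.{u, v} A A) (n : ℕ) : Type v := (Fin n → ℕ) →₀ M.carrier

namespace DP

variable (M : ColorDGBimod.{u, v} A A) (e : Fin n → A.carrier) (δ : Fin n → G)

instance : AddCommGroup (DPCarrier M n) :=
  inferInstanceAs (AddCommGroup ((Fin n → ℕ) →₀ M.carrier))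
instance : Module k (DPCarrier M n) :=
  inferInstanceAs (Module k ((Fin n → ℕ) →₀ M.carrier))

/-- The element `m y^(H)`. -/
def single (H : Fin n → ℕ) : M.carrier →ₗ[k] DPCarrier M n := Finsupp.lsingle H

/-- The coefficient of `y^(H)`. -/
def coeff (H : Fin n → ℕ) : DPCarrier M n →ₗ[k] M.carrier := Finsupp.lapply H

variable {M}

/-- The linear map determined by its values on the elements `m y^(H)`. -/
def lift {V : Type*} [AddCommGroup V] [Module k V] (F : (Fin n → ℕ) → M.carrier →ₗ[k] V) :
    DPCarrier M n →ₗ[k] V := Finsupp.lsum k F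

@[simp] theorem lift_single {V : Type*} [AddCommGroup V] [Module k V]
    (F : (Fin n → ℕ) → M.carrier →ₗ[k] V) (H m) : lift F (single M H m) = F H m := by
  change (Finsupp.lsum k F) (Finsupp.single H m) = F H m
  simp

theorem coeff_single_self (H : Fin n → ℕ) (m) : coeff M H (single M H m) = m := by
  change (Finsupp.single H m) H = m
  simp

theorem coeff_single_ne {H K : Fin n → ℕ} (h : H ≠ K) (m) : coeff M K (single M H m) = 0 := by
  change (Finsupp.single H m) K = 0
  simp [h]

theorem hom_ext {V : Type*} [AddCommGroup V] [Module k V] {f g : DPCarrier M n →ₗ[k] V}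
    (h : ∀ H s, ∀ m ∈ M.gr s, f (single M H m) = g (single M H m)) : f = g :=
  Finsupp.lhom_ext' fun H => M.isGrading.linext fun s m hm => h H s m hm

theorem mem_of_single {V : Type*} [AddCommGroup V] [Module k V] {f : DPCarrier M n →ₗ[k] V}
    {W : Submodule k V} {p : DPCarrier M n} (h : ∀ H, f (single M H (coeff M H p)) ∈ W) :
    f p ∈ W := by
  have h1 : p = ∑ H ∈ Finsupp.support (M := M.carrier) p, single M H (coeff M H p) :=
    (Finsupp.sum_single (M := M.carrier) p).symm
  have h2 := (congrArg f h1).trans (map_sum f _ _)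
  rw [h2]
  exact Submodule.sum_mem _ fun H _ => h H

variable (M)

/-- The bidegree decomposition of `M⟨Y⟩`: `m y^(H)` has bidegree `|m| + |y^(H)|`. -/
def gr (s : Deg G) : Submodule k (DPCarrier M n) where
  carrier := {p | ∀ H, coeff M H p ∈ M.gr (s - hdeg δ H)}
  add_mem' := fun h h' H => by rw [map_add]; exact Submodule.add_mem _ (h H) (h' H)
  zero_mem' := fun H => by rw [map_zero]; exact Submodule.zero_mem _
  smul_mem' := fun c _ h H => by rw [map_smul]; exact Submodule.smul_mem _ c (h H)

variable {M δ}

theorem single_mem {H : Fin n → ℕ} {s t : Deg G} (h : t + hdeg δ H = s) {m} (hm : m ∈ M.gr t) :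
    single M H m ∈ gr M δ s := by
  intro K
  by_cases hK : H = K
  · subst hK
    rw [coeff_single_self]
    rwa [← h, add_sub_cancel_right]
  · rw [coeff_single_ne hK]
    exact Submodule.zero_mem _

theorem map_mem {V : Type*} [AddCommGroup V] [Module k V] {f : DPCarrier M n →ₗ[k] V}
    {W : Submodule k V} {s : Deg G} (h : ∀ H t, t + hdeg δ H = s → ∀ m ∈ M.gr t,
      f (single M H m) ∈ W) {p} (hp : p ∈ gr M δ s) : f p ∈ W :=
  mem_of_single fun H => h H _ (sub_add_cancel _ _) _ (hp H)

theorem eqOn {V : Type*} [AddCommGroup V] [Module k V] {f g : DPCarrier M n →ₗ[k] V}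
    {s : Deg G} (h : ∀ H t, t + hdeg δ H = s → ∀ m ∈ M.gr t,
      f (single M H m) = g (single M H m)) {p} (hp : p ∈ gr M δ s) : f p = g p := by
  have : (f - g) p ∈ (⊥ : Submodule k V) := map_mem (f := f - g) (fun H t ht m hm => by
    simp [h H t ht m hm]) hp
  simpa [sub_eq_zero] using this

theorem gr_isGrading : IsGrading (gr (n := n) M δ) := by
  refine isGrading_of_dec (lift fun H =>
    (Finsupp.lsum k fun t => (Finsupp.lsingle (t + hdeg δ H)).comp (single M H)).comp
      M.isGrading.dec) ?_ ?_
  · intro s p hp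
    refine eqOn (δ := δ) (g := Finsupp.lsingle s) ?_ hp
    rintro H t rfl m hm
    simp [M.isGrading.dec_of_mem hm]
  · rw [eq_top_iff]
    rintro p -
    refine mem_of_single (f := LinearMap.id) fun H => ?_
    refine M.isGrading.induction (p := fun m => LinearMap.id (single M H m) ∈ ⨆ s, gr M δ s)
      ?_ ?_ ?_ (coeff M H p)
    · intro s m hm
      exact Submodule.mem_iSup_of_mem (s + hdeg δ H) (single_mem rfl hm)
    · intro a b ha hb
      rw [map_add]; exact Submodule.add_mem _ ha hb
    · rw [map_zero]; exact Submodule.zero_mem _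

variable (M n)

/-- The left action `a (m y^(H)) = (a m) y^(H)`. -/
def lact : A.carrier →ₗ[k] DPCarrier M n →ₗ[k] DPCarrier M n where
  toFun a := lift fun H => (single M H).comp (M.lact a)
  map_add' a b := hom_ext fun H s m _ => by simp
  map_smul' c a := hom_ext fun H s m _ => by simp

variable (δ)

/-- The right action `(m y^(H)) b = (-1)^{|y^(H)||b|} χ(y^(H), b) (m b) y^(H)`. -/
def ract : A.carrier →ₗ[k] DPCarrier M n →ₗ[k] DPCarrier M n where
  toFun b := lift fun H => (single M H).comp (M.ract (A.tw (hdeg δ H) b))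
  map_add' a b := hom_ext fun H s m _ => by simp
  map_smul' c a := hom_ext fun H s m _ => by simp

variable {n} {M δ}

@[simp] theorem lact_single (a : A.carrier) (H : Fin n → ℕ) (m) :
    lact n M a (single M H m) = single M H (M.lact a m) := by simp [lact]

@[simp] theorem ract_single (b : A.carrier) (H : Fin n → ℕ) (m) :
    ract n M δ b (single M H m) = single M H (M.ract (A.tw (hdeg δ H) b) m) := by simp [ract]

theorem ract_single_of_mem {t : Deg G} {b : A.carrier} (hb : b ∈ A.gr t) (H : Fin n → ℕ) (m) :
    ract n M δ b (single M H m) = χ.β (hdeg δ H) t • single M H (M.ract b m) := by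
  simp [A.tw_of_mem _ hb]

variable (M n)

/-- The part `m y^(H) ↦ (d m) y^(H)` of the differential. -/
def d₀ : DPCarrier M n →ₗ[k] DPCarrier M n := lift fun H => (single M H).comp M.d

variable (δ)

/-- The part `m y^(H) ↦ (-1)^{|m|} m (y₁^(h₁) ⋯ (∂yᵢ) yᵢ^(hᵢ - 1) ⋯ y_n^(h_n))` of the differential,
where `∂yᵢ = zᵢ = eᵢ ⊗ 1 - 1 ⊗ eᵢ`. It equals
`∏_{j < i} χ(yⱼ, yᵢ)^{hⱼ} (-1)^{|m|} (m zᵢ) y^(H - 1ᵢ)`, and `0` for `hᵢ = 0`. -/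
def dVar (i : Fin n) : DPCarrier M n →ₗ[k] DPCarrier M n :=
  lift fun H => if H i = 0 then 0 else
    kap χ δ i H • (single M (H - Pi.single i 1)).comp (zAct M (e i) (δ i))

/-- The differential of `M⟨Y⟩`. -/
def d : DPCarrier M n →ₗ[k] DPCarrier M n := d₀ n M + ∑ i, dVar n M e δ i

variable {n} {M δ e}

@[simp] theorem d₀_single (H : Fin n → ℕ) (m) : d₀ n M (single M H m) = single M H (M.d m) := by
  simp [d₀]

theorem dVar_single (i : Fin n) (H : Fin n → ℕ) (m) :
    dVar n M e δ i (single M H m) = if H i = 0 then 0 else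
      kap χ δ i H • single M (H - Pi.single i 1) (zAct M (e i) (δ i) m) := by
  rw [dVar, lift_single]
  split_ifs <;> simp

theorem d_single (H : Fin n → ℕ) (m) : d n M e δ (single M H m) = single M H (M.d m) +
    ∑ i, dVar n M e δ i (single M H m) := by
  simp [d]

theorem kap_sub_of_le {i j : Fin n} (h : j ≤ i) (H : Fin n → ℕ) :
    kap χ δ j (H - Pi.single i 1) = kap χ δ j H := by
  refine Finset.prod_congr rfl fun l hl => ?_
  have : l ≠ i := ((Finset.mem_Iio.1 hl).trans_le h).ne
  simp [this]

theorem kap_sub_of_lt {i j : Fin n} (h : i < j) {H : Fin n → ℕ} (hi : H i ≠ 0) :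
    kap χ δ j H = χ.c (δ i) (δ j) * kap χ δ j (H - Pi.single i 1) := by
  have hm : i ∈ Finset.Iio j := Finset.mem_Iio.2 h
  rw [kap, kap, ← Finset.mul_prod_erase _ _ hm, ← Finset.mul_prod_erase _ _ hm, ← mul_assoc]
  congr 1
  · rw [← pow_succ']
    congr 1
    simp
    omega
  · refine Finset.prod_congr rfl fun l hl => ?_
    have : l ≠ i := (Finset.mem_erase.1 hl).1
    simp [this]

theorem dVar_mem (he : ∀ i, e i ∈ A.gr (1, δ i)) (i : Fin n) {s t : Deg G} {H : Fin n → ℕ}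
    (hs : t + hdeg δ H = s) {m} (hm : m ∈ M.gr t) :
    dVar n M e δ i (single M H m) ∈ gr M δ (s - one₁ G) := by
  rw [dVar_single]
  split_ifs with h
  · exact Submodule.zero_mem _
  · refine Submodule.smul_mem _ _ (single_mem ?_ (zAct_mem (he i) hm))
    rw [← hs, ← hdeg_sub_single δ h]
    ext
    · simp; ring
    · simp; abel

theorem d₀_dVar (he : ∀ i, e i ∈ A.gr (1, δ i)) {f : Fin n → Q.carrier}
    (hf : ∀ i, f i ∈ Q.gr (δ i)) (hd : ∀ i, A.d (e i) = A.unit (f i)) (i : Fin n) :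
    (d₀ n M).comp (dVar n M e δ i) + (dVar n M e δ i).comp (d₀ n M) = 0 := by
  refine hom_ext fun H s m hm => ?_
  simp only [LinearMap.add_apply, LinearMap.comp_apply, d₀_single, dVar_single,
    LinearMap.zero_apply]
  split_ifs
  · simp
  · simp [zAct_d (he i) (hf i) (hd i) hm]

theorem dVar_dVar_self (he : ∀ i, e i ∈ A.gr (1, δ i)) (i : Fin n) :
    (dVar n M e δ i).comp (dVar n M e δ i) = 0 := by
  refine hom_ext fun H s m hm => ?_
  simp only [LinearMap.comp_apply, dVar_single, LinearMap.zero_apply]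
  split_ifs
  · simp
  · rw [map_smul, dVar_single]
    split_ifs
    · simp
    · simp [zAct_self (he i) hm]

theorem dVar_dVar_lt (he : ∀ i, e i ∈ A.gr (1, δ i)) {i j : Fin n} (hij : i < j) :
    (dVar n M e δ i).comp (dVar n M e δ j) + (dVar n M e δ j).comp (dVar n M e δ i) = 0 := by
  refine hom_ext fun H s m hm => ?_
  have e1 : (H - Pi.single j 1 : Fin n → ℕ) i = H i := by simp [hij.ne]
  have e2 : (H - Pi.single i 1 : Fin n → ℕ) j = H j := by simp [hij.ne']
  simp only [LinearMap.add_apply, LinearMap.comp_apply, dVar_single, LinearMap.zero_apply]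
  by_cases hi : H i = 0
  · by_cases hj : H j = 0
    · simp [hi, hj]
    · simp [hi, hj, dVar_single, e1]
  · by_cases hj : H j = 0
    · simp [hi, hj, dVar_single, e2]
    · simp only [hi, hj, if_false, map_smul, dVar_single, e1, e2]
      rw [kap_sub_of_le hij.le, kap_sub_of_lt hij hi, zAct_zAct (he i) (he j) hm,
        tsub_right_comm, map_smul, smul_smul, smul_smul, smul_smul, ← add_smul]
      convert zero_smul k _
      ring

theorem d_d (he : ∀ i, e i ∈ A.gr (1, δ i)) {f : Fin n → Q.carrier}
    (hf : ∀ i, f i ∈ Q.gr (δ i)) (hd : ∀ i, A.d (e i) = A.unit (f i)) :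
    (d n M e δ).comp (d n M e δ) = 0 := by
  have h0 : (d₀ n M).comp (d₀ n M) = 0 := hom_ext fun H s m _ => by simp [M.d_d]
  have h1 : ∑ i, ∑ j, (dVar n M e δ i).comp (dVar n M e δ j) = 0 := by
    rw [← Finset.sum_product']
    refine Finset.sum_involution (fun p _ => (p.2, p.1)) ?_ ?_ (by simp) (by simp)
    · rintro ⟨i, j⟩ -
      rcases lt_trichotomy i j with h | h | h
      · exact dVar_dVar_lt he h
      · subst h; simp [dVar_dVar_self he]
      · rw [add_comm]; exact dVar_dVar_lt he h
    · rintro ⟨i, j⟩ - hne heq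
      simp only [Prod.mk.injEq] at heq
      obtain rfl := heq.1
      exact hne (dVar_dVar_self he _)
  have h2 : ∑ i, ((d₀ n M).comp (dVar n M e δ i) + (dVar n M e δ i).comp (d₀ n M)) = 0 :=
    Finset.sum_eq_zero fun i _ => d₀_dVar he hf hd i
  rw [Finset.sum_add_distrib] at h2
  ext p
  have h1' := LinearMap.congr_fun h1 p
  have h2' := LinearMap.congr_fun h2 p
  have h0' := LinearMap.congr_fun h0 p
  simp only [LinearMap.sum_apply, LinearMap.comp_apply, LinearMap.add_apply,
    LinearMap.zero_apply] at h0' h1' h2'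
  simp only [d, LinearMap.comp_apply, LinearMap.add_apply, LinearMap.sum_apply, map_add, map_sum,
    LinearMap.zero_apply, h0', Finset.sum_add_distrib, zero_add]
  rw [← add_assoc, add_comm (∑ i, dVar n M e δ i (d₀ n M p)), h2', zero_add, Finset.sum_comm]
  exact h1'

theorem dVar_lact (he : ∀ i, e i ∈ A.gr (1, δ i)) (i : Fin n) {t : Deg G} {a} (ha : a ∈ A.gr t) :
    (dVar n M e δ i).comp (lact n M a) = sg k t.1 • (lact n M a).comp (dVar n M e δ i) := by
  refine hom_ext fun H s m hm => ?_
  simp only [LinearMap.comp_apply, lact_single, dVar_single, LinearMap.smul_apply]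
  split_ifs
  · simp
  · simp [zAct_lact (he i) ha hm, smul_smul, mul_comm]

theorem β_hdeg_sub (δ : Fin n → G) {H : Fin n → ℕ} {i : Fin n} (h : H i ≠ 0) (t : Deg G) :
    χ.β (hdeg δ H) t * χ.c t.2 (δ i) = χ.β (hdeg δ (H - Pi.single i 1)) t := by
  rw [← hdeg_sub_single δ h, χ.β_add_left, mul_assoc]
  have : χ.β (2, δ i) t = χ.c (δ i) t.2 := by
    have : sg k (2 * t.1) = 1 := sg_even (by simp)
    simp [AltBichar.β, this]
  rw [this, χ.c_swap, mul_one]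

theorem dVar_ract (he : ∀ i, e i ∈ A.gr (1, δ i)) (i : Fin n) {t : Deg G} {b} (hb : b ∈ A.gr t) :
    (dVar n M e δ i).comp (ract n M δ b) = (ract n M δ b).comp (dVar n M e δ i) := by
  refine hom_ext fun H s m hm => ?_
  simp only [LinearMap.comp_apply, ract_single_of_mem hb, map_smul, dVar_single]
  split_ifs with h
  · simp
  · rw [zAct_ract (he i) hb hm, map_smul, map_smul, ract_single_of_mem hb, ← β_hdeg_sub δ h]
    simp only [smul_smul]
    congr 1
    ring

end DP

open DP in
/-- The color DG bimodule `M⟨Y | ∂yᵢ = eᵢ ⊗ 1 - 1 ⊗ eᵢ⟩` obtained by adjoining (skew) divided power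
variables `y₁, …, y_n` of bidegrees `(2, δᵢ)`. Here `eᵢ ∈ A` has bidegree `(1, δᵢ)` and
`d eᵢ = fᵢ` comes from `Q`, so that `eᵢ ⊗ 1 - 1 ⊗ eᵢ` is a cycle of `Aᵉ`. -/
def adjoinDP (M : ColorDGBimod.{u, v} A A) {e : Fin n → A.carrier} {δ : Fin n → G}
    {f : Fin n → Q.carrier} (he : ∀ i, e i ∈ A.gr (1, δ i)) (hf : ∀ i, f i ∈ Q.gr (δ i))
    (hd : ∀ i, A.d (e i) = A.unit (f i)) : ColorDGBimod.{u, v} A A where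
  carrier := DPCarrier M n
  gr := DP.gr M δ
  isGrading := DP.gr_isGrading
  lact := DP.lact n M
  ract := DP.ract n M δ
  one_lact := fun p => by
    have : DP.lact n M 1 = LinearMap.id := hom_ext fun H s m _ => by simp [M.one_lact]
    exact LinearMap.congr_fun this p
  mul_lact := fun a a' p => by
    have : DP.lact n M (a * a') = (DP.lact n M a).comp (DP.lact n M a') :=
      hom_ext fun H s m _ => by simp [M.mul_lact]
    exact LinearMap.congr_fun this p
  one_ract := fun p => by
    have : DP.ract n M δ 1 = LinearMap.id := hom_ext fun H s m _ => by
      simp [M.one_ract, ColorDGAlg.tw_one]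
    exact LinearMap.congr_fun this p
  mul_ract := fun b b' p => by
    have : DP.ract n M δ (b * b') = (DP.ract n M δ b').comp (DP.ract n M δ b) :=
      hom_ext fun H s m _ => by simp [M.mul_ract, ColorDGAlg.tw_mul]
    exact LinearMap.congr_fun this p
  lact_ract := fun a b p => by
    have : (DP.lact n M a).comp (DP.ract n M δ b) = (DP.ract n M δ b).comp (DP.lact n M a) :=
      hom_ext fun H s m _ => by simp [M.lact_ract]
    exact LinearMap.congr_fun this p
  lact_mem := fun {s t a p} ha hp => by
    refine DP.map_mem (δ := δ) (f := DP.lact n M a) ?_ hp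
    rintro H r rfl m hm
    rw [lact_single]
    exact single_mem (add_assoc _ _ _) (M.lact_mem ha hm)
  ract_mem := fun {s t b p} hp hb => by
    refine DP.map_mem (δ := δ) (f := DP.ract n M δ b) ?_ hp
    rintro H r rfl m hm
    rw [ract_single_of_mem hb]
    exact Submodule.smul_mem _ _ (single_mem (by abel) (M.ract_mem hm hb))
  d := DP.d n M e δ
  d_mem := fun {s p} hp => by
    refine DP.map_mem (δ := δ) (f := DP.d n M e δ) ?_ hp
    intro H r hr m hm
    rw [d_single]
    refine Submodule.add_mem _ (single_mem ?_ (M.d_mem hm))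
      (Submodule.sum_mem _ fun i _ => dVar_mem he i hr hm)
    rw [← hr]; abel
  d_d := fun p => LinearMap.congr_fun (DP.d_d he hf hd) p
  d_lact := fun {s a} ha p => by
    have : (DP.d n M e δ).comp (DP.lact n M a) =
        DP.lact n M (A.d a) + sg k s.1 • (DP.lact n M a).comp (DP.d n M e δ) := by
      refine hom_ext fun H t m hm => ?_
      have h : ∀ i, dVar n M e δ i (single M H (M.lact a m)) =
          sg k s.1 • DP.lact n M a (dVar n M e δ i (single M H m)) := fun i => by
        have := LinearMap.congr_fun (dVar_lact (M := M) he i ha) (single M H m)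
        simpa using this
      simp only [LinearMap.comp_apply, LinearMap.add_apply, LinearMap.smul_apply, lact_single,
        d_single, M.d_lact ha, map_add, map_smul, map_sum, h, smul_add, Finset.smul_sum, add_assoc]
    exact LinearMap.congr_fun this p
  d_ract := fun {s p} hp b => by
    have key : ∀ H t, t + hdeg δ H = s → ∀ m ∈ M.gr t,
        ((DP.d n M e δ).comp ((DP.ract n M δ).flip (single M H m))) =
        ((DP.ract n M δ).flip (DP.d n M e δ (single M H m))) +
          sg k s.1 • ((DP.ract n M δ).flip (single M H m)).comp A.d := by
      rintro H t rfl m hm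
      refine A.isGrading.linext fun r b hb => ?_
      have h : ∀ i, dVar n M e δ i (DP.ract n M δ b (single M H m)) =
          DP.ract n M δ b (dVar n M e δ i (single M H m)) := fun i =>
        LinearMap.congr_fun (dVar_ract (M := M) he i hb) (single M H m)
      have h1 : DP.d n M e δ (DP.ract n M δ b (single M H m)) =
          d₀ n M (DP.ract n M δ b (single M H m)) +
            ∑ i, dVar n M e δ i (DP.ract n M δ b (single M H m)) := by
        simp [DP.d]
      have h2 : χ.β (hdeg δ H) (r - one₁ G) = χ.β (hdeg δ H) r := by
        rw [χ.β_sub_one_right, sg_hdeg, one_mul]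
      simp only [LinearMap.comp_apply, LinearMap.add_apply, LinearMap.smul_apply,
        LinearMap.flip_apply, h1, h, d_single, map_add, map_sum, ract_single_of_mem hb,
        ract_single_of_mem (A.d_mem hb), map_smul, d₀_single, M.d_ract hm, h2, Prod.fst_add,
        sg_add, sg_hdeg, mul_one, smul_add, smul_smul]
      simp only [LinearMap.sum_apply, LinearMap.flip_apply, ← h, ract_single_of_mem hb, map_smul,
        Finset.smul_sum]
      rw [mul_comm (sg k t.1)]
      abel
    exact DP.eqOn (δ := δ) (f := (DP.d n M e δ).comp (DP.ract n M δ b))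
      (g := (DP.ract n M δ b).comp (DP.d n M e δ) + sg k s.1 • DP.ract n M δ (A.d b))
      (fun H t ht m hm => LinearMap.congr_fun (key H t ht m hm) b) hp
  symm := fun {a q s p} hq hp => by
    refine DP.eqOn (δ := δ) (f := DP.lact n M (A.unit q))
      (g := χ.c a s.2 • DP.ract n M δ (A.unit q)) ?_ hp
    rintro H t rfl m hm
    rw [lact_single, LinearMap.smul_apply, ract_single_of_mem (A.unit_mem hq), M.symm hq hm,
      map_smul, smul_smul, Prod.snd_add, χ.c_add_right]
    congr 1
    simp only [AltBichar.β, mul_zero, sg_zero, one_mul]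
    linear_combination (-χ.c a t.2) * χ.c_swap a (hdeg δ H).2

/-- The enveloping algebra `Aᵉ = A ⊗_Q A`, as a color DG `A`-bimodule, i.e. as a color DG
`Aᵉ`-module. -/
def ColorDGAlg.env (A : ColorDGAlg Q) : ColorDGBimod.{u, u} A A :=
  tens A.reg.restrictRight A.reg.restrictLeft

/-- The element `a ⊗ b` of `Aᵉ`. -/
def ColorDGAlg.envMk (A : ColorDGAlg Q) (a b : A.carrier) : A.env.carrier :=
  tmk A.reg.restrictRight A.reg.restrictLeft a b

/-- The multiplication `Aᵉ → A`, `a ⊗ b ↦ a b`, as a linear map. -/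
def ColorDGAlg.envMulLin (A : ColorDGAlg Q) :
    TensCarrier A.reg.restrictRight A.reg.restrictLeft →ₗ[k] A.reg.carrier :=
  tlift (M := A.reg.restrictRight) (N := A.reg.restrictLeft) (LinearMap.mul k A.carrier)
    fun _ _ _ _ _ _ _ _ _ => mul_assoc (G := A.carrier) _ _ _

theorem ColorDGAlg.envMulLin_tmk (A : ColorDGAlg Q) (a b : A.carrier) :
    A.envMulLin (tmk A.reg.restrictRight A.reg.restrictLeft a b) = (a * b : A.carrier) :=
  tlift_tmk _ _ _ _

/-- The multiplication `Aᵉ → A`, `a ⊗ b ↦ a b`. -/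
def ColorDGAlg.envMul (A : ColorDGAlg Q) : DGMor A.env A.reg where
  toLin := A.envMulLin
  map_gr := fun {s z} hz => by
    refine tensGr_le (f := A.envMulLin) ?_ hz
    rintro p q rfl m hm n hn
    exact A.envMulLin_tmk m n ▸ A.mul_mem hm hn
  map_lact := fun a z => by
    have : A.envMulLin.comp (tensLact A.reg.restrictRight A.reg.restrictLeft a) =
        (A.reg.lact a).comp A.envMulLin :=
      tens_ext fun s m _ t n _ => by
        rw [LinearMap.comp_apply, tensLact_tmk]
        exact ((A.envMulLin_tmk (A.ring.mul a m) n).trans (mul_assoc (G := A.carrier) _ _ _)).trans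
          (congrArg (A.reg.lact a) (A.envMulLin_tmk m n).symm)
    exact LinearMap.congr_fun this z
  map_ract := fun a z => by
    have : A.envMulLin.comp (tensRact A.reg.restrictRight A.reg.restrictLeft a) =
        (A.reg.ract a).comp A.envMulLin :=
      tens_ext fun s m _ t n _ => by
        rw [LinearMap.comp_apply, tensRact_tmk]
        exact ((A.envMulLin_tmk m (A.ring.mul n a)).trans
          (mul_assoc (G := A.carrier) _ _ _).symm).trans
          (congrArg (A.reg.ract a) (A.envMulLin_tmk m n).symm)
    exact LinearMap.congr_fun this z
  map_d := fun z => by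
    have : A.envMulLin.comp (tensD A.reg.restrictRight A.reg.restrictLeft) =
        A.reg.d.comp A.envMulLin :=
      tens_ext fun s m hm t n _ => by
        rw [LinearMap.comp_apply, tensD_tmk hm, map_add, map_smul, LinearMap.comp_apply]
        refine Eq.trans ?_ (congrArg A.reg.d (A.envMulLin_tmk m n).symm)
        refine Eq.trans ?_ (A.leibniz hm n).symm
        exact congrArg₂ (fun (x y : A.carrier) => x + sg k s.1 • y) (A.envMulLin_tmk (A.d m) n)
          (A.envMulLin_tmk m (A.d n))
    exact LinearMap.congr_fun this z

theorem zAct_reg {e : A.carrier} {δ : G} (he : e ∈ A.gr (1, δ)) : zAct A.reg e δ = 0 := by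
  refine A.reg.isGrading.linext fun s m hm => ?_
  rw [zAct_of_mem hm]
  have h3 : A.reg.ract e m = χ.β s (1, δ) • A.reg.lact e m := A.color_comm hm he
  rw [h3, smul_smul, ← sub_smul]
  have h : χ.c s.2 δ - sg k s.1 * χ.β s (1, δ) = 0 := by
    simp only [AltBichar.β, mul_one]
    linear_combination (-χ.c s.2 δ) * sg_mul_self (k := k) s.1
  rw [h, zero_smul, LinearMap.zero_apply]

theorem DGMor.zAct {M : ColorDGBimod.{u, v} A A} {N : ColorDGBimod.{u, w} A A} (φ : DGMor M N)
    (e : A.carrier) (δ : G) (m) : φ.toLin (zAct M e δ m) = ColorDG.zAct N e δ (φ.toLin m) := by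
  have : φ.toLin.comp (ColorDG.zAct M e δ) = (ColorDG.zAct N e δ).comp φ.toLin :=
    M.isGrading.linext fun s m hm => by
      simp [zAct_of_mem hm, zAct_of_mem (φ.map_gr hm), φ.map_lact, φ.map_ract]
  exact LinearMap.congr_fun this m

/-- The linear map `Aᵉ⟨Y⟩ → A` with `(a ⊗ b) y^(H) ↦ a b` for `H = 0` and `↦ 0` for `H ≠ 0`. -/
def dpAugLin (n : ℕ) (A : ColorDGAlg Q) : DPCarrier A.env n →ₗ[k] A.reg.carrier :=
  A.envMul.toLin.comp (DP.coeff A.env 0)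

open DP in
/-- The augmentation `Aᵉ⟨Y⟩ → A` with `(a ⊗ b) y^(H) ↦ a b` for `H = 0` and `↦ 0` for `H ≠ 0`. -/
def dpAug {e : Fin n → A.carrier} {δ : Fin n → G}
    {f : Fin n → Q.carrier} (he : ∀ i, e i ∈ A.gr (1, δ i)) (hf : ∀ i, f i ∈ Q.gr (δ i))
    (hd : ∀ i, A.d (e i) = A.unit (f i)) : DGMor (adjoinDP A.env he hf hd) A.reg where
  toLin := dpAugLin n A
  map_gr := fun {s p} hp => by
    refine A.envMul.map_gr ?_
    have := (show ∀ H : Fin n → ℕ, coeff A.env H p ∈ A.env.gr (s - hdeg δ H) from hp) 0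
    rwa [hdeg_zero, sub_zero] at this
  map_lact := fun a p => by
    have : (coeff A.env 0).comp (DP.lact n A.env a) = (A.env.lact a).comp (coeff A.env 0) :=
      hom_ext fun H s m _ => by
        by_cases h : H = 0
        · subst h; simp [coeff_single_self]
        · simp [coeff_single_ne h]
    exact (congrArg A.envMul.toLin (LinearMap.congr_fun this p)).trans (A.envMul.map_lact _ _)
  map_ract := fun b p => by
    have : (coeff A.env 0).comp (DP.ract n A.env δ b) = (A.env.ract b).comp (coeff A.env 0) :=
      hom_ext fun H s m _ => by
        by_cases h : H = 0
        · subst h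
          have : A.tw 0 b = b := by
            have : A.tw 0 = LinearMap.id := A.isGrading.linext fun s a ha => by
              simp [A.tw_of_mem 0 ha]
            rw [this]; rfl
          simp [coeff_single_self, this]
        · simp [coeff_single_ne h]
    exact (congrArg A.envMul.toLin (LinearMap.congr_fun this p)).trans (A.envMul.map_ract _ _)
  map_d := fun p => by
    have h1 : ∀ i, (A.envMul.toLin.comp (coeff A.env 0)).comp (dVar n A.env e δ i) = 0 := by
      intro i
      refine hom_ext fun H s m hm => ?_
      simp only [LinearMap.comp_apply, dVar_single, LinearMap.zero_apply]
      split_ifs with h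
      · simp
      · rw [map_smul, map_smul]
        by_cases h' : H - Pi.single i 1 = 0
        · rw [h', coeff_single_self, DGMor.zAct, zAct_reg (he i)]
          simp
        · rw [coeff_single_ne h', map_zero, smul_zero]
    have h2 : (coeff A.env 0).comp (d₀ n A.env) = A.env.d.comp (coeff A.env 0) :=
      hom_ext fun H s m _ => by
        by_cases h : H = 0
        · subst h; simp [coeff_single_self]
        · simp [coeff_single_ne h]
    have h3 : (A.envMul.toLin.comp (coeff A.env 0)).comp (DP.d n A.env e δ) =
        (A.envMul.toLin.comp A.env.d).comp (coeff A.env 0) := by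
      ext p
      have h1' := fun i => LinearMap.congr_fun (h1 i) p
      have h2' := LinearMap.congr_fun h2 p
      simp only [LinearMap.comp_apply, LinearMap.zero_apply] at h1' h2'
      simp only [DP.d, LinearMap.comp_apply, LinearMap.add_apply, LinearMap.sum_apply, map_add,
        map_sum, h1', h2', Finset.sum_const_zero, add_zero]
    exact (LinearMap.congr_fun h3 p).trans (A.envMul.map_d _)

/-- The color DG `Eᵉ`-module `Eᵉ⟨Y | ∂yᵢ = eᵢ ⊗ 1 - 1 ⊗ eᵢ⟩` for the Koszul complex `E`. -/
def koszulDiag {f : Fin n → Q.carrier} {δ : Fin n → G} (h : ∀ i, f i ∈ Q.gr (δ i)) :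
    ColorDGBimod.{u, u} (koszul h) (koszul h) :=
  adjoinDP (koszul h).env (koszulVar_mem h) h (d_koszulVar h)

/-- The augmentation `Eᵉ⟨Y⟩ → E`. -/
def koszulAug {f : Fin n → Q.carrier} {δ : Fin n → G} (h : ∀ i, f i ∈ Q.gr (δ i)) :
    DGMor (koszulDiag h) (koszul h).reg :=
  dpAug (koszulVar_mem h) h (d_koszulVar h)

/-- The element `(a ⊗ b) y^(H)` of `Aᵉ⟨Y⟩`. -/
def dpMk {e : Fin n → A.carrier} {δ : Fin n → G}
    {f : Fin n → Q.carrier} (he : ∀ i, e i ∈ A.gr (1, δ i)) (hf : ∀ i, f i ∈ Q.gr (δ i))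
    (hd : ∀ i, A.d (e i) = A.unit (f i)) (H : Fin n → ℕ) (a b : A.carrier) :
    (adjoinDP A.env he hf hd).carrier :=
  (DP.single A.env H (A.envMk a b) : DPCarrier A.env n)

/-- The divided power monomial `y^(H) = y₁^(h₁) ⋯ y_c^(h_c)` of `Eᵉ⟨Y⟩`. -/
def divPow {f : Fin n → Q.carrier} {δ : Fin n → G} (h : ∀ i, f i ∈ Q.gr (δ i))
    (H : Fin n → ℕ) : (koszulDiag h).carrier :=
  dpMk (koszulVar_mem h) h (d_koszulVar h) H 1 1

/-- The coefficient `∏_{i < j} χ(yᵢ, yⱼ)^{h'ⱼ h''ᵢ}` in the expansion of `Φ(y^(H' + H''))`. -/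
def diagCoeff (χ : AltBichar G k) (δ : Fin n → G) (H' H'' : Fin n → ℕ) : k :=
  ∏ i, ∏ j ∈ Finset.Ioi i, χ.c (δ i) (δ j) ^ (H' j * H'' i)

end DividedPowers

end ColorDG

end

/-!
The actions on Ext. Right linearity of `σ` gives `μ (σ ⊗ ψ) = σ μ (1 ⊗ ψ)` for `ψ : P → A`, so
that `σ ∪ τ = σ τ'` with `τ' = μ (1 ⊗ ε τ) Φ`, an endomorphism of `P` (`comp_cupId`). Both `ε μ (1
⊗ ε τ)` and `ε τ μ (ε ⊗ 1)` send `p ⊗ q` to `± ε(p) ε(τ(q))`; as `μ (ε ⊗ 1) Φ = 1`, it follows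
that `ε τ' = ε τ` (`postcomp_cupId`). Since `P` is semiprojective and `ε` a quasi-isomorphism, `ε`
is injective on `H(Hom(P, P))`; so `τ'` and `τ` are homologous, and `σ ∪ τ` is homologous to `σ
τ`.

The diagonal approximation exists for `Aᵉ⟨Y⟩` over every color DG algebra `A` with elements `eᵢ`
of bidegree `(1, δᵢ)` whose differentials come from `Q`. As an `Aᵉ`-module `Aᵉ⟨Y⟩` is free on the
`y^(H)`, so a morphism to a bimodule `N` is determined by the images `z H` of the `y^(H)`, and it
exists as soon as the `z H` have the right bidegrees and satisfy the formula that computes `∂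
y^(H)` (`dpLift`). Written with commutators, this formula is `∂ y^(H) = ∑ᵢ κᵢ(H) [eᵢ, y^(H -
1ᵢ)]`, where the commutator `[e, m] = χ(m, e) e m - (-1)^{|m|} m e` is `zAct` and `κᵢ(H) = ∏_{j >
i} χ(δᵢ, δⱼ)^{hⱼ}` is `kapRight`. Since `[e, -]` is a derivation of the tensor product over `A`,
the formula for `z H = ∑ c(H', H'') y^(H') ⊗ y^(H'')` comes down to the identities `c(H' + 1ᵢ,
H'') = c(H', H'') kapᵢ(H'')` and `c(H', H'' + 1ᵢ) = c(H', H'') κᵢ(H')`, which follow from the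
bimultiplicativity of `c` (`d_dpDiagElem`). The augmentation kills all `y^(H)` with `H ≠ 0`, and
`c(0, H) = c(H, 0) = 1`, whence co-unitality.
-/

namespace ColorDG

variable {G : Type uG} [AddCommGroup G] {k : Type uk} [Field k] {χ : AltBichar G k}
  {Q : ColorRing.{u} χ}

open ColorDGBimod

/-! ### The cup action and the composition action -/

section Actions

variable {A : ColorDGAlg Q} {P : ColorDGBimod.{u, u} A A} {X : ColorDGBimod.{u, w} A A}

/-- `μ (σ ⊗ ψ) = σ μ (1 ⊗ ψ)`: right linearity of `σ`. -/
theorem rightMulLin_tensMapLin_id {s t : Deg G} (σ : ColorHom s P X) (ψ : ColorHom t P A.reg)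
    (z : TensCarrier P P) :
    σ.toLin (rightMulLin P (tensMapLin (DGMor.id P).toHom ψ z)) =
      rightMulLin X (tensMapLin σ ψ z) := by
  have : σ.toLin.comp ((rightMulLin P).comp (tensMapLin (DGMor.id P).toHom ψ)) =
      (rightMulLin X).comp (tensMapLin σ ψ) := tens_ext fun p m hm q n _ => by
    simp only [LinearMap.comp_apply, tensMapLin_tmk _ _ hm, map_smul]
    congr 1
    refine (congrArg σ.toLin (rightMulLin_tmk P m (ψ.toLin n))).trans ?_
    exact (σ.map_ract _ _).trans (rightMulLin_tmk X (σ.toLin m) (ψ.toLin n)).symm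
  exact LinearMap.congr_fun this z

/-- Both sides send `p ⊗ q` to `± ε(p) ψ(q)`. -/
theorem aug_rightMulLin_tensMapLin {t : Deg G} (ε : DGMor P A.reg) (ψ : ColorHom t P A.reg)
    (z : TensCarrier P P) :
    ε.toLin (rightMulLin P (tensMapLin (DGMor.id P).toHom ψ z)) =
      ψ.toLin (leftMulLin P (tensMapLin ε.toHom (DGMor.id P).toHom z)) := by
  have : ε.toLin.comp ((rightMulLin P).comp (tensMapLin (DGMor.id P).toHom ψ)) =
      ψ.toLin.comp ((leftMulLin P).comp (tensMapLin ε.toHom (DGMor.id P).toHom)) :=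
    tens_ext fun p m hm q n _ => by
      simp only [LinearMap.comp_apply, tensMapLin_tmk _ _ hm, map_smul, χ.β_zero_left, one_smul]
      refine (congrArg (χ.β t p • ε.toLin ·) (rightMulLin_tmk P m (ψ.toLin n))).trans ?_
      refine Eq.trans ?_ (congrArg ψ.toLin (leftMulLin_tmk P (ε.toLin m) n)).symm
      refine Eq.trans ?_ (ψ.map_lact (ε.map_gr hm) n).symm
      exact congrArg (χ.β t p • ·) (ε.map_ract _ _)
  exact LinearMap.congr_fun this z

/-- The endomorphism `μ (1 ⊗ ε τ) Φ` of `P`, the cup product of the identity with `τ`. -/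
noncomputable def cupId (ε : DGMor P A.reg) (Φ : DGMor P (tens P P)) {t : Deg G}
    (τ : ColorHom t P P) : ColorHom t P P :=
  ColorHom.mk (cupFun ε Φ P (DGMor.id P).toHom τ).toLin
    (le_of_eq (congrArg (HomDeg · P P) (zero_add t)) (cupFun ε Φ P (DGMor.id P).toHom τ).2)

theorem comp_cupId {s t : Deg G} (ε : DGMor P A.reg) (Φ : DGMor P (tens P P))
    (σ : ColorHom s P X) (τ : ColorHom t P P) :
    ColorHom.comp s t σ (cupId ε Φ τ) = cupFun ε Φ X σ τ :=
  ColorHom.toLin_injective <| LinearMap.ext fun p =>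
    rightMulLin_tensMapLin_id σ (ε.postcomp t τ) (Φ.toLin p)

theorem cupId_mem_HomZ {t : Deg G} (ε : DGMor P A.reg) (Φ : DGMor P (tens P P))
    {τ : ColorHom t P P} (hτ : τ ∈ HomZ t P P) : cupId ε Φ τ ∈ HomZ t P P := by
  have hid : (DGMor.id P).toHom ∈ HomZ 0 P P := mem_HomZ.2 fun m => by
    simp [DGMor.id]
  have h : cupFun ε Φ P (DGMor.id P).toHom τ ∈ HomZ (0 + t) P P :=
    Φ.precomp_mem_HomZ ((rightMul P).postcomp_mem_HomZ
      (tensMap_mem_HomZ hid (ε.postcomp_mem_HomZ hτ)))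
  rw [mem_HomZ] at h ⊢
  have hs : sg k (0 + t).1 = sg k t.1 := by rw [zero_add]
  exact fun m => (h m).trans (congrArg (· • _) hs)

/-- Because `(ε ⊗ 1) Φ = 1`, the maps `cupId ε Φ τ` and `τ` have the same composite with `ε`. -/
theorem postcomp_cupId {t : Deg G} {ε : DGMor P A.reg} {Φ : DGMor P (tens P P)}
    (hΦ : IsCounitalDiagApprox ε Φ) (τ : ColorHom t P P) :
    ε.postcomp t (cupId ε Φ τ) = ε.postcomp t τ :=
  ColorHom.toLin_injective <| LinearMap.ext fun p =>
    (aug_rightMulLin_tensMapLin ε (ε.postcomp t τ) (Φ.toLin p)).trans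
      (congrArg (fun q => ε.toLin (τ.toLin q)) (hΦ.1 p))

/-- `σ ∪ τ = σ (cupId ε Φ τ)`, and `cupId ε Φ τ` is homologous to `τ` because `ε` is injective on
`H(Hom(P, P))`. -/
theorem cupH_eq_compH {ε : DGMor P A.reg} {Φ : DGMor P (tens P P)} (hP : IsSemiprojective P)
    (hε : ε.IsQuasiIso) (hΦ : IsCounitalDiagApprox ε Φ) (s t : Deg G) :
    cupH ε Φ X s t = compH P X s t := by
  refine LinearMap.ext fun x => LinearMap.ext fun y => ?_
  obtain ⟨σ, rfl⟩ := Submodule.mkQ_surjective _ x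
  obtain ⟨τ, rfl⟩ := Submodule.mkQ_surjective _ y
  let τ' : HomZ t P P := ⟨cupId ε Φ τ.1, cupId_mem_HomZ ε Φ τ.2⟩
  have hττ' : (Submodule.Quotient.mk τ' : HomH t P P) = Submodule.Quotient.mk τ := by
    refine (hP.2 _ _ ε hε t).1 ?_
    exact congrArg (Submodule.Quotient.mk (p := (HomB t P A.reg).submoduleOf (HomZ t P A.reg)))
      (Subtype.ext (postcomp_cupId hΦ τ.1))
  refine Eq.trans ?_ (congrArg (compH P X s t (Submodule.Quotient.mk σ)) hττ')
  exact congrArg Submodule.Quotient.mk (Subtype.ext (comp_cupId ε Φ σ.1 τ.1).symm)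

end Actions

/-! ### Combinatorics of the coefficients -/

section Coefficients

variable {n : ℕ}

/-- The scalar `∏_{j > i} χ(δᵢ, δⱼ)^{hⱼ}`, produced by moving an element of color `δᵢ` to the
right past `y_{i+1}^(h_{i+1}) ⋯ y_n^(h_n)`. -/
noncomputable def kapRight (χ : AltBichar G k) (δ : Fin n → G) (i : Fin n) (H : Fin n → ℕ) : k :=
  ∏ j ∈ Finset.Ioi i, χ.c (δ i) (δ j) ^ H j

theorem kapRight_add (χ : AltBichar G k) (δ : Fin n → G) (i : Fin n) (H K : Fin n → ℕ) :
    kapRight χ δ i (H + K) = kapRight χ δ i H * kapRight χ δ i K := by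
  simp [kapRight, pow_add, Finset.prod_mul_distrib]

@[simp] theorem kapRight_single (χ : AltBichar G k) (δ : Fin n → G) (i : Fin n) :
    kapRight χ δ i (Pi.single i 1) = 1 :=
  Finset.prod_eq_one fun j hj => by simp [(Finset.mem_Ioi.1 hj).ne']

theorem kapRight_sub_single {χ : AltBichar G k} {δ : Fin n → G} {i : Fin n} {H : Fin n → ℕ}
    (h : H i ≠ 0) : kapRight χ δ i (H - Pi.single i 1) = kapRight χ δ i H := by
  conv_rhs => rw [← sub_single_add h, kapRight_add, kapRight_single, mul_one]

theorem AltBichar.c_sum_left (χ : AltBichar G k) {ι : Type*} (s : Finset ι) (g : ι → G)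
    (m : ι → ℕ) (a : G) : χ.c (∑ i ∈ s, m i • g i) a = ∏ i ∈ s, χ.c (g i) a ^ m i := by
  classical
  have hs : ∀ (b : G) (r : ℕ), χ.c (r • b) a = χ.c b a ^ r := fun b r => by
    induction r with
    | zero => simp
    | succ r ih => rw [succ_nsmul, χ.c_add_left, ih, pow_succ]
  induction s using Finset.induction_on with
  | empty => simp
  | insert i s hi ih => rw [Finset.sum_insert hi, Finset.prod_insert hi, χ.c_add_left, ih, hs]

/-- Moving `δᵢ` through all of `y^(H)` amounts to moving it through the part to the left of `yᵢ` and
through the part to the right of `yᵢ`, as `χ(δᵢ, δᵢ) = 1`. -/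
theorem kapRight_mul_c_hdeg (χ : AltBichar G k) (δ : Fin n → G) (i : Fin n) (H : Fin n → ℕ) :
    kapRight χ δ i H * χ.c (hdeg δ H).2 (δ i) = kap χ δ i H := by
  have h : χ.c (hdeg δ H).2 (δ i) =
      (∏ j ∈ Finset.Iio i, χ.c (δ j) (δ i) ^ H j) * ∏ j ∈ Finset.Ioi i, χ.c (δ j) (δ i) ^ H j := by
    rw [hdeg, χ.c_sum_left, ← Finset.prod_union]
    · refine (Finset.prod_subset (Finset.subset_univ _) fun j _ hj => ?_).symm
      have : j = i := by
        by_contra hne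
        rcases lt_or_gt_of_ne hne with h | h <;> simp [h] at hj
      simp [this]
    · exact Finset.disjoint_left.2 fun j h1 h2 =>
        (Finset.mem_Iio.1 h1).asymm (Finset.mem_Ioi.1 h2)
  rw [h, kap, kapRight, mul_left_comm, ← Finset.prod_mul_distrib]
  simp [← mul_pow, χ.c_swap]

theorem kap_mul_c_hdeg (χ : AltBichar G k) (δ : Fin n → G) (i : Fin n) (H : Fin n → ℕ) :
    kap χ δ i H * χ.c (δ i) (hdeg δ H).2 = kapRight χ δ i H := by
  rw [← kapRight_mul_c_hdeg, mul_assoc, χ.c_swap, mul_one]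

theorem diagCoeff_add_left (χ : AltBichar G k) (δ : Fin n → G) (H K L : Fin n → ℕ) :
    diagCoeff χ δ (H + K) L = diagCoeff χ δ H L * diagCoeff χ δ K L := by
  simp [diagCoeff, add_mul, pow_add, Finset.prod_mul_distrib]

theorem diagCoeff_add_right (χ : AltBichar G k) (δ : Fin n → G) (H K L : Fin n → ℕ) :
    diagCoeff χ δ H (K + L) = diagCoeff χ δ H K * diagCoeff χ δ H L := by
  simp [diagCoeff, mul_add, pow_add, Finset.prod_mul_distrib]

@[simp] theorem diagCoeff_zero_left (χ : AltBichar G k) (δ : Fin n → G) (H : Fin n → ℕ) :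
    diagCoeff χ δ 0 H = 1 := by simp [diagCoeff]

@[simp] theorem diagCoeff_zero_right (χ : AltBichar G k) (δ : Fin n → G) (H : Fin n → ℕ) :
    diagCoeff χ δ H 0 = 1 := by simp [diagCoeff]

theorem diagCoeff_single_right (χ : AltBichar G k) (δ : Fin n → G) (i : Fin n) (H : Fin n → ℕ) :
    diagCoeff χ δ H (Pi.single i 1) = kapRight χ δ i H := by
  rw [diagCoeff, Finset.prod_eq_single i]
  · simp [kapRight]
  · intro j _ hj
    simp [hj]
  · simp

theorem diagCoeff_single_left (χ : AltBichar G k) (δ : Fin n → G) (i : Fin n) (H : Fin n → ℕ) :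
    diagCoeff χ δ (Pi.single i 1) H = kap χ δ i H := by
  rw [diagCoeff, kap]
  have : ∀ j : Fin n, ∏ l ∈ Finset.Ioi j, χ.c (δ j) (δ l) ^ ((Pi.single i 1 : Fin n → ℕ) l * H j) =
      if j < i then χ.c (δ j) (δ i) ^ H j else 1 := fun j => by
    split_ifs with h
    · rw [Finset.prod_eq_single i]
      · simp
      · intro l _ hl
        simp [hl]
      · simp [h]
    · refine Finset.prod_eq_one fun l hl => ?_
      have : l ≠ i := by rintro rfl; exact h (Finset.mem_Ioi.1 hl)
      simp [this]
  rw [Finset.prod_congr rfl fun j _ => this j, ← Finset.prod_filter]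
  congr 1
  ext j
  simp

theorem hdeg_add_sub (δ : Fin n → G) {H K : Fin n → ℕ} (h : K ≤ H) :
    hdeg δ K + hdeg δ (H - K) = hdeg δ H := by
  rw [← hdeg_add, add_tsub_cancel_of_le h]

theorem single_le {H : Fin n → ℕ} {i : Fin n} (h : H i ≠ 0) : (Pi.single i 1 : Fin n → ℕ) ≤ H := by
  intro j
  by_cases hj : j = i
  · subst hj; simpa using Nat.one_le_iff_ne_zero.2 h
  · simp [hj]

variable {V : Type*} [AddCommMonoid V]

/-- Substituting `K + 1ᵢ` for `K` in a sum over the `K ≤ H` with `kᵢ ≠ 0`. -/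
theorem sum_Iic_ite_left (H : Fin n → ℕ) (i : Fin n) (F : (Fin n → ℕ) → (Fin n → ℕ) → V) :
    (∑ K ∈ Finset.Iic H, if K i = 0 then 0 else F K (H - K)) =
      if H i = 0 then 0 else ∑ K ∈ Finset.Iic (H - Pi.single i 1),
        F (K + Pi.single i 1) (H - Pi.single i 1 - K) := by
  split_ifs with hi
  · refine Finset.sum_eq_zero fun K hK => if_pos ?_
    exact Nat.le_zero.1 (hi ▸ Finset.mem_Iic.1 hK i)
  · simp_rw [← ite_not (p := _ = 0)]
    rw [← Finset.sum_filter]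
    refine Finset.sum_nbij' (· - Pi.single i 1) (· + Pi.single i 1) ?_ ?_ ?_ ?_ ?_
    · intro K hK
      simp only [Finset.mem_filter, Finset.mem_Iic] at hK ⊢
      exact tsub_le_tsub_right hK.1 _
    · intro K hK
      simp only [Finset.mem_filter, Finset.mem_Iic] at hK ⊢
      exact ⟨(le_tsub_iff_right (single_le hi)).1 hK, by simp⟩
    · intro K hK
      exact tsub_add_cancel_of_le (single_le (Finset.mem_filter.1 hK).2)
    · intro K _
      exact add_tsub_cancel_right _ _
    · intro K hK
      have h := tsub_add_cancel_of_le (single_le (Finset.mem_filter.1 hK).2)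
      rw [h, tsub_tsub, add_comm, h]

/-- Substituting `L + 1ᵢ` for `L = H - K` in a sum over the `K ≤ H` with `lᵢ ≠ 0`. -/
theorem sum_Iic_ite_right (H : Fin n → ℕ) (i : Fin n) (F : (Fin n → ℕ) → (Fin n → ℕ) → V) :
    (∑ K ∈ Finset.Iic H, if (H - K) i = 0 then 0 else F K (H - K)) =
      if H i = 0 then 0 else ∑ K ∈ Finset.Iic (H - Pi.single i 1),
        F K (H - Pi.single i 1 - K + Pi.single i 1) := by
  split_ifs with hi
  · refine Finset.sum_eq_zero fun K hK => if_pos ?_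
    simp [hi]
  · simp_rw [← ite_not (p := _ = 0)]
    rw [← Finset.sum_filter]
    refine Finset.sum_congr ?_ ?_
    · ext K
      simp only [Finset.mem_filter, Finset.mem_Iic]
      constructor
      · rintro ⟨h1, h2⟩
        rw [le_tsub_iff_right (single_le hi), ← le_tsub_iff_left h1]
        exact single_le h2
      · intro h
        have h1 := (le_tsub_iff_right (single_le hi)).1 h
        have h2 := h1 i
        refine ⟨le_trans le_self_add h1, ?_⟩
        simp only [Pi.add_apply, Pi.single_eq_same, Pi.sub_apply] at h2 ⊢
        omega
    · intro K hK
      have h1 := (le_tsub_iff_right (single_le hi)).1 (Finset.mem_Iic.1 hK)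
      have h2 : (H - K) i ≠ 0 := by
        have h2 := h1 i
        simp only [Pi.add_apply, Pi.single_eq_same, Pi.sub_apply] at h2 ⊢
        omega
      rw [tsub_right_comm, sub_single_add h2]

end Coefficients

/-! ### Maps out of the enveloping algebra -/

section EnvLift

variable {A : ColorDGAlg Q} {N : ColorDGBimod.{u, w} A A}

theorem ColorDGAlg.env_ext {V : Type*} [AddCommGroup V] [Module k V]
    {f g : A.env.carrier →ₗ[k] V} (h : ∀ s t (a b : A.carrier), a ∈ A.gr s → b ∈ A.gr t →
      f (A.envMk a b) = g (A.envMk a b)) : f = g :=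
  tens_ext (M := A.reg.restrictRight) (N := A.reg.restrictLeft)
    fun s a ha t b hb => h s t a b ha hb

theorem ColorDGAlg.env_lact (c a b : A.carrier) :
    A.env.lact c (A.envMk a b) = A.envMk (c * a) b :=
  tensLact_tmk (M := A.reg.restrictRight) (N := A.reg.restrictLeft) c a b

theorem ColorDGAlg.env_ract (c a b : A.carrier) :
    A.env.ract c (A.envMk a b) = A.envMk a (b * c) :=
  tensRact_tmk (M := A.reg.restrictRight) (N := A.reg.restrictLeft) c a b

theorem ColorDGAlg.env_d {s : Deg G} {a : A.carrier} (ha : a ∈ A.gr s) (b : A.carrier) :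
    A.env.d (A.envMk a b) = A.envMk (A.d a) b + sg k s.1 • A.envMk a (A.d b) :=
  tensD_tmk (M := A.reg.restrictRight) (N := A.reg.restrictLeft) ha b

theorem ColorDGAlg.envMk_mem {s t : Deg G} {a b : A.carrier} (ha : a ∈ A.gr s) (hb : b ∈ A.gr t) :
    A.envMk a b ∈ A.env.gr (s + t) :=
  tmk_mem (M := A.reg.restrictRight) (N := A.reg.restrictLeft) ha hb

theorem ColorDGAlg.d_envMk_one (A : ColorDGAlg Q) : A.env.d (A.envMk 1 1) = 0 := by
  have h : A.d 1 = 0 := by simpa using A.d_unit 1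
  have h1 : A.envMk 0 1 = 0 :=
    LinearMap.map_zero₂ (tmk A.reg.restrictRight A.reg.restrictLeft) (1 : A.carrier)
  have h2 : A.envMk 1 0 = 0 :=
    map_zero (tmk A.reg.restrictRight A.reg.restrictLeft (1 : A.carrier))
  rw [ColorDGAlg.env_d A.one_mem, h, h1, h2, smul_zero, add_zero]

theorem AltBichar.β_neg_left (χ : AltBichar G k) (s t : Deg G) : χ.β (-s) t = χ.β t s := by
  have h1 : χ.β (-s) t * χ.β s t = 1 := by rw [← χ.β_add_left]; simp
  linear_combination (-χ.β (-s) t) * χ.β_swap s t + χ.β t s * h1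

theorem ColorDGBimod.ract_tw_neg (r : Deg G) {t : Deg G} {b : A.carrier} (hb : b ∈ A.gr t) (m) :
    N.ract (A.tw (-r) b) m = χ.β t r • N.ract b m := by
  rw [ColorDGAlg.tw_of_mem _ hb, map_smul, LinearMap.smul_apply, χ.β_neg_left]

/-- For `z ∈ N` of bidegree `r`, the linear map `Aᵉ → N` with `a ⊗ b ↦ β(b, z) a z b`. If `y` is a
variable of bidegree `r`, it is the restriction to `Aᵉ y` of the linear extension of `y ↦ z`,
since `(a ⊗ b) y = β(b, y) a y b`. -/
noncomputable def envLift {r : Deg G} {z : N.carrier} (hz : z ∈ N.gr r) :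
    A.env.carrier →ₗ[k] N.carrier :=
  tlift (M := A.reg.restrictRight) (N := A.reg.restrictLeft)
    (LinearMap.mk₂ k (fun a b => N.lact a (N.ract (A.tw (-r) b) z))
      (fun a a' b => by rw [map_add, LinearMap.add_apply])
      (fun c a b => by rw [map_smul, LinearMap.smul_apply])
      (fun a b b' => by rw [map_add, map_add, LinearMap.add_apply, map_add])
      (fun c a b => by rw [map_smul, map_smul, LinearMap.smul_apply, map_smul]) :
      A.carrier →ₗ[k] A.carrier →ₗ[k] N.carrier)
    (by
      have key : ∀ (i : ℤ) (c : G) (q : Q.carrier), (q : Q.toDGAlg.carrier) ∈ Q.toDGAlg.gr (i, c) →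
          ∀ a b : A.carrier, N.lact (a * A.unit q) (N.ract (A.tw (-r) b) z) =
            N.lact a (N.ract (A.tw (-r) (A.unit q * b)) z) := by
        intro i c q hq a b
        rcases ColorRing.toDGAlg_cases hq with ⟨rfl, hb⟩ | rfl
        · rw [N.mul_lact, N.lact_ract (A.unit q), N.symm hb hz, ColorDGAlg.tw_mul, N.mul_ract,
            ract_tw_neg r (A.unit_mem hb), χ.β_deg_zero_left]
        · simp
      exact fun s a _ t q hq r b _ => key t.1 t.2 q hq a b)

theorem envLift_envMk {r : Deg G} {z : N.carrier} (hz : z ∈ N.gr r) (a : A.carrier) {t : Deg G}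
    {b : A.carrier} (hb : b ∈ A.gr t) :
    envLift hz (A.envMk a b) = χ.β t r • N.lact a (N.ract b z) := by
  refine (tlift_tmk (M := A.reg.restrictRight) (N := A.reg.restrictLeft) _ _ a b).trans ?_
  exact (congrArg (N.lact a) (ract_tw_neg r hb z)).trans (map_smul _ _ _)

theorem envLift_lact {r : Deg G} {z : N.carrier} (hz : z ∈ N.gr r) (a : A.carrier)
    (w : A.env.carrier) : envLift hz (A.env.lact a w) = N.lact a (envLift hz w) := by
  have : (envLift hz).comp (A.env.lact a) = (N.lact a).comp (envLift hz) :=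
    ColorDGAlg.env_ext fun s t x y _ hy => by
      simp only [LinearMap.comp_apply, ColorDGAlg.env_lact, envLift_envMk hz _ hy, N.mul_lact,
        map_smul]
  exact LinearMap.congr_fun this w

theorem envLift_ract {r : Deg G} {z : N.carrier} (hz : z ∈ N.gr r) {t : Deg G} {b : A.carrier}
    (hb : b ∈ A.gr t) (w : A.env.carrier) :
    envLift hz (A.env.ract b w) = χ.β t r • N.ract b (envLift hz w) := by
  have : (envLift hz).comp (A.env.ract b) = χ.β t r • (N.ract b).comp (envLift hz) :=
    ColorDGAlg.env_ext fun s p x y _ hy => by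
      simp only [LinearMap.comp_apply, LinearMap.smul_apply, ColorDGAlg.env_ract,
        envLift_envMk hz _ hy, envLift_envMk hz _ (A.mul_mem hy hb), N.mul_ract, map_smul,
        smul_smul, N.lact_ract, χ.β_add_left, mul_comm]
  exact LinearMap.congr_fun this w

theorem envLift_mem {r : Deg G} {z : N.carrier} (hz : z ∈ N.gr r) {s : Deg G} {w : A.env.carrier}
    (hw : w ∈ A.env.gr s) : envLift hz w ∈ N.gr (s + r) := by
  refine tensGr_le (M := A.reg.restrictRight) (N := A.reg.restrictLeft) (f := envLift hz) ?_ hw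
  rintro p q rfl x hx y hy
  refine (envLift_envMk hz x hy).symm ▸ Submodule.smul_mem _ _ ?_
  have := N.lact_mem hx (N.ract_mem hz hy)
  rwa [add_comm r, ← add_assoc] at this

/-- The map `envLift` commutes with right multiplication by `e ⊗ 1 - 1 ⊗ e`, up to the scalar that
moves `e` past `z`. -/
theorem envLift_zAct {r : Deg G} {z : N.carrier} (hz : z ∈ N.gr r) {e : A.carrier} {δ : G}
    (he : e ∈ A.gr (1, δ)) (hr : sg k r.1 = 1) (w : A.env.carrier) :
    envLift hz (zAct A.env e δ w) = χ.c δ r.2 • zAct N e δ (envLift hz w) := by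
  have : (envLift hz).comp (zAct A.env e δ) = χ.c δ r.2 • (zAct N e δ).comp (envLift hz) :=
    A.env.isGrading.linext fun s w hw => by
      have h : χ.β (1, δ) r = χ.c δ r.2 := by simp [AltBichar.β, hr]
      simp only [LinearMap.comp_apply, LinearMap.smul_apply, zAct_of_mem hw,
        zAct_of_mem (envLift_mem hz hw), map_sub, map_smul, envLift_lact, envLift_ract hz he, h,
        smul_sub, smul_smul, Prod.fst_add, Prod.snd_add, sg_add, hr, χ.c_add_left, mul_one]
      congr 2
      · linear_combination (-χ.c s.2 δ) * χ.c_swap δ r.2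
      · ring
  exact LinearMap.congr_fun this w

/-- The Leibniz rule `d (w y) = (d w) z + (-1)^{|w|} w (d z)` for `y ↦ z`, where `d z` is a
combination of commutators of the `eᵢ` with elements `z'ᵢ`. -/
theorem d_envLift {ι : Type*} (I : Finset ι) {r : Deg G} {z : N.carrier} (hz : z ∈ N.gr r)
    (hr : sg k r.1 = 1) {e : ι → A.carrier} {δ : ι → G} (he : ∀ i, e i ∈ A.gr (1, δ i))
    {r' : ι → Deg G} {z' : ι → N.carrier} (hz' : ∀ i, z' i ∈ N.gr (r' i))
    (hrr' : ∀ i ∈ I, r' i + (2, δ i) = r) (c : ι → k)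
    (hd : N.d z = ∑ i ∈ I, c i • zAct N (e i) (δ i) (z' i)) (w : A.env.carrier) :
    N.d (envLift hz w) = envLift hz (A.env.d w) +
      ∑ i ∈ I, c i • zAct N (e i) (δ i) (envLift (hz' i) w) := by
  have : N.d.comp (envLift hz) = (envLift hz).comp A.env.d +
      ∑ i ∈ I, c i • (zAct N (e i) (δ i)).comp (envLift (hz' i)) := by
    refine ColorDGAlg.env_ext fun s t a b ha hb => ?_
    have h1 : χ.β (t - one₁ G) r = χ.β t r := by rw [χ.β_sub_one_left, hr, one_mul]
    have h2 : ∀ i ∈ I, zAct N (e i) (δ i) (χ.β t (r' i) • N.lact a (N.ract b (z' i))) =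
        (χ.β t r * sg k s.1) • N.lact a (N.ract b (zAct N (e i) (δ i) (z' i))) := fun i hi => by
      rw [map_smul, zAct_lact (he i) ha (N.ract_mem (hz' i) hb),
        zAct_ract (he i) hb (hz' i), map_smul, smul_smul, smul_smul]
      congr 1
      have h3 : χ.β t r = χ.β t (r' i) * χ.c t.2 (δ i) := by
        have : sg k (t.1 * 2) = 1 := sg_even (by simp)
        rw [← hrr' i hi, χ.β_add_right]
        simp [AltBichar.β, this]
      rw [h3]; ring
    have h4 : ∑ i ∈ I, c i • zAct N (e i) (δ i) (envLift (hz' i) (A.envMk a b)) =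
        (χ.β t r * sg k s.1) • N.lact a (N.ract b (N.d z)) := by
      rw [hd, map_sum, map_sum, Finset.smul_sum]
      refine Finset.sum_congr rfl fun i hi => ?_
      rw [envLift_envMk _ _ hb, h2 i hi, map_smul, map_smul, smul_comm]
    simp only [LinearMap.comp_apply, LinearMap.add_apply, LinearMap.sum_apply,
      LinearMap.smul_apply, h4]
    rw [envLift_envMk hz a hb, map_smul, ColorDGAlg.env_d ha, map_add, map_smul,
      envLift_envMk hz _ hb, envLift_envMk hz _ (A.d_mem hb), h1, N.d_lact ha, N.d_ract hz, hr]
    simp only [map_add, one_smul, smul_add, smul_smul]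
    rw [mul_comm (sg k s.1)]
    abel
  simpa using LinearMap.congr_fun this w

end EnvLift

/-! ### The universal property of `Aᵉ⟨Y⟩` -/

section DPLift

variable {A : ColorDGAlg Q} {n : ℕ} {e : Fin n → A.carrier} {δ : Fin n → G}
  {f : Fin n → Q.carrier} {he : ∀ i, e i ∈ A.gr (1, δ i)} {hf : ∀ i, f i ∈ Q.gr (δ i)}
  {hd : ∀ i, A.d (e i) = A.unit (f i)} {N : ColorDGBimod.{u, w} A A}

theorem dpMk_one_mem (H : Fin n → ℕ) :
    dpMk he hf hd H 1 1 ∈ (adjoinDP A.env he hf hd).gr (hdeg δ H) :=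
  DP.single_mem (M := A.env) (zero_add _) (by simpa using A.envMk_mem A.one_mem A.one_mem)

/-- `(a ⊗ b) y^(H) = β(b, y^(H)) a y^(H) b`, so `Aᵉ⟨Y⟩` is generated by the `y^(H)`. -/
theorem dpMk_eq (H : Fin n → ℕ) (a : A.carrier) {t : Deg G} {b : A.carrier} (hb : b ∈ A.gr t) :
    dpMk he hf hd H a b = χ.β t (hdeg δ H) • (adjoinDP A.env he hf hd).lact a
      ((adjoinDP A.env he hf hd).ract b (dpMk he hf hd H 1 1)) := by
  have h : DP.lact n A.env a (DP.ract n A.env δ b (DP.single A.env H (A.envMk 1 1))) =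
      χ.β (hdeg δ H) t • DP.single A.env H (A.envMk a b) := by
    rw [DP.ract_single_of_mem hb, map_smul, DP.lact_single, ColorDGAlg.env_ract,
      ColorDGAlg.env_lact, one_mul, mul_one]
  refine Eq.trans ?_ (congrArg (χ.β t (hdeg δ H) • ·) h).symm
  change DP.single A.env H (A.envMk a b) = _ • (_ • _ : DPCarrier A.env n)
  rw [smul_smul, χ.β_swap, one_smul]

/-- Linear maps out of `Aᵉ⟨Y⟩` are determined by their values on the monomials `y^(H)`. -/
theorem homDeg_ext {s : Deg G} {g g' : (adjoinDP A.env he hf hd).carrier →ₗ[k] N.carrier}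
    (hg : g ∈ HomDeg s (adjoinDP A.env he hf hd) N)
    (hg' : g' ∈ HomDeg s (adjoinDP A.env he hf hd) N)
    (h : ∀ H, g (dpMk he hf hd H 1 1) = g' (dpMk he hf hd H 1 1)) : g = g' := by
  refine Finsupp.lhom_ext' fun H => ColorDGAlg.env_ext fun p t a b ha hb => ?_
  change g (dpMk he hf hd H a b) = g' (dpMk he hf hd H a b)
  rw [dpMk_eq H a hb, map_smul, map_smul, hg.2.1 p a ha, hg'.2.1 p a ha, hg.2.2, hg'.2.2, h]

theorem DGMor.ext_dpMk {Φ Ψ : DGMor (adjoinDP A.env he hf hd) N}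
    (h : ∀ H, Φ.toLin (dpMk he hf hd H 1 1) = Ψ.toLin (dpMk he hf hd H 1 1)) : Φ = Ψ :=
  DGMor.ext (homDeg_ext Φ.toHom.2 Ψ.toHom.2 h)

/-- In `Aᵉ⟨Y⟩`, the element `(-1)^{|w|} (w z) y^(H)` with `z = eᵢ ⊗ 1 - 1 ⊗ eᵢ` is the commutator of
`eᵢ` with `w y^(H)`, up to the scalar that moves `eᵢ` past `y^(H)`. -/
theorem zAct_adjoinDP (H : Fin n → ℕ) (i : Fin n) (w : A.env.carrier) :
    (DP.single A.env H (zAct A.env (e i) (δ i) w) : DPCarrier A.env n) =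
      χ.c (δ i) (hdeg δ H).2 •
        zAct (adjoinDP A.env he hf hd) (e i) (δ i) (DP.single A.env H w : DPCarrier A.env n) := by
  have : (DP.single A.env H).comp (zAct A.env (e i) (δ i)) = χ.c (δ i) (hdeg δ H).2 •
      (zAct (adjoinDP A.env he hf hd) (e i) (δ i) :
        DPCarrier A.env n →ₗ[k] DPCarrier A.env n).comp (DP.single A.env H) :=
    A.env.isGrading.linext fun s m hm => by
      have h1 : (zAct (adjoinDP A.env he hf hd) (e i) (δ i)
          (DP.single A.env H m : DPCarrier A.env n) : DPCarrier A.env n) =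
            χ.c (s + hdeg δ H).2 (δ i) • DP.lact n A.env (e i) (DP.single A.env H m) -
              sg k (s + hdeg δ H).1 • DP.ract n A.env δ (e i) (DP.single A.env H m) :=
        zAct_of_mem (M := adjoinDP A.env he hf hd) (DP.single_mem rfl hm)
      have h2 : χ.β (hdeg δ H) (1, δ i) = χ.c (hdeg δ H).2 (δ i) := by
        simp [AltBichar.β, sg_hdeg]
      refine Eq.trans ?_ (congrArg
        (fun p : DPCarrier A.env n => χ.c (δ i) (hdeg δ H).2 • p) h1).symm
      simp only [LinearMap.comp_apply, zAct_of_mem hm, map_sub, map_smul,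
        DP.lact_single, DP.ract_single_of_mem (he i), h2, smul_sub, smul_smul, Prod.fst_add,
        Prod.snd_add, sg_add, sg_hdeg, χ.c_add_left, mul_one]
      congr 2
      · linear_combination (-χ.c s.2 (δ i)) * χ.c_swap (δ i) (hdeg δ H).2
      · linear_combination (-sg k s.1) * χ.c_swap (δ i) (hdeg δ H).2
  exact LinearMap.congr_fun this w

/-- `∂ y^(H)` as a combination of commutators. The scalar `kap`, which moves `∂yᵢ` to the left of
`y^(H - 1ᵢ)`, turns into `kapRight` when `eᵢ` is moved on to the right of it. -/
theorem d_dpMk_one (H : Fin n → ℕ) :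
    (adjoinDP A.env he hf hd).d (dpMk he hf hd H 1 1) = ∑ i, if H i = 0 then 0 else
      kapRight χ δ i H • zAct (adjoinDP A.env he hf hd) (e i) (δ i)
        (dpMk he hf hd (H - Pi.single i 1) 1 1) := by
  refine (DP.d_single H (A.envMk 1 1)).trans ?_
  rw [A.d_envMk_one, map_zero, zero_add]
  refine Finset.sum_congr rfl fun i _ => ?_
  rw [DP.dVar_single]
  split_ifs with hi
  · rfl
  · rw [zAct_adjoinDP (he := he) (hf := hf) (hd := hd), ← kapRight_sub_single hi,
      ← kap_mul_c_hdeg, DP.kap_sub_of_le le_rfl, mul_smul]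
    rfl

/-- The linear map `Aᵉ⟨Y⟩ → N` with `y^(H) ↦ z H`. -/
noncomputable def dpLiftLin (N : ColorDGBimod.{u, w} A A) {z : (Fin n → ℕ) → N.carrier}
    (hz : ∀ H, z H ∈ N.gr (hdeg δ H)) : DPCarrier A.env n →ₗ[k] N.carrier :=
  DP.lift fun H => envLift (hz H)

theorem dpLiftLin_single {z : (Fin n → ℕ) → N.carrier} (hz : ∀ H, z H ∈ N.gr (hdeg δ H))
    (H : Fin n → ℕ) (w : A.env.carrier) :
    dpLiftLin N hz (DP.single A.env H w) = envLift (hz H) w := DP.lift_single _ _ _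

/-- Elements `z H` of a bimodule `N` that have the bidegrees of the `y^(H)`, and whose differentials
satisfy the same formula, define a morphism `Aᵉ⟨Y⟩ → N` with `y^(H) ↦ z H`. -/
noncomputable def dpLift {z : (Fin n → ℕ) → N.carrier} (hz : ∀ H, z H ∈ N.gr (hdeg δ H))
    (hdz : ∀ H, N.d (z H) = ∑ i, if H i = 0 then 0 else
      kapRight χ δ i H • zAct N (e i) (δ i) (z (H - Pi.single i 1))) :
    DGMor (adjoinDP A.env he hf hd) N where
  toLin := dpLiftLin N hz
  map_gr := fun {s p} hp => by
    refine DP.map_mem (δ := δ) (f := dpLiftLin N hz) ?_ hp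
    rintro H t rfl m hm
    rw [dpLiftLin_single]
    exact envLift_mem (hz H) hm
  map_lact := fun a p => by
    have : (dpLiftLin N hz).comp (DP.lact n A.env a) = (N.lact a).comp (dpLiftLin N hz) :=
      DP.hom_ext fun H s m _ => by
        simp only [LinearMap.comp_apply, DP.lact_single, dpLiftLin_single, envLift_lact]
    exact LinearMap.congr_fun this p
  map_ract := fun b p => by
    have key : ∀ p : DPCarrier A.env n, (dpLiftLin N hz).comp ((DP.ract n A.env δ).flip p) =
        N.ract.flip (dpLiftLin N hz p) := fun p => A.isGrading.linext fun t b hb => by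
      have : (dpLiftLin N hz).comp (DP.ract n A.env δ b) = (N.ract b).comp (dpLiftLin N hz) :=
        DP.hom_ext fun H s m _ => by
          simp only [LinearMap.comp_apply, DP.ract_single_of_mem hb, map_smul, dpLiftLin_single,
            envLift_ract (hz H) hb, smul_smul, χ.β_swap, one_smul]
      exact LinearMap.congr_fun this p
    exact LinearMap.congr_fun (key p) b
  map_d := fun p => by
    have : (dpLiftLin N hz).comp (DP.d n A.env e δ) = N.d.comp (dpLiftLin N hz) :=
      DP.hom_ext fun H s m _ => by
        have h := d_envLift (Finset.univ.filter fun i => ¬ H i = 0) (hz H) (sg_hdeg δ H) he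
          (fun i => hz (H - Pi.single i 1))
          (fun i hi => hdeg_sub_single δ (Finset.mem_filter.1 hi).2) (fun i => kapRight χ δ i H)
          (by rw [hdz, Finset.sum_filter]; simp_rw [ite_not]) m
        rw [LinearMap.comp_apply, LinearMap.comp_apply, DP.d_single, map_add, map_sum,
          dpLiftLin_single, dpLiftLin_single, h, Finset.sum_filter]
        congr 1
        refine Finset.sum_congr rfl fun i _ => ?_
        rw [DP.dVar_single, ite_not]
        split_ifs with hi
        · rw [map_zero]
        · rw [map_smul, dpLiftLin_single, envLift_zAct _ (he i) (sg_hdeg δ _), smul_smul,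
            ← kapRight_sub_single hi, ← kap_mul_c_hdeg, DP.kap_sub_of_le le_rfl]
    exact LinearMap.congr_fun this p

theorem dpLift_dpMk {z : (Fin n → ℕ) → N.carrier} (hz : ∀ H, z H ∈ N.gr (hdeg δ H)) (hdz)
    (H : Fin n → ℕ) :
    (dpLift (he := he) (hf := hf) (hd := hd) hz hdz).toLin (dpMk he hf hd H 1 1) = z H := by
  refine (dpLiftLin_single hz H (A.envMk 1 1)).trans ?_
  rw [envLift_envMk _ _ A.one_mem, N.one_ract, N.one_lact, χ.β_zero_left, one_smul]

end DPLift

/-! ### The diagonal approximation of `Aᵉ⟨Y⟩` -/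

section Diagonal

variable {A : ColorDGAlg Q}

/-- The commutator with `e` is a derivation of the tensor product over `A`: the terms `m e ⊗ n` and
`m ⊗ e n` cancel. -/
theorem zAct_tmk {M : ColorDGBimod.{u, v} A A} {N : ColorDGBimod.{u, w} A A} {e : A.carrier} {δ : G}
    {s t : Deg G} {m n} (hm : m ∈ M.gr s) (hn : n ∈ N.gr t) :
    zAct (tens M N) e δ (tmk M N m n) =
      χ.c t.2 δ • tmk M N (zAct M e δ m) n + sg k s.1 • tmk M N m (zAct N e δ n) := by
  have h : zAct (tens M N) e δ (tmk M N m n) = χ.c (s + t).2 δ • tensLact M N e (tmk M N m n) -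
      sg k (s + t).1 • tensRact M N e (tmk M N m n) :=
    zAct_of_mem (M := tens M N) (tmk_mem hm hn)
  refine h.trans ?_
  simp only [tensLact_tmk, tensRact_tmk, zAct_of_mem hm, zAct_of_mem hn, map_sub, map_smul,
    LinearMap.sub_apply, LinearMap.smul_apply, tmk_ract, smul_sub, smul_smul, Prod.fst_add,
    Prod.snd_add, sg_add, χ.c_add_left]
  rw [mul_comm (χ.c s.2 δ), mul_comm (sg k s.1) (χ.c t.2 δ)]
  abel

variable {n : ℕ} {e : Fin n → A.carrier} {δ : Fin n → G}
  {f : Fin n → Q.carrier} (he : ∀ i, e i ∈ A.gr (1, δ i)) (hf : ∀ i, f i ∈ Q.gr (δ i))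
  (hd : ∀ i, A.d (e i) = A.unit (f i))

/-- The element `∑_{H' + H'' = H} (∏_{i < j} χ(yᵢ, yⱼ)^{h'ⱼ h''ᵢ}) y^(H') ⊗ y^(H'')` of
`Aᵉ⟨Y⟩ ⊗_A Aᵉ⟨Y⟩`. -/
noncomputable def dpDiagElem (H : Fin n → ℕ) :
    (tens (adjoinDP A.env he hf hd) (adjoinDP A.env he hf hd)).carrier :=
  ∑ K ∈ Finset.Iic H, diagCoeff χ δ K (H - K) •
    tmk _ _ (dpMk he hf hd K 1 1) (dpMk he hf hd (H - K) 1 1)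

theorem dpDiagElem_mem (H : Fin n → ℕ) : dpDiagElem he hf hd H ∈
    (tens (adjoinDP A.env he hf hd) (adjoinDP A.env he hf hd)).gr (hdeg δ H) :=
  Submodule.sum_mem _ fun _ hK => Submodule.smul_mem _ _
    (tmk_mem_tens (hdeg_add_sub δ (Finset.mem_Iic.1 hK)) (dpMk_one_mem _) (dpMk_one_mem _))

/-- The elements `dpDiagElem` satisfy the formula for `∂ y^(H)`. -/
theorem d_dpDiagElem (H : Fin n → ℕ) :
    (tens (adjoinDP A.env he hf hd) (adjoinDP A.env he hf hd)).d (dpDiagElem he hf hd H) =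
      ∑ i, if H i = 0 then 0 else kapRight χ δ i H •
        zAct (tens (adjoinDP A.env he hf hd) (adjoinDP A.env he hf hd)) (e i) (δ i)
          (dpDiagElem he hf hd (H - Pi.single i 1)) := by
  let P := adjoinDP A.env he hf hd
  let y : (Fin n → ℕ) → P.carrier := fun K => dpMk he hf hd K 1 1
  let Z : Fin n → P.carrier →ₗ[k] P.carrier := fun i => zAct P (e i) (δ i)
  let F₁ : Fin n → (Fin n → ℕ) → (Fin n → ℕ) → TensCarrier P P := fun i K L =>
    (diagCoeff χ δ K L * kapRight χ δ i K) • tmk P P (Z i (y (K - Pi.single i 1))) (y L)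
  let F₂ : Fin n → (Fin n → ℕ) → (Fin n → ℕ) → TensCarrier P P := fun i K L =>
    (diagCoeff χ δ K L * kapRight χ δ i L) • tmk P P (y K) (Z i (y (L - Pi.single i 1)))
  have hy : ∀ K, y K ∈ P.gr (hdeg δ K) := fun K => dpMk_one_mem K
  have hdy : ∀ K, P.d (y K) = ∑ i, if K i = 0 then 0 else
      kapRight χ δ i K • Z i (y (K - Pi.single i 1)) := fun K => d_dpMk_one K
  change tensD P P (∑ K ∈ Finset.Iic H, diagCoeff χ δ K (H - K) • tmk P P (y K) (y (H - K))) = _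
  have hL : tensD P P (∑ K ∈ Finset.Iic H, diagCoeff χ δ K (H - K) • tmk P P (y K) (y (H - K))) =
      ∑ i, ((∑ K ∈ Finset.Iic H, if K i = 0 then 0 else F₁ i K (H - K)) +
        ∑ K ∈ Finset.Iic H, if (H - K) i = 0 then 0 else F₂ i K (H - K)) := by
    simp only [← Finset.sum_add_distrib]
    rw [Finset.sum_comm, map_sum]
    refine Finset.sum_congr rfl fun K _ => ?_
    rw [map_smul, tensD_tmk (hy K), sg_hdeg, one_smul, hdy, hdy, map_sum, map_sum,
      LinearMap.sum_apply, ← Finset.sum_add_distrib, Finset.smul_sum]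
    refine Finset.sum_congr rfl fun i _ => ?_
    rw [smul_add]
    congr 1
    · split_ifs
      · simp
      · simp only [F₁, map_smul, LinearMap.smul_apply, smul_smul]
    · split_ifs
      · simp
      · simp only [F₂, map_smul, smul_smul]
  rw [hL]
  -- Substitute `K + 1ᵢ` for `K` in the first sum, and `L + 1ᵢ` for `L = H - K` in the second one.
  refine Finset.sum_congr rfl fun i _ => ?_
  rw [sum_Iic_ite_left H i (F₁ i), sum_Iic_ite_right H i (F₂ i)]
  split_ifs with hi
  · exact add_zero _
  change _ = kapRight χ δ i H • zAct (tens P P) (e i) (δ i)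
    (∑ K ∈ Finset.Iic (H - Pi.single i 1), diagCoeff χ δ K (H - Pi.single i 1 - K) •
      tmk P P (y K) (y (H - Pi.single i 1 - K)))
  rw [← kapRight_sub_single hi]
  generalize H - Pi.single i 1 = H₁
  have hz : ∀ K L, zAct (tens P P) (e i) (δ i) (tmk P P (y K) (y L)) =
      χ.c (hdeg δ L).2 (δ i) • tmk P P (Z i (y K)) (y L) + tmk P P (y K) (Z i (y L)) :=
    fun K L => (zAct_tmk (hy K) (hy L)).trans (by rw [sg_hdeg, one_smul])
  rw [← Finset.sum_add_distrib]
  refine Eq.trans ?_ (congrArg (kapRight χ δ i H₁ • ·) (map_sum _ _ _)).symm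
  refine Eq.trans ?_ Finset.smul_sum.symm
  refine Finset.sum_congr rfl fun K hK => ?_
  have hKL : kapRight χ δ i H₁ = kapRight χ δ i K * kapRight χ δ i (H₁ - K) := by
    rw [← kapRight_add, add_tsub_cancel_of_le (Finset.mem_Iic.1 hK)]
  generalize H₁ - K = L at hKL ⊢
  refine Eq.trans ?_ (congrArg (kapRight χ δ i H₁ • ·)
    ((map_smul (zAct (tens P P) (e i) (δ i)) _ _).trans
      (congrArg (diagCoeff χ δ K L • ·) (hz K L)))).symm
  change F₁ i (K + Pi.single i 1) L + F₂ i K (L + Pi.single i 1) =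
    kapRight χ δ i H₁ • diagCoeff χ δ K L •
      (χ.c (hdeg δ L).2 (δ i) • tmk P P (Z i (y K)) (y L) + tmk P P (y K) (Z i (y L)))
  simp only [F₁, F₂, add_tsub_cancel_right, smul_add, smul_smul, diagCoeff_add_left,
    diagCoeff_add_right, diagCoeff_single_left, diagCoeff_single_right, kapRight_add,
    kapRight_single, hKL, ← kapRight_mul_c_hdeg]
  congr 2 <;> ring

/-- The diagonal `Aᵉ⟨Y⟩ → Aᵉ⟨Y⟩ ⊗_A Aᵉ⟨Y⟩` given by the divided power formula. -/
noncomputable def dpDiag : DGMor (adjoinDP A.env he hf hd)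
    (tens (adjoinDP A.env he hf hd) (adjoinDP A.env he hf hd)) :=
  dpLift (dpDiagElem_mem he hf hd) (d_dpDiagElem he hf hd)

theorem dpDiag_dpMk (H : Fin n → ℕ) : (dpDiag he hf hd).toLin (dpMk he hf hd H 1 1) =
    ∑ K ∈ Finset.Iic H, diagCoeff χ δ K (H - K) •
      tmk _ _ (dpMk he hf hd K 1 1) (dpMk he hf hd (H - K) 1 1) :=
  dpLift_dpMk _ _ H

theorem dpAug_dpMk (H : Fin n → ℕ) :
    (dpAug he hf hd).toLin (dpMk he hf hd H 1 1) =
      if H = 0 then (1 : A.carrier) else (0 : A.carrier) := by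
  change A.envMul.toLin (DP.coeff A.env 0 (DP.single A.env H (A.envMk 1 1))) = _
  split_ifs with h
  · subst h
    rw [DP.coeff_single_self]
    exact (A.envMulLin_tmk 1 1).trans (mul_one (M := A.carrier) 1)
  · rw [DP.coeff_single_ne h, map_zero]
    rfl

/-- Both composites are `Aᵉ`-linear, so it suffices to evaluate them on `y^(H)`, where only the
summands `1 ⊗ y^(H)`, respectively `y^(H) ⊗ 1`, survive the augmentation. -/
theorem isCounitalDiagApprox_dpDiag : IsCounitalDiagApprox (dpAug he hf hd) (dpDiag he hf hd) := by
  let P := adjoinDP A.env he hf hd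
  let ε : DGMor P A.reg := dpAug he hf hd
  let Φ : DGMor P (tens P P) := dpDiag he hf hd
  have hid : (DGMor.id P).toLin ∈ HomDeg (0 + 0) P P :=
    le_of_eq (congrArg (HomDeg · P P) (zero_add 0).symm) (DGMor.id P).toHom.2
  constructor
  · refine LinearMap.congr_fun (homDeg_ext (Φ.precomp ((leftMul P).postcomp (0 + 0)
      (tensMap ε.toHom (DGMor.id P).toHom))).2 hid fun H => ?_)
    change leftMulLin P (tensMapLin ε.toHom (DGMor.id P).toHom (Φ.toLin (dpMk he hf hd H 1 1))) =
      dpMk he hf hd H 1 1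
    have hK : ∀ K L : Fin n → ℕ, leftMulLin P (tensMapLin ε.toHom (DGMor.id P).toHom
        (tmk P P (dpMk he hf hd K 1 1) (dpMk he hf hd L 1 1))) =
          if K = 0 then dpMk he hf hd L 1 1 else 0 := fun K L => by
      rw [tensMapLin_tmk _ _ (dpMk_one_mem K), χ.β_zero_left, one_smul]
      refine (leftMulLin_tmk P (ε.toLin (dpMk he hf hd K 1 1)) (dpMk he hf hd L 1 1)).trans ?_
      rw [show ε.toLin (dpMk he hf hd K 1 1) = _ from dpAug_dpMk he hf hd K]
      split_ifs
      · exact P.one_lact _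
      · rw [map_zero, LinearMap.zero_apply]
    rw [show Φ.toLin (dpMk he hf hd H 1 1) = _ from dpDiag_dpMk he hf hd H, map_sum, map_sum,
      Finset.sum_eq_single 0]
    · rw [map_smul, map_smul, hK, if_pos rfl, diagCoeff_zero_left, one_smul, tsub_zero]
    · intro K _ hK0
      rw [map_smul, map_smul, hK, if_neg hK0, smul_zero]
    · simp
  · refine LinearMap.congr_fun (homDeg_ext (Φ.precomp ((rightMul P).postcomp (0 + 0)
      (tensMap (DGMor.id P).toHom ε.toHom))).2 hid fun H => ?_)
    change rightMulLin P (tensMapLin (DGMor.id P).toHom ε.toHom (Φ.toLin (dpMk he hf hd H 1 1))) =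
      dpMk he hf hd H 1 1
    have hK : ∀ K L : Fin n → ℕ, rightMulLin P (tensMapLin (DGMor.id P).toHom ε.toHom
        (tmk P P (dpMk he hf hd K 1 1) (dpMk he hf hd L 1 1))) =
          if L = 0 then dpMk he hf hd K 1 1 else 0 := fun K L => by
      rw [tensMapLin_tmk _ _ (dpMk_one_mem K), χ.β_zero_left, one_smul]
      refine (rightMulLin_tmk P (dpMk he hf hd K 1 1) (ε.toLin (dpMk he hf hd L 1 1))).trans ?_
      rw [show ε.toLin (dpMk he hf hd L 1 1) = _ from dpAug_dpMk he hf hd L]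
      split_ifs
      · exact P.one_ract _
      · rw [map_zero, LinearMap.zero_apply]
    rw [show Φ.toLin (dpMk he hf hd H 1 1) = _ from dpDiag_dpMk he hf hd H, map_sum, map_sum,
      Finset.sum_eq_single H]
    · rw [map_smul, map_smul, hK, tsub_self, if_pos rfl, diagCoeff_zero_right, one_smul]
    · intro K hKH hKne
      have : H - K ≠ 0 := fun h =>
        hKne (le_antisymm (Finset.mem_Iic.1 hKH) (tsub_eq_zero_iff_le.1 h))
      rw [map_smul, map_smul, hK, if_neg this, smul_zero]
    · simp

theorem sum_Iic_single {V : Type*} [AddCommMonoid V] (i : Fin n)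
    (F : (Fin n → ℕ) → (Fin n → ℕ) → V) :
    ∑ K ∈ Finset.Iic (Pi.single i 1), F K (Pi.single i 1 - K) =
      F (Pi.single i 1) 0 + F 0 (Pi.single i 1) := by
  have h : Finset.Iic (Pi.single i 1 : Fin n → ℕ) = {Pi.single i 1, 0} := by
    ext K
    simp only [Finset.mem_Iic, Finset.mem_insert, Finset.mem_singleton]
    constructor
    · intro hK
      have h0 : ∀ j, j ≠ i → K j = 0 := fun j hj => by simpa [hj] using hK j
      have h1 : K i ≤ 1 := by simpa using hK i
      rcases Nat.le_one_iff_eq_zero_or_eq_one.1 h1 with h1 | h1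
      · right; ext j
        by_cases hj : j = i
        · subst hj; exact h1
        · exact h0 j hj
      · left; ext j
        by_cases hj : j = i
        · subst hj; simpa using h1
        · simpa [hj] using h0 j hj
    · rintro (rfl | rfl)
      · exact le_rfl
      · exact fun _ => Nat.zero_le _
  rw [h, Finset.sum_pair (by simp), tsub_self, tsub_zero]

/-- For `H = 1ᵢ` the divided power formula reads `yᵢ ↦ yᵢ ⊗ 1 + 1 ⊗ yᵢ`. -/
theorem dpDiag_dpMk_single (i : Fin n) :
    (dpDiag he hf hd).toLin (dpMk he hf hd (Pi.single i 1) 1 1) =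
      tmk _ _ (dpMk he hf hd (Pi.single i 1) 1 1) (dpMk he hf hd 0 1 1) +
        tmk _ _ (dpMk he hf hd 0 1 1) (dpMk he hf hd (Pi.single i 1) 1 1) := by
  refine (dpDiag_dpMk he hf hd _).trans ((sum_Iic_single i fun K L => diagCoeff χ δ K L •
    tmk _ _ (dpMk he hf hd K 1 1) (dpMk he hf hd L 1 1)).trans ?_)
  rw [diagCoeff_zero_left, diagCoeff_zero_right, one_smul, one_smul]

end Diagonal

end ColorDG

theorem mainTheorem12 {G : Type uG} [AddCommGroup G] {k : Type uk} [Field k]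
    (χ : ColorDG.AltBichar G k) (Q : ColorDG.ColorRing.{u} χ) :
    -- the cup and composition actions of `Ext(A, A)` on `Ext(A, X)` coincide
    (∀ (A : ColorDG.ColorDGAlg Q) (P : ColorDG.ColorDGBimod.{u, u} A A)
      (ε : ColorDG.DGMor P A.reg) (hP : ColorDG.IsSemiprojective P) (hε : ε.IsQuasiIso)
      (Φ : ColorDG.DGMor P (ColorDG.ColorDGBimod.tens P P)),
      ColorDG.IsCounitalDiagApprox ε Φ →
      ∀ (X : ColorDG.ColorDGBimod.{u, w} A A) (s t : ColorDG.Deg G),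
        ColorDG.extCup ε Φ X hP hε s t = ColorDG.extComp ε X hP hε s t) ∧
    -- `Eᵉ⟨Y⟩ → E` admits a co-unital diagonal approximation, determined by `y ↦ y ⊗ 1 + 1 ⊗ y`
    (∀ (c : ℕ) (f : Fin c → Q.carrier) (δ : Fin c → G) (h : ∀ i, f i ∈ Q.gr (δ i)),
      ∃! Φ : ColorDG.DGMor (ColorDG.koszulDiag h)
          (ColorDG.ColorDGBimod.tens (ColorDG.koszulDiag h) (ColorDG.koszulDiag h)),
        ColorDG.IsCounitalDiagApprox (ColorDG.koszulAug h) Φ ∧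
        (∀ i, Φ.toLin (ColorDG.divPow h (Pi.single i 1)) =
          ColorDG.ColorDGBimod.tmk _ _ (ColorDG.divPow h (Pi.single i 1)) (ColorDG.divPow h 0) +
          ColorDG.ColorDGBimod.tmk _ _ (ColorDG.divPow h 0) (ColorDG.divPow h (Pi.single i 1))) ∧
        ∀ H : Fin c → ℕ, Φ.toLin (ColorDG.divPow h H) =
          ∑ H' ∈ Finset.Iic H, ColorDG.diagCoeff χ δ H' (H - H') •
            ColorDG.ColorDGBimod.tmk _ _ (ColorDG.divPow h H') (ColorDG.divPow h (H - H'))) := by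
  refine ⟨fun A P ε hP hε Φ hΦ X s t => ?_, fun c f δ h => ?_⟩
  · rw [ColorDG.extCup, ColorDG.extComp, ColorDG.cupH_eq_compH hP hε hΦ]
  · exact ⟨ColorDG.dpDiag (ColorDG.koszulVar_mem h) h (ColorDG.d_koszulVar h),
      ⟨ColorDG.isCounitalDiagApprox_dpDiag _ _ _, ColorDG.dpDiag_dpMk_single _ _ _,
        ColorDG.dpDiag_dpMk _ _ _⟩,
      fun Ψ hΨ => ColorDG.DGMor.ext_dpMk fun H =>
        (hΨ.2.2 H).trans (ColorDG.dpDiag_dpMk _ _ _ H).symm⟩
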